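/- **Conventions.** A polynomial endofunctor on $\mathbf{Set}/I$ is a diagram of sets $I \xleftarrow{s} E \xrightarrow{p} B \xrightarrow{t} I$ with $p$ of finite fibres; write $E_b = p^{-1}(b)$. A polynomial monad $P$ is such a diagram with a monoid structure for composition of functors and cartesian natural transformations. The set $\operatorname{tr}(P)$ of isomorphism classes of $P$-trees (finite rooted trees with nodes decorated in $B$, edges decorated in $I$, the input edges of a node decorated by $b$ being identified with $E_b$, compatibly with $s$ and $t$) is the least fixpoint of $X \mapsto I + P(X)$. The Baez–Dolan construction $P^+$ is the polynomial monad $B \leftarrow \operatorname{tr}^\bullet(P) \to \operatorname{tr}(P) \to B$, where $\operatorname{tr}^\bullet(P)$ is the set of $P$-trees with a marked node; the maps return the decoration of the marked node, forget the mark, and contract all inner edges using the multiplication of $P$ (a unit tree going to a unit of $P$); the multiplication of $P^+$ substitutes $P$-trees into nodes, and its unit is the inclusion of one-node trees. A *$P$-constellation* consists of a $P$-tree $T$, a subdivision $T'$ of $T$ (each edge replaced by a linear tree, whose dots are called white; the dots of $T$ are called black), a finite rooted tree $N$ (possibly the unit tree, with one leaf and no dots), and bijections from the black dots of $T'$ to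 the leaves of $N$ and from the white dots of $T'$ to the null-dots of $N$ (dots without inputs), such that for each dot $x$ of $N$ the dots of $T'$ corresponding to elements below $x$ form a kernel, i.e. span a non-empty connected subgraph of $T'$. The dots of $N$ are called the spheres, or the layers, of the constellation. The $P$-tree seen in the layer $x$ is the part of $T'$ contained in $x$, where the part contained in each child of $x$ is contracted to one node by means of the monad structure of $P$ (white dots counting as units); it is a unit tree if $x$ is a null-dot. Let $\operatorname{const}(P)$ and $\operatorname{const}^\circ(P)$ be the sets of isomorphism classes of $P$-constellations and of $P$-constellations with a marked layer, and consider the polynomial endofunctor $$\operatorname{tr}(P) \leftarrow \operatorname{const}^\circ(P) \to \operatorname{const}(P) \to \operatorname{tr}(P),$$ whose maps return the tree seen in the marked layer, forget the mark, and return the underlying tree $T$. **Theorem.** Let $P$ be a polynomial monad. (1) There is exactly one monad structure on this endofunctor (the *$P$-constellation monad*) whose unit sends a $P$-tree to the constellation with a single sphere around that tree, and whose multiplication is the substitution of constellations into layers: into each layer $x$ of a constellation $C$ one substitutes a constellation whose underlying tree is the tree seen in the layer $x$ of $C$, and the layers of the result are the layers of the constellations substituted. (2) There is an isomorphism of polynomial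 monads, over the identity of $\operatorname{tr}(P)$, from the $P$-constellation monad to $P^{++}$, i.e. there are bijections $\operatorname{const}(P) \cong \operatorname{tr}(P^+)$ and $\operatorname{const}^\circ(P) \cong \operatorname{tr}^\bullet(P^+)$ compatible with the source maps, forgetful maps and target maps and with units and multiplications. It is the following natural one: it sends a constellation $C$ to its composition tree, that is, the tree $N$ with each dot $x$ decorated by the $P$-tree seen in the layer $x$, where the input edges of $x$ correspond to the nodes of that tree as the children of $x$ do, and with each leaf decorated by the operation at the corresponding black dot; and it sends the layer $x$ to the node $x$. -/

import Mathlib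

universe u

/-- A polynomial endofunctor on `Set/I`, given by a diagram `I ← E → B → I` whose middle map has
finite fibres: `B` is `Op`, the fibre of `E → B` over `b` is `Ar b`, and `src`, `tgt` are the
outer maps. -/
structure PolyEndo (I : Type u) where
  Op : Type u
  Ar : Op → Type u
  finite_ar : ∀ b, Finite (Ar b)
  src : ∀ b, Ar b → I
  tgt : Op → I

namespace PolyEndo

/-- A family of operations, one for each input of `b`, with matching types. Pairs `(b, c)` with
`c : P.Fam b` are the operations of `P ∘ P` (two-level trees). -/
def Fam {I : Type u} (P : PolyEndo I) (b : P.Op) : Type u :=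
  {c : P.Ar b → P.Op // ∀ e, P.tgt (c e) = P.src b e}

/-- The total space `E` of inputs. Equations between inputs of operations that are only
propositionally equal are stated in it. -/
abbrev Input {I : Type u} (P : PolyEndo I) : Type u := Σ b : P.Op, P.Ar b

/-- A monad structure on a polynomial endofunctor, i.e. a monoid structure in the category of
polynomial endofunctors on `Set/I` and cartesian natural transformations: the unit is the map
`one : I → B` over `I` together with the fact that the fibre over `one i` is a point over `i`; the
multiplication is `mul` together with the bijections `pos` over `I` between the inputs of a
two-level tree and those of its composite. The unit and associativity laws are required for
operations and for inputs. -/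
structure MonadStr {I : Type u} (P : PolyEndo I) where
  one : I → P.Op
  tgt_one : ∀ i, P.tgt (one i) = i
  pt : ∀ i, P.Ar (one i)
  eq_pt : ∀ i (e : P.Ar (one i)), e = pt i
  src_pt : ∀ i, P.src (one i) (pt i) = i
  mul : ∀ b, P.Fam b → P.Op
  tgt_mul : ∀ b c, P.tgt (mul b c) = P.tgt b
  pos : ∀ b (c : P.Fam b), (Σ e : P.Ar b, P.Ar (c.1 e)) ≃ P.Ar (mul b c)
  src_pos : ∀ b c x, P.src _ (pos b c x) = P.src _ x.2
  mul_one : ∀ b, mul b ⟨fun e => one (P.src b e), fun _ => tgt_one _⟩ = b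
  mul_one_pos : ∀ b e,
    (⟨_, pos b ⟨fun e => one (P.src b e), fun _ => tgt_one _⟩ ⟨e, pt _⟩⟩ : P.Input) = ⟨b, e⟩
  one_mul : ∀ i (c : P.Fam (one i)), mul (one i) c = c.1 (pt i)
  one_mul_pos : ∀ i (c : P.Fam (one i)) f, (⟨_, pos (one i) c ⟨pt i, f⟩⟩ : P.Input) = ⟨_, f⟩
  assoc : ∀ b (c : P.Fam b) (d : P.Fam (mul b c)),
    mul (mul b c) d =
      mul b ⟨fun e => mul (c.1 e) ⟨fun f => d.1 (pos b c ⟨e, f⟩),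
          fun f => (d.2 _).trans (src_pos b c ⟨e, f⟩)⟩,
        fun e => (tgt_mul _ _).trans (c.2 e)⟩
  assoc_pos : ∀ b (c : P.Fam b) (d : P.Fam (mul b c)) (e : P.Ar b) (f : P.Ar (c.1 e))
      (g : P.Ar (d.1 (pos b c ⟨e, f⟩))),
    (⟨_, pos (mul b c) d ⟨pos b c ⟨e, f⟩, g⟩⟩ : P.Input) =
      ⟨_, pos b ⟨fun e => mul (c.1 e) ⟨fun f => d.1 (pos b c ⟨e, f⟩),
            fun f => (d.2 _).trans (src_pos b c ⟨e, f⟩)⟩,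
          fun e => (tgt_mul _ _).trans (c.2 e)⟩
        ⟨e, pos (c.1 e) ⟨fun f => d.1 (pos b c ⟨e, f⟩),
            fun f => (d.2 _).trans (src_pos b c ⟨e, f⟩)⟩ ⟨f, g⟩⟩⟩

/-- Trees with nodes decorated by operations of `P`, with the inputs of each node indexed by the
arity of its decoration; `edge i` is the unit tree with its edge decorated by `i`. -/
inductive PreTree {I : Type u} (P : PolyEndo I) : Type u
  | edge (i : I) : PreTree P
  | node (b : P.Op) (ch : P.Ar b → PreTree P) : PreTree P

namespace PreTree
variable {I J : Type u} {P : PolyEndo I} {Q : PolyEndo J}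

/-- The decoration of the root edge. -/
def root : PreTree P → I
  | edge i => i
  | node b _ => P.tgt b

/-- The compatibility condition for decorations. -/
def Valid : PreTree P → Prop
  | edge _ => True
  | node b ch => ∀ e, (ch e).root = P.src b e ∧ (ch e).Valid

/-- The leaves of a tree. -/
def Leaf : PreTree P → Type u
  | edge _ => PUnit
  | node b ch => Σ e : P.Ar b, (ch e).Leaf

/-- The decoration of a leaf. -/
def leafType : (T : PreTree P) → T.Leaf → I
  | edge i, _ => i
  | node _ ch, l => (ch l.1).leafType l.2

/-- The nodes (dots) of a tree; `none` is the root node. -/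
def Node : PreTree P → Type u
  | edge _ => PEmpty
  | node b ch => Option (Σ e : P.Ar b, (ch e).Node)

/-- The operation decorating a node. -/
def dec : (T : PreTree P) → T.Node → P.Op
  | edge _, n => n.elim
  | node b _, none => b
  | node _ ch, some n => (ch n.1).dec n.2

theorem finite_node (T : PreTree P) : Finite T.Node := by
  induction T with
  | edge i => exact (inferInstance : Finite PEmpty.{u+1})
  | node b ch ih =>
    have := P.finite_ar b
    exact (inferInstance : Finite (Option (Σ e : P.Ar b, (ch e).Node)))

/-- Grafting a tree onto each leaf. -/
def graft : (T : PreTree P) → (T.Leaf → PreTree P) → PreTree P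
  | edge _, g => g PUnit.unit
  | node b ch, g => node b fun e => (ch e).graft fun l => g ⟨e, l⟩

/-- A leaf of a grafted tree is a leaf of one of the trees grafted on. -/
def graftLeaf : (T : PreTree P) → (g : T.Leaf → PreTree P) → (T.graft g).Leaf →
    Σ l, (g l).Leaf
  | edge _, _, l => ⟨PUnit.unit, l⟩
  | node _ ch, g, l =>
    let r := (ch l.1).graftLeaf (fun k => g ⟨l.1, k⟩) l.2
    ⟨⟨l.1, r.1⟩, r.2⟩

/-- A node of a grafted tree is a node of the lower tree or of one of the trees grafted on. -/
def graftNode : (T : PreTree P) → (g : T.Leaf → PreTree P) → (T.graft g).Node →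
    T.Node ⊕ Σ l, (g l).Node
  | edge _, _, n => .inr ⟨PUnit.unit, n⟩
  | node _ _, _, none => .inl none
  | node _ ch, g, some n =>
    ((ch n.1).graftNode (fun k => g ⟨n.1, k⟩) n.2).map (fun m => some ⟨n.1, m⟩)
      (fun m => ⟨⟨n.1, m.1⟩, m.2⟩)

/-- Nodes of the lower tree as nodes of the grafted tree. -/
def graftInl : (T : PreTree P) → (g : T.Leaf → PreTree P) → T.Node → (T.graft g).Node
  | edge _, _, n => n.elim
  | node _ _, _, none => none
  | node _ ch, g, some n => some ⟨n.1, (ch n.1).graftInl (fun k => g ⟨n.1, k⟩) n.2⟩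

/-- Nodes of the upper trees as nodes of the grafted tree. -/
def graftInr : (T : PreTree P) → (g : T.Leaf → PreTree P) → (l : T.Leaf) → (g l).Node →
    (T.graft g).Node
  | edge _, _, _, n => n
  | node _ ch, g, l, n => some ⟨l.1, (ch l.1).graftInr (fun k => g ⟨l.1, k⟩) l.2 n⟩

theorem root_graft (T : PreTree P) (g : T.Leaf → PreTree P)
    (hg : ∀ l, (g l).root = T.leafType l) : (T.graft g).root = T.root := by
  cases T with
  | edge i => exact hg _
  | node b ch => rfl

theorem valid_graft (T : PreTree P) (g : T.Leaf → PreTree P) (hT : T.Valid)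
    (hg : ∀ l, (g l).root = T.leafType l) (hv : ∀ l, (g l).Valid) : (T.graft g).Valid := by
  induction T with
  | edge i => exact hv _
  | node b ch ih =>
    intro e
    exact ⟨(root_graft _ _ fun l => hg ⟨e, l⟩).trans (hT e).1,
      ih e _ (hT e).2 (fun l => hg ⟨e, l⟩) (fun l => hv ⟨e, l⟩)⟩

theorem leafType_graftLeaf (T : PreTree P) (g : T.Leaf → PreTree P) (l : (T.graft g).Leaf) :
    (T.graft g).leafType l = (g (T.graftLeaf g l).1).leafType (T.graftLeaf g l).2 := by
  induction T with
  | edge i => rfl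
  | node b ch ih => exact ih l.1 (fun k => g ⟨l.1, k⟩) l.2

theorem dec_graftNode (T : PreTree P) (g : T.Leaf → PreTree P) (n : (T.graft g).Node) :
    (T.graft g).dec n = Sum.elim T.dec (fun m => (g m.1).dec m.2) (T.graftNode g n) := by
  induction T with
  | edge i => rfl
  | node b ch ih =>
    match n with
    | none => rfl
    | some n =>
      refine (ih n.1 (fun k => g ⟨n.1, k⟩) n.2).trans ?_
      simp only [graftNode]
      cases (ch n.1).graftNode (fun k => g ⟨n.1, k⟩) n.2 <;> rfl

theorem graftNode_inl (T : PreTree P) (g : T.Leaf → PreTree P) (n : T.Node) :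
    T.graftNode g (T.graftInl g n) = .inl n := by
  induction T with
  | edge i => exact n.elim
  | node b ch ih =>
    match n with
    | none => rfl
    | some n => simp only [graftNode, graftInl, ih]; rfl

theorem graftNode_inr (T : PreTree P) (g : T.Leaf → PreTree P) (l : T.Leaf) (n : (g l).Node) :
    T.graftNode g (T.graftInr g l n) = .inr ⟨l, n⟩ := by
  induction T with
  | edge i => rfl
  | node b ch ih =>
    have := ih l.1 (fun k => g ⟨l.1, k⟩) l.2 n
    simp only [graftNode, graftInr, this]; rfl

theorem graftNode_leftInv (T : PreTree P) (g : T.Leaf → PreTree P) (x : (T.graft g).Node) :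
    Sum.elim (T.graftInl g) (fun m => T.graftInr g m.1 m.2) (T.graftNode g x) = x := by
  induction T with
  | edge i => rfl
  | node b ch ih =>
    match x with
    | none => rfl
    | some ⟨e, x⟩ =>
      have h := ih e (fun k => g ⟨e, k⟩) x
      simp only [graftNode]
      cases hx : (ch e).graftNode (fun k => g ⟨e, k⟩) x with
      | inl m =>
        rw [hx] at h
        exact congrArg (fun y => some (Sigma.mk e y)) h
      | inr m =>
        rw [hx] at h
        exact congrArg (fun y => some (Sigma.mk e y)) h

/-- Node-labelled trees, as pairs. -/
abbrev LT (P : PolyEndo I) (Z : Type u) : Type u := Σ T : PreTree P, (T.Node → Z)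

/-- A labelled tree with a given root node. -/
def mkNode {Z : Type u} (z : Z) (b : P.Op) (X : P.Ar b → LT P Z) : LT P Z :=
  ⟨node b fun e => (X e).1, fun o => match o with
    | none => z
    | some n => (X n.1).2 n.2⟩

/-- Grafting of labelled trees. -/
def mkGraft {Z : Type u} (T : LT P Z) (X : T.1.Leaf → LT P Z) : LT P Z :=
  ⟨T.1.graft fun l => (X l).1, fun x => Sum.elim T.2 (fun m => (X m.1).2 m.2)
    (T.1.graftNode (fun l => (X l).1) x)⟩

theorem mkGraft_node {Z : Type u} (b : P.Op) (ch : P.Ar b → PreTree P) (a : (node b ch).Node → Z)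
    (X : (node b ch).Leaf → LT P Z) :
    mkGraft ⟨node b ch, a⟩ X =
      mkNode (a none) b (fun e => mkGraft ⟨ch e, fun n => a (some ⟨e, n⟩)⟩ fun l => X ⟨e, l⟩) := by
  refine Sigma.ext rfl (heq_of_eq (funext fun x => ?_))
  match x with
  | none => rfl
  | some ⟨e, x⟩ =>
    simp only [mkGraft, graftNode, mkNode]
    cases (ch e).graftNode (fun k => (X ⟨e, k⟩).1) x <;> rfl

theorem mkGraft_congr {Z : Type u} (T : PreTree P) {a a' : T.Node → Z} (h : a = a')
    (X : T.Leaf → LT P Z) : mkGraft ⟨T, a⟩ X = mkGraft ⟨T, a'⟩ X := by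
  rw [h]

theorem mkGraft_mkGraft {Z : Type u} (T : PreTree P) (a : T.Node → Z) (X : T.Leaf → LT P Z)
    (K : ∀ l, (X l).1.Leaf → LT P Z) :
    mkGraft (mkGraft ⟨T, a⟩ X)
      (fun L => K (T.graftLeaf (fun l => (X l).1) L).1 (T.graftLeaf (fun l => (X l).1) L).2) =
    mkGraft ⟨T, a⟩ fun l => mkGraft (X l) (K l) := by
  induction T with
  | edge i => rfl
  | node b ch ih =>
    rw [mkGraft_node b ch a fun l => mkGraft (X l) (K l)]
    have := fun e => ih e (fun n => a (some ⟨e, n⟩)) (fun l => X ⟨e, l⟩) (fun l => K ⟨e, l⟩)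
    rw [← funext this]
    refine (mkGraft_node b _ _ _).trans (congrArg (mkNode (a none) b) (funext fun e => ?_))
    refine mkGraft_congr _ (funext fun n => ?_) _
    simp only [graftNode]
    cases (ch e).graftNode (fun k => (X ⟨e, k⟩).1) n <;> rfl

theorem mkGraft_edge {Z : Type u} (T : PreTree P) (a : T.Node → Z) (X : T.Leaf → LT P Z)
    (hX : ∀ l, X l = ⟨edge (T.leafType l), fun n => n.elim⟩) :
    mkGraft ⟨T, a⟩ X = ⟨T, a⟩ := by
  induction T with
  | edge i =>
    refine (hX PUnit.unit).trans (Sigma.ext rfl (heq_of_eq (funext fun x => x.elim)))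
  | node b ch ih =>
    rw [mkGraft_node, funext fun e => ih e (fun n => a (some ⟨e, n⟩)) (fun l => X ⟨e, l⟩)
      fun l => hX ⟨e, l⟩]
    refine Sigma.ext rfl (heq_of_eq (funext fun x => ?_))
    match x with
    | none => rfl
    | some _ => rfl

end PreTree

end PolyEndo

/-- A polynomial monad on `Set/I`. -/
structure PolyMonad (I : Type u) extends PolyEndo I, PolyEndo.MonadStr toPolyEndo

namespace PolyEndo

/-- The set `tr(P)` of (isomorphism classes of) `P`-trees: the least fixpoint of
`X ↦ I + P(X)`. -/
def Tree {I : Type u} (P : PolyEndo I) : Type u := {T : PreTree P // T.Valid}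

end PolyEndo

namespace PolyMonad

open PolyEndo PreTree

variable {I : Type u} (P : PolyMonad I)

/-- Not necessarily compatibly decorated trees over `P`. -/
abbrev PTree : Type u := P.toPolyEndo.PreTree

/-- The operation obtained by contracting all inner edges of a tree. -/
def tot : (T : P.PTree) → T.Valid → {b : P.Op // P.tgt b = T.root}
  | edge i, _ => ⟨P.one i, P.tgt_one i⟩
  | node b ch, v =>
    ⟨P.mul b ⟨fun e => (tot (ch e) (v e).2).1, fun e => (tot (ch e) (v e).2).2.trans (v e).1⟩,
      P.tgt_mul _ _⟩

/-- The total operations of the trees sitting on the root node. -/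
abbrev totFam (b : P.Op) (ch : P.Ar b → P.PTree) (v : (node b ch).Valid) : P.Fam b :=
  ⟨fun e => (P.tot (ch e) (v e).2).1, fun e => (P.tot (ch e) (v e).2).2.trans (v e).1⟩

/-- The leaves of a tree are the inputs of its total operation. -/
def leafAr : (T : P.PTree) → (v : T.Valid) → T.Leaf ≃ P.Ar (tot P T v).1
  | edge i, _ =>
    { toFun := fun _ => P.pt i
      invFun := fun _ => PUnit.unit
      left_inv := fun _ => rfl
      right_inv := fun e => (P.eq_pt i e).symm }
  | node b ch, v =>
    (Equiv.sigmaCongrRight fun e => leafAr (ch e) (v e).2).trans (P.pos b (P.totFam b ch v))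

theorem src_leafAr (T : P.PTree) (v : T.Valid) (l : T.Leaf) :
    P.src _ (P.leafAr T v l) = T.leafType l := by
  induction T with
  | edge i => exact P.src_pt i
  | node b ch ih =>
    exact (P.src_pos b (P.totFam b ch v) ⟨l.1, P.leafAr _ _ l.2⟩).trans
        (ih l.1 (v l.1).2 l.2)

/-- The map `tr(P) → B`: contract a `P`-tree to a single operation, using the monad structure. -/
def target (T : P.toPolyEndo.Tree) : P.Op := (P.tot T.1 T.2).1

/-- If `T` has total operation `b`, its leaves are the inputs of `b`. -/
def leafTo (T : P.toPolyEndo.Tree) {b : P.Op} (h : P.target T = b) : T.1.Leaf ≃ P.Ar b :=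
  (P.leafAr T.1 T.2).trans (Equiv.cast (congrArg P.Ar h))

/-- Substitute into each node `n` of `M` the tree `F n`, whose total operation is the decoration
of `n`. -/
def subst : (M : P.PTree) → (F : M.Node → P.toPolyEndo.Tree) →
    (∀ n, P.target (F n) = M.dec n) → P.PTree
  | edge i, _, _ => edge i
  | node _ ch, F, h => (F none).1.graft fun l =>
      subst (ch (P.leafTo (F none) (h none) l)) (fun n => F (some ⟨_, n⟩)) (fun n => h (some ⟨_, n⟩))

/-- The leaves of the tree obtained by substitution are those of `M`. -/
def substLeaf : (M : P.PTree) → (F : M.Node → P.toPolyEndo.Tree) →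
    (h : ∀ n, P.target (F n) = M.dec n) → (P.subst M F h).Leaf → M.Leaf
  | edge _, _, _, l => l
  | node _ ch, F, h, l =>
    let r := (F none).1.graftLeaf (fun l => P.subst (ch (P.leafTo (F none) (h none) l))
      (fun n => F (some ⟨_, n⟩)) (fun n => h (some ⟨_, n⟩))) l
    ⟨_, substLeaf (ch (P.leafTo (F none) (h none) r.1)) _ _ r.2⟩

/-- A node of the tree obtained by substitution is a node of one of the trees substituted. -/
def substNode : (M : P.PTree) → (F : M.Node → P.toPolyEndo.Tree) →
    (h : ∀ n, P.target (F n) = M.dec n) → (P.subst M F h).Node → Σ n, (F n).1.Node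
  | edge _, _, _, x => x.elim
  | node _ ch, F, h, x =>
    Sum.elim (fun m => ⟨none, m⟩)
      (fun m =>
        let r := substNode (ch (P.leafTo (F none) (h none) m.1)) (fun n => F (some ⟨_, n⟩))
          (fun n => h (some ⟨_, n⟩)) m.2
        ⟨some ⟨_, r.1⟩, r.2⟩)
      ((F none).1.graftNode (fun l => P.subst (ch (P.leafTo (F none) (h none) l))
        (fun n => F (some ⟨_, n⟩)) (fun n => h (some ⟨_, n⟩))) x)

theorem pos_congr (b : P.Op) {c c' : P.Fam b} (h : c = c') (e : P.Ar b) (x : P.Ar (c.1 e))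
    (y : P.Ar (c'.1 e)) (hxy : (⟨_, x⟩ : P.Input) = ⟨_, y⟩) :
    (⟨_, P.pos b c ⟨e, x⟩⟩ : P.Input) = ⟨_, P.pos b c' ⟨e, y⟩⟩ := by
  subst h
  have := eq_of_heq (Sigma.mk.inj hxy).2
  rw [this]

theorem tot_graft (T : P.PTree) (g : T.Leaf → P.PTree) (vT : T.Valid) (vg : ∀ l, (g l).Valid)
    (v : (T.graft g).Valid) (c : P.Fam (P.tot T vT).1)
    (hc : ∀ l, c.1 (P.leafAr T vT l) = (P.tot (g l) (vg l)).1) :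
    (P.tot (T.graft g) v).1 = P.mul (P.tot T vT).1 c ∧
    ∀ (L : (T.graft g).Leaf) (q : P.Ar (c.1 (P.leafAr T vT (T.graftLeaf g L).1))),
      (⟨_, q⟩ : P.Input) = ⟨_, P.leafAr _ (vg _) (T.graftLeaf g L).2⟩ →
      (⟨_, P.leafAr _ v L⟩ : P.Input) =
        ⟨_, P.pos _ c ⟨P.leafAr T vT (T.graftLeaf g L).1, q⟩⟩ := by
  induction T with
  | edge i =>
    refine ⟨((P.one_mul i c).trans (hc PUnit.unit)).symm, fun L q hq => ?_⟩
    exact hq.symm.trans (P.one_mul_pos i c q).symm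
  | node b ch ih =>
    have H := fun e => ih e (fun l => g ⟨e, l⟩) (vT e).2 (fun l => vg ⟨e, l⟩) (v e).2
      ⟨fun f => c.1 (P.pos b (P.totFam b ch vT) ⟨e, f⟩),
        fun f => (c.2 _).trans (P.src_pos b (P.totFam b ch vT) ⟨e, f⟩)⟩
      (fun l => hc ⟨e, l⟩)
    have hfam : P.totFam b _ v =
        ⟨fun e => P.mul (P.tot (ch e) (vT e).2).1
          ⟨fun f => c.1 (P.pos b (P.totFam b ch vT) ⟨e, f⟩),
            fun f => (c.2 _).trans (P.src_pos b (P.totFam b ch vT) ⟨e, f⟩)⟩,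
        fun e => (P.tgt_mul _ _).trans ((P.tot (ch e) (vT e).2).2.trans (vT e).1)⟩ :=
      Subtype.ext (funext fun e => (H e).1)
    refine ⟨(congrArg (P.mul b) hfam).trans (P.assoc b (P.totFam b ch vT) c).symm,
      fun L q hq => ?_⟩
    refine Eq.trans ?_ (P.assoc_pos b (P.totFam b ch vT) c L.1 _ q).symm
    exact P.pos_congr b hfam L.1 _ _ ((H L.1).2 L.2 q hq)

theorem tot_graft_to (T : P.toPolyEndo.Tree) {b : P.Op} (h : P.target T = b)
    (g : T.1.Leaf → P.PTree) (vg : ∀ l, (g l).Valid)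
    (v : (T.1.graft g).Valid) (c : P.Fam b)
    (hc : ∀ l, c.1 (P.leafTo T h l) = (P.tot (g l) (vg l)).1) :
    (P.tot (T.1.graft g) v).1 = P.mul b c ∧
    ∀ (L : (T.1.graft g).Leaf) (q : P.Ar (c.1 (P.leafTo T h (T.1.graftLeaf g L).1))),
      (⟨_, q⟩ : P.Input) = ⟨_, P.leafAr _ (vg _) (T.1.graftLeaf g L).2⟩ →
      (⟨_, P.leafAr _ v L⟩ : P.Input) =
        ⟨_, P.pos _ c ⟨P.leafTo T h (T.1.graftLeaf g L).1, q⟩⟩ := by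
  subst h
  exact P.tot_graft T.1 g T.2 vg v c hc

theorem src_leafTo (T : P.toPolyEndo.Tree) {b : P.Op} (h : P.target T = b) (l : T.1.Leaf) :
    P.src b (P.leafTo T h l) = T.1.leafType l := by
  subst h
  exact P.src_leafAr T.1 T.2 l

theorem leafTo_of_input (T : P.toPolyEndo.Tree) {b : P.Op} (h : P.target T = b) (l : T.1.Leaf)
    (e : P.Input) (he : (⟨_, P.leafAr T.1 T.2 l⟩ : P.Input) = e) :
    (⟨b, P.leafTo T h l⟩ : P.Input) = e := by
  subst h
  exact he

theorem valid_subst (M : P.PTree) (F : M.Node → P.toPolyEndo.Tree)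
    (h : ∀ n, P.target (F n) = M.dec n) (vM : M.Valid) :
    (P.subst M F h).Valid ∧ (P.subst M F h).root = M.root := by
  induction M with
  | edge i => exact ⟨trivial, rfl⟩
  | node b ch ih =>
    have H := fun l => ih (P.leafTo (F none) (h none) l) (fun n => F (some ⟨_, n⟩))
      (fun n => h (some ⟨_, n⟩)) (vM _).2
    have H2 := fun l => (H l).2.trans ((vM _).1.trans (P.src_leafTo (F none) (h none) l))
    refine ⟨valid_graft _ _ (F none).2 H2 fun l => (H l).1, (root_graft _ _ H2).trans ?_⟩
    exact (P.tot _ (F none).2).2.symm.trans (congrArg P.tgt (h none))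

theorem tot_subst (M : P.PTree) (F : M.Node → P.toPolyEndo.Tree)
    (h : ∀ n, P.target (F n) = M.dec n) (vM : M.Valid) (v : (P.subst M F h).Valid) :
    (P.tot _ v).1 = (P.tot M vM).1 ∧ ∀ L, (⟨_, P.leafAr _ v L⟩ : P.Input) =
      ⟨_, P.leafAr M vM (P.substLeaf M F h L)⟩ := by
  induction M with
  | edge i => exact ⟨rfl, fun _ => rfl⟩
  | node b ch ih =>
    have V := fun l => (P.valid_subst (ch (P.leafTo (F none) (h none) l))
      (fun n => F (some ⟨_, n⟩)) (fun n => h (some ⟨_, n⟩)) (vM _).2).1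
    have H := fun l => ih (P.leafTo (F none) (h none) l) (fun n => F (some ⟨_, n⟩))
      (fun n => h (some ⟨_, n⟩)) (vM _).2 (V l)
    have G := P.tot_graft_to (F none) (h none) _ V v
      ⟨fun e => (P.tot (ch e) (vM e).2).1, fun e => (P.tot (ch e) (vM e).2).2.trans (vM e).1⟩
      (fun l => (H l).1.symm)
    exact ⟨G.1, fun L => G.2 L _ ((H _).2 _).symm⟩

theorem dec_substNode (M : P.PTree) (F : M.Node → P.toPolyEndo.Tree)
    (h : ∀ n, P.target (F n) = M.dec n) (x : (P.subst M F h).Node) :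
    (P.subst M F h).dec x = (F (P.substNode M F h x).1).1.dec (P.substNode M F h x).2 := by
  induction M with
  | edge i => exact x.elim
  | node b ch ih =>
    refine (dec_graftNode _ _ _).trans ?_
    simp only [substNode]
    cases (F none).1.graftNode (fun l => P.subst (ch (P.leafTo (F none) (h none) l))
        (fun n => F (some ⟨_, n⟩)) (fun n => h (some ⟨_, n⟩))) x with
    | inl m => rfl
    | inr m => exact ih _ (fun n => F (some ⟨_, n⟩)) (fun n => h (some ⟨_, n⟩)) m.2

theorem substNode_bijective (M : P.PTree) (F : M.Node → P.toPolyEndo.Tree)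
    (h : ∀ n, P.target (F n) = M.dec n) : Function.Bijective (P.substNode M F h) := by
  induction M with
  | edge i => exact ⟨fun x => x.elim, fun x => x.1.elim⟩
  | node b ch ih =>
    have H := fun l => ih (P.leafTo (F none) (h none) l) (fun n => F (some ⟨_, n⟩))
      (fun n => h (some ⟨_, n⟩))
    constructor
    · intro x y hxy
      rw [← graftNode_leftInv _ _ x, ← graftNode_leftInv _ _ y]
      simp only [substNode] at hxy
      revert hxy
      generalize (F none).1.graftNode (fun l => P.subst (ch (P.leafTo (F none) (h none) l))
        (fun n => F (some ⟨_, n⟩)) (fun n => h (some ⟨_, n⟩))) x = x'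
      generalize (F none).1.graftNode (fun l => P.subst (ch (P.leafTo (F none) (h none) l))
        (fun n => F (some ⟨_, n⟩)) (fun n => h (some ⟨_, n⟩))) y = y'
      intro hxy
      congr 1
      match x', y' with
      | .inl m, .inl m' => exact congrArg Sum.inl (eq_of_heq (Sigma.mk.inj hxy).2)
      | .inl m, .inr m' => exact absurd (Sigma.mk.inj hxy).1 (by simp)
      | .inr m, .inl m' => exact absurd (Sigma.mk.inj hxy).1 (by simp)
      | .inr ⟨l, m⟩, .inr ⟨l', m'⟩ =>
        have h1 := (Sigma.mk.inj (Option.some.inj (Sigma.mk.inj hxy).1)).1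
        obtain rfl := (P.leafTo (F none) (h none)).injective h1
        have h2 := eq_of_heq (Sigma.mk.inj (Option.some.inj (Sigma.mk.inj hxy).1)).2
        have : m = m' := (H l).1 (Sigma.ext h2 (Sigma.mk.inj hxy).2)
        rw [this]
    · rintro ⟨n, m⟩
      match n with
      | none =>
        refine ⟨graftInl _ _ m, ?_⟩
        simp only [substNode, graftNode_inl]; rfl
      | some ⟨e, n⟩ =>
        obtain ⟨l, rfl⟩ := (P.leafTo (F none) (h none)).surjective e
        obtain ⟨x, hx⟩ := (H l).2 ⟨n, m⟩
        refine ⟨graftInr _ _ l x, ?_⟩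
        simp only [substNode, graftNode_inr, Sum.elim_inr]
        rw [hx]

/-- `P`-trees with labelled nodes, as pairs. -/
abbrev LTree (Z : Type u) : Type u := Σ T : P.toPolyEndo.Tree, (T.1.Node → Z)

/-- Substitution of labelled trees. -/
def mkSubst {Z : Type u} (M : P.PTree) (F : M.Node → P.LTree Z)
    (h : ∀ n, P.target (F n).1 = M.dec n) : LT P.toPolyEndo Z :=
  ⟨P.subst M (fun n => (F n).1) h, fun x => (F (P.substNode M _ h x).1).2 (P.substNode M _ h x).2⟩

theorem mkSubst_node {Z : Type u} (b : P.Op) (ch : P.Ar b → P.PTree)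
    (F : (node b ch).Node → P.LTree Z) (h : ∀ n, P.target (F n).1 = (node b ch).dec n) :
    P.mkSubst (node b ch) F h = mkGraft ⟨(F none).1.1, (F none).2⟩ fun l =>
      P.mkSubst (ch (P.leafTo (F none).1 (h none) l)) (fun n => F (some ⟨_, n⟩))
        (fun n => h (some ⟨_, n⟩)) := by
  refine Sigma.ext rfl (heq_of_eq (funext fun x => ?_))
  simp only [mkSubst, substNode, mkGraft]
  cases (F none).1.1.graftNode (fun l => P.subst (ch (P.leafTo (F none).1 (h none) l))
        (fun n => (F (some ⟨_, n⟩)).1) (fun n => h (some ⟨_, n⟩))) x <;> rfl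

theorem mkSubst_graft {Z : Type u} (T : P.PTree) (g : T.Leaf → P.PTree)
    (G₁ : T.Node → P.LTree Z) (G₂ : ∀ l, (g l).Node → P.LTree Z)
    (h₁ : ∀ n, P.target (G₁ n).1 = T.dec n) (h₂ : ∀ l n, P.target (G₂ l n).1 = (g l).dec n)
    (G : (T.graft g).Node → P.LTree Z)
    (hG : G = fun p => Sum.elim G₁ (fun m => G₂ m.1 m.2) (T.graftNode g p))
    (h : ∀ p, P.target (G p).1 = (T.graft g).dec p) :
    P.mkSubst (T.graft g) G h = mkGraft (P.mkSubst T G₁ h₁) fun L =>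
      P.mkSubst (g (P.substLeaf T _ h₁ L)) (G₂ _) (h₂ _) := by
  induction T with
  | edge i => subst hG; rfl
  | node b ch ih =>
    subst hG
    have K : ∀ e, (fun n => Sum.elim G₁ (fun m => G₂ m.1 m.2)
        ((node b ch).graftNode g (some ⟨e, n⟩))) =
        (fun p => Sum.elim (fun n => G₁ (some ⟨e, n⟩)) (fun m => G₂ ⟨e, m.1⟩ m.2)
          ((ch e).graftNode (fun k => g ⟨e, k⟩) p)) := by
      intro e
      funext n
      simp only [graftNode]
      cases (ch e).graftNode (fun k => g ⟨e, k⟩) n <;> rfl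
    refine (P.mkSubst_node b _ _ _).trans ?_
    have E := fun l => ih (P.leafTo (G₁ none).1 (h₁ none) l) (fun k => g ⟨_, k⟩)
      (fun n => G₁ (some ⟨_, n⟩)) (fun k => G₂ ⟨_, k⟩) (fun n => h₁ (some ⟨_, n⟩))
      (fun k => h₂ ⟨_, k⟩) _ (K _) (fun n => h (some ⟨_, n⟩))
    refine (congrArg (mkGraft ⟨(G₁ none).1.1, (G₁ none).2⟩) (funext E)).trans ?_
    refine (mkGraft_mkGraft (G₁ none).1.1 (G₁ none).2 (fun l =>
      P.mkSubst (ch (P.leafTo (G₁ none).1 (h₁ none) l)) (fun n => G₁ (some ⟨_, n⟩))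
        (fun n => h₁ (some ⟨_, n⟩))) (fun l L => P.mkSubst (g ⟨_, P.substLeaf _ _ _ L⟩)
          (G₂ _) (h₂ _))).symm.trans ?_
    have := P.mkSubst_node b ch G₁ h₁
    exact mkGraft_congr _ (eq_of_heq (Sigma.ext_iff.1 this).2).symm _

/-- Substitution, as an operation on `P`-trees. -/
def substTree (M : P.toPolyEndo.Tree) (F : M.1.Node → P.toPolyEndo.Tree)
    (h : ∀ n, P.target (F n) = M.1.dec n) : P.toPolyEndo.Tree :=
  ⟨P.subst M.1 F h, (P.valid_subst M.1 F h M.2).1⟩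

theorem target_substTree (M : P.toPolyEndo.Tree) (F : M.1.Node → P.toPolyEndo.Tree)
    (h : ∀ n, P.target (F n) = M.1.dec n) : P.target (P.substTree M F h) = P.target M :=
  (P.tot_subst M.1 F h M.2 _).1

/-- Substitution of labelled trees, as an operation on `P`-trees. -/
def mkSubstTree {Z : Type u} (M : P.toPolyEndo.Tree) (F : M.1.Node → P.LTree Z)
    (h : ∀ n, P.target (F n).1 = M.1.dec n) : P.LTree Z :=
  ⟨P.substTree M (fun n => (F n).1) h, (P.mkSubst M.1 F h).2⟩

theorem leafTo_substTree (M : P.toPolyEndo.Tree) (F : M.1.Node → P.toPolyEndo.Tree)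
    (h : ∀ n, P.target (F n) = M.1.dec n) {b : P.Op} (hb : P.target M = b)
    (hb' : P.target (P.substTree M F h) = b) (l : (P.subst M.1 F h).Leaf) :
    P.leafTo (P.substTree M F h) hb' l = P.leafTo M hb (P.substLeaf M.1 F h l) := by
  have h1 := P.leafTo_of_input _ hb' l _ rfl
  have h2 := P.leafTo_of_input _ hb (P.substLeaf M.1 F h l) _ rfl
  have h3 := h1.trans (((P.tot_subst M.1 F h M.2 _).2 l).trans h2.symm)
  exact eq_of_heq (Sigma.mk.inj h3).2

theorem mkSubst_subst {Z : Type u} (M : P.PTree) (F : M.Node → P.toPolyEndo.Tree)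
    (h : ∀ n, P.target (F n) = M.dec n) (G : ∀ n, (F n).1.Node → P.LTree Z)
    (hG : ∀ n m, P.target (G n m).1 = (F n).1.dec m)
    (G' : (P.subst M F h).Node → P.LTree Z)
    (hGG : G' = fun p => G (P.substNode M F h p).1 (P.substNode M F h p).2)
    (hG' : ∀ p, P.target (G' p).1 = (P.subst M F h).dec p)
    (h' : ∀ n, P.target (P.mkSubstTree (F n) (G n) (hG n)).1 = M.dec n) :
    P.mkSubst (P.subst M F h) G' hG' =
      P.mkSubst M (fun n => P.mkSubstTree (F n) (G n) (hG n)) h' := by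
  induction M with
  | edge i => exact Sigma.ext rfl (heq_of_eq (funext fun x => x.elim))
  | node b ch ih =>
    refine (P.mkSubst_graft (F none).1 _ (G none) (fun l n =>
      G (some ⟨_, (P.substNode _ _ (fun n => h (some ⟨_, n⟩)) n).1⟩)
        (P.substNode (ch (P.leafTo (F none) (h none) l)) _ (fun n => h (some ⟨_, n⟩)) n).2)
      (hG none) (fun l n => (hG _ _).trans (P.dec_substNode (ch (P.leafTo (F none) (h none) l))
        (fun n => F (some ⟨_, n⟩)) (fun n => h (some ⟨_, n⟩)) n).symm) G' ?_ hG').trans ?_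
    · rw [hGG]
      funext p
      simp only [substNode]
      cases (F none).1.graftNode (fun l => P.subst (ch (P.leafTo (F none) (h none) l))
        (fun n => F (some ⟨_, n⟩)) (fun n => h (some ⟨_, n⟩))) p <;> rfl
    · rw [P.mkSubst_node]
      refine congrArg (mkGraft (P.mkSubst (F none).1 (G none) (hG none))) (funext fun L => ?_)
      refine (ih (P.leafTo (F none) (h none) (P.substLeaf _ _ (hG none) L))
        (fun n => F (some ⟨_, n⟩)) (fun n => h (some ⟨_, n⟩)) (fun n => G (some ⟨_, n⟩))
        (fun n => hG (some ⟨_, n⟩)) _ rfl _ (fun n => h' (some ⟨_, n⟩))).trans ?_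
      have := P.leafTo_substTree (F none) _ (hG none) (h none) (h' none) L
      exact congrArg (fun e => P.mkSubst (ch e)
        (fun n => P.mkSubstTree (F (some ⟨e, n⟩)) (G (some ⟨e, n⟩)) (hG (some ⟨e, n⟩)))
        (fun n => h' (some ⟨e, n⟩))) this.symm

theorem corolla_valid (b : P.Op) : (node b fun e => edge (P.src b e) : P.PTree).Valid :=
  fun _ => ⟨rfl, trivial⟩

/-- The one-node tree given by an operation. -/
def corolla (b : P.Op) : P.toPolyEndo.Tree := ⟨node b fun e => edge (P.src b e), P.corolla_valid b⟩

theorem target_corolla (b : P.Op) : P.target (P.corolla b) = b := P.mul_one b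

theorem leafTo_corolla (b : P.Op) (e : P.Ar b) :
    P.leafTo (P.corolla b) (P.target_corolla b) ⟨e, PUnit.unit⟩ = e := by
  have h1 := P.leafTo_of_input (P.corolla b) (P.target_corolla b) ⟨e, PUnit.unit⟩ _
    (P.mul_one_pos b e)
  exact eq_of_heq (Sigma.mk.inj h1).2

theorem mkSubst_corolla {Z : Type u} (M : P.PTree) (vM : M.Valid) (a : M.Node → Z)
    (F : M.Node → P.LTree Z) (hF : F = fun n => ⟨P.corolla (M.dec n), fun _ => a n⟩)
    (h : ∀ n, P.target (F n).1 = M.dec n) : P.mkSubst M F h = ⟨M, a⟩ := by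
  induction M with
  | edge i => exact Sigma.ext rfl (heq_of_eq (funext fun x => x.elim))
  | node b ch ih =>
    subst hF
    refine (P.mkSubst_node b _ _ _).trans ?_
    refine (mkGraft_node b _ _ _).trans ?_
    have H : ∀ e, mkGraft ⟨edge (P.src b e), fun n => PEmpty.elim n⟩ (fun _ => P.mkSubst
        (ch (P.leafTo (P.corolla b) (h none) ⟨e, PUnit.unit⟩))
        (fun n => ⟨P.corolla ((ch _).dec n), fun _ => a (some ⟨_, n⟩)⟩)
        (fun n => h (some ⟨_, n⟩))) = (⟨ch e, fun n => a (some ⟨e, n⟩)⟩ : LT P.toPolyEndo Z) := by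
      intro e
      refine Eq.trans rfl ((ih _ (vM _).2 (fun n => a (some ⟨_, n⟩)) _ rfl
        (fun n => h (some ⟨_, n⟩))).trans ?_)
      exact congrArg (fun e => (⟨ch e, fun n => a (some ⟨e, n⟩)⟩ : LT P.toPolyEndo Z))
        (P.leafTo_corolla b e)
    refine Eq.trans (congrArg (mkNode (a none) b) (funext fun e => ?_))
      (b := mkNode (a none) b fun e => ⟨ch e, fun n => a (some ⟨e, n⟩)⟩) ?_
    · refine Eq.trans ?_ (H e)
      exact mkGraft_congr (edge (P.src b e)) (funext fun n => PEmpty.elim n) _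
    · refine Sigma.ext rfl (heq_of_eq (funext fun x => ?_))
      match x with
      | none => rfl
      | some _ => rfl

theorem mkSubst_of_corolla {Z : Type u} (b : P.Op) (F : (P.corolla b).1.Node → P.LTree Z)
    (h : ∀ n, P.target (F n).1 = (P.corolla b).1.dec n) :
    P.mkSubst (P.corolla b).1 F h = ⟨(F none).1.1, (F none).2⟩ := by
  refine (P.mkSubst_node b _ _ _).trans (mkGraft_edge _ _ _ fun l => ?_)
  refine Sigma.ext (congrArg edge (P.src_leafTo (F none).1 (h none) l)) ?_
  rw [← P.src_leafTo (F none).1 (h none) l]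
  exact heq_of_eq (funext fun x => x.elim)

theorem mark_eq {T T' : P.toPolyEndo.Tree} {Z : Type u} {a : T.1.Node → Z} {a' : T'.1.Node → Z}
    (h : (⟨T.1, a⟩ : LT P.toPolyEndo Z) = ⟨T'.1, a'⟩) (x : T.1.Node) (y : T'.1.Node)
    (hy : ∀ y', a' y' = a x → y' = y) :
    (⟨T, x⟩ : Σ T : P.toPolyEndo.Tree, T.1.Node) = ⟨T', y⟩ := by
  obtain ⟨T, v⟩ := T
  obtain ⟨T', v'⟩ := T'
  obtain ⟨h1, h2⟩ := Sigma.mk.inj h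
  dsimp only at h1
  subst h1
  have := eq_of_heq h2
  subst this
  rw [hy x rfl]

/-- The polynomial endofunctor `B ← tr•(P) → tr(P) → B`, where `tr•(P)` is the set of `P`-trees
with a marked node: return the decoration of the marked node, forget the mark, contract all inner
edges. -/
def plusEndo : PolyEndo P.Op where
  Op := P.toPolyEndo.Tree
  Ar T := T.1.Node
  finite_ar T := T.1.finite_node
  src T n := T.1.dec n
  tgt := P.target

/-- The nodes of a substitution are the nodes of the trees substituted. -/
noncomputable def plusPos (M : P.toPolyEndo.Tree) (F : P.plusEndo.Fam M) :
    (Σ n : M.1.Node, (F.1 n).1.Node) ≃ (P.substTree M F.1 F.2).1.Node :=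
  (Equiv.ofBijective _ (P.substNode_bijective M.1 F.1 F.2)).symm

theorem substNode_plusPos (M : P.toPolyEndo.Tree) (F : P.plusEndo.Fam M) (x) :
    P.substNode M.1 F.1 F.2 (P.plusPos M F x) = x :=
  (Equiv.ofBijective _ (P.substNode_bijective M.1 F.1 F.2)).apply_symm_apply x

theorem plusPos_eq (M : P.toPolyEndo.Tree) (F : P.plusEndo.Fam M) (x y)
    (h : P.substNode M.1 F.1 F.2 y = x) : y = P.plusPos M F x := by
  rw [← h]
  exact ((Equiv.ofBijective _ (P.substNode_bijective M.1 F.1 F.2)).symm_apply_apply y).symm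

theorem src_plusPos (M : P.toPolyEndo.Tree) (F : P.plusEndo.Fam M) (x) :
    (P.substTree M F.1 F.2).1.dec (P.plusPos M F x) = (F.1 x.1).1.dec x.2 := by
  refine (P.dec_substNode M.1 F.1 F.2 _).trans ?_
  rw [substNode_plusPos]

theorem plus_mul_one (M : P.toPolyEndo.Tree) :
    P.substTree M (fun n => P.corolla (M.1.dec n)) (fun _ => P.target_corolla _) = M := by
  have := P.mkSubst_corolla (Z := PUnit) M.1 M.2 (fun _ => PUnit.unit) _ rfl
    (fun n => P.target_corolla _)
  exact Subtype.ext (Sigma.mk.inj this).1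

theorem plus_mul_one_pos (M : P.toPolyEndo.Tree) (n : M.1.Node) :
    (⟨_, P.plusPos M ⟨fun n => P.corolla (M.1.dec n), fun _ => P.target_corolla _⟩
      ⟨n, none⟩⟩ : P.plusEndo.Input) = ⟨M, n⟩ := by
  refine P.mark_eq (P.mkSubst_corolla M.1 M.2 (fun n => n) _ rfl
    (fun n => P.target_corolla _)) _ _ fun y' hy => hy.trans ?_
  exact congrArg Sigma.fst (P.substNode_plusPos M
    ⟨fun n => P.corolla (M.1.dec n), fun _ => P.target_corolla _⟩ ⟨n, none⟩)

theorem plus_one_mul (b : P.Op) (F : P.plusEndo.Fam (P.corolla b)) :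
    P.substTree (P.corolla b) F.1 F.2 = F.1 none := by
  have := P.mkSubst_of_corolla (Z := PUnit) b (fun n => ⟨F.1 n, fun _ => PUnit.unit⟩) F.2
  exact Subtype.ext (Sigma.mk.inj this).1

theorem plus_one_mul_pos (b : P.Op) (F : P.plusEndo.Fam (P.corolla b)) (f) :
    (⟨_, P.plusPos (P.corolla b) F ⟨none, f⟩⟩ : P.plusEndo.Input) = ⟨F.1 none, f⟩ := by
  refine P.mark_eq (P.mkSubst_of_corolla b
    (fun n => ⟨F.1 n, fun x => (⟨n, x⟩ : Σ n, (F.1 n).1.Node)⟩) F.2) _ _ fun y' hy => ?_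
  have hy := hy.trans (P.substNode_plusPos (P.corolla b) F ⟨none, f⟩)
  exact eq_of_heq (Sigma.mk.inj hy).2

theorem plus_assoc_aux (M : P.toPolyEndo.Tree) (F : P.plusEndo.Fam M)
    (G : P.plusEndo.Fam (P.substTree M F.1 F.2)) {Z : Type u} (a : ∀ p, (G.1 p).1.Node → Z)
    (hG : ∀ n m, P.target (G.1 (P.plusPos M F ⟨n, m⟩)) = (F.1 n).1.dec m)
    (h' : ∀ n, P.target (P.substTree (F.1 n) (fun m => G.1 (P.plusPos M F ⟨n, m⟩)) (hG n)) =
      M.1.dec n) :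
    P.mkSubst (P.subst M.1 F.1 F.2) (fun p => ⟨G.1 p, a p⟩) G.2 =
    P.mkSubst M.1 (fun n => P.mkSubstTree (F.1 n)
      (fun m => ⟨G.1 (P.plusPos M F ⟨n, m⟩), a (P.plusPos M F ⟨n, m⟩)⟩) (hG n)) h' := by
  refine P.mkSubst_subst M.1 F.1 F.2 (fun n m =>
    (⟨G.1 (P.plusPos M F ⟨n, m⟩), a (P.plusPos M F ⟨n, m⟩)⟩ : P.LTree Z)) hG
    (fun p => ⟨G.1 p, a p⟩) ?_ G.2 h'
  funext p
  exact congrArg (fun p => (⟨G.1 p, a p⟩ : P.LTree Z))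
    (P.plusPos_eq M F (P.substNode M.1 F.1 F.2 p) p rfl)

theorem plus_assoc (M : P.toPolyEndo.Tree) (F : P.plusEndo.Fam M)
    (G : P.plusEndo.Fam (P.substTree M F.1 F.2))
    (hG : ∀ n m, P.target (G.1 (P.plusPos M F ⟨n, m⟩)) = (F.1 n).1.dec m)
    (h' : ∀ n, P.target (P.substTree (F.1 n) (fun m => G.1 (P.plusPos M F ⟨n, m⟩)) (hG n)) =
      M.1.dec n) :
    P.substTree (P.substTree M F.1 F.2) G.1 G.2 =
      P.substTree M (fun n => P.substTree (F.1 n) (fun m => G.1 (P.plusPos M F ⟨n, m⟩)) (hG n))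
        h' :=
  Subtype.ext (Sigma.mk.inj (P.plus_assoc_aux M F G (fun _ _ => PUnit.unit) hG h')).1

theorem plus_assoc_pos (M : P.toPolyEndo.Tree) (F : P.plusEndo.Fam M)
    (G : P.plusEndo.Fam (P.substTree M F.1 F.2))
    (hG : ∀ n m, P.target (G.1 (P.plusPos M F ⟨n, m⟩)) = (F.1 n).1.dec m)
    (h' : ∀ n, P.target (P.substTree (F.1 n) (fun m => G.1 (P.plusPos M F ⟨n, m⟩)) (hG n)) =
      M.1.dec n)
    (n : M.1.Node) (m : (F.1 n).1.Node) (g : (G.1 (P.plusPos M F ⟨n, m⟩)).1.Node) :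
    (⟨_, P.plusPos (P.substTree M F.1 F.2) G ⟨P.plusPos M F ⟨n, m⟩, g⟩⟩ : P.plusEndo.Input) =
      ⟨_, P.plusPos M ⟨fun n => P.substTree (F.1 n) (fun m => G.1 (P.plusPos M F ⟨n, m⟩)) (hG n),
        h'⟩ ⟨n, P.plusPos (F.1 n) ⟨fun m => G.1 (P.plusPos M F ⟨n, m⟩), hG n⟩ ⟨m, g⟩⟩⟩ := by
  refine P.mark_eq (P.plus_assoc_aux M F G
    (fun p x => (⟨p, x⟩ : Σ p, (G.1 p).1.Node)) hG h') _ _ fun y' hy => ?_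
  have hy := hy.trans (P.substNode_plusPos (P.substTree M F.1 F.2) G ⟨_, g⟩)
  have key : ∀ r : Σ n, (P.substTree (F.1 n) (fun m => G.1 (P.plusPos M F ⟨n, m⟩)) (hG n)).1.Node,
      (⟨P.plusPos M F ⟨r.1, (P.substNode (F.1 r.1).1 _ (hG r.1) r.2).1⟩,
        (P.substNode (F.1 r.1).1 _ (hG r.1) r.2).2⟩ : Σ p, (G.1 p).1.Node) =
      ⟨P.plusPos M F ⟨n, m⟩, g⟩ →
      r = ⟨n, P.plusPos (F.1 n) ⟨fun m => G.1 (P.plusPos M F ⟨n, m⟩), hG n⟩ ⟨m, g⟩⟩ := by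
    rintro ⟨n', z⟩ hr
    obtain ⟨h1, h2⟩ := Sigma.mk.inj hr
    have h3 := (P.plusPos M F).injective h1
    obtain rfl : n' = n := (Sigma.mk.inj h3).1
    have h4 := eq_of_heq (Sigma.mk.inj h3).2
    have h5 : z = P.plusPos (F.1 n') ⟨fun m => G.1 (P.plusPos M F ⟨n', m⟩), hG n'⟩ ⟨m, g⟩ :=
      P.plusPos_eq (F.1 n') ⟨fun m => G.1 (P.plusPos M F ⟨n', m⟩), hG n'⟩ ⟨m, g⟩ z
        (Sigma.ext h4 h2)
    rw [h5]
  exact P.plusPos_eq M ⟨_, h'⟩ _ _ (key _ hy)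

/-- The Baez-Dolan construction `P⁺`: the multiplication substitutes trees into nodes, and the
unit regards an operation as a one-node tree. -/
noncomputable def plus : PolyMonad P.Op where
  toPolyEndo := P.plusEndo
  one := P.corolla
  tgt_one := P.target_corolla
  pt _ := none
  eq_pt _ n := match n with
    | none => rfl
    | some n => PEmpty.elim n.2
  src_pt _ := rfl
  mul M F := P.substTree M F.1 F.2
  tgt_mul M F := P.target_substTree M F.1 F.2
  pos M F := P.plusPos M F
  src_pos M F x := P.src_plusPos M F x
  mul_one M := P.plus_mul_one M
  mul_one_pos M n := P.plus_mul_one_pos M n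
  one_mul b F := P.plus_one_mul b F
  one_mul_pos b F f := P.plus_one_mul_pos b F f
  assoc M F G := P.plus_assoc M F G _ _
  assoc_pos M F G n m g := P.plus_assoc_pos M F G _ _ n m g

end PolyMonad


/-- A finite rooted tree with boundary, with its dots and leaves numbered. Every dot and every
leaf has one output edge, which goes to a dot, its parent, or is the root edge (`none`). The unit
tree has no dots and one leaf. Spheres and dots of a nesting are the dots and leaves of the
corresponding tree. -/
structure RTree where
  dots : ℕ
  leaves : ℕ
  parent : Fin dots ⊕ Fin leaves → Option (Fin dots)
  existsUnique_root : ∃! v, parent v = none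
  acyclic : WellFounded fun x y : Fin dots => parent (.inl x) = some y

namespace RTree

/-- The dots and leaves. -/
abbrev Elt (N : RTree) : Type := Fin N.dots ⊕ Fin N.leaves

/-- The dot or leaf whose output edge is the root edge. -/
noncomputable def root (N : RTree) : N.Elt := N.existsUnique_root.choose

/-- The partial order, in which the root is the largest element. -/
def Le (N : RTree) : N.Elt → N.Elt → Prop :=
  Relation.ReflTransGen fun v w => ∃ x, w = .inl x ∧ N.parent v = some x

/-- Null-dots: dots without input edges. -/
def IsNull (N : RTree) (x : Fin N.dots) : Prop := ∀ v, N.parent v ≠ some x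

theorem not_cycle (N : RTree) (x : Fin N.dots) (y : N.Elt) (hy : N.parent y = some x)
    (h : N.Le (.inl x) y) : False := by
  have key : ∀ a b : N.Elt, N.Le a b → ∀ x, a = .inl x →
      ∃ z, b = .inl z ∧ Relation.ReflTransGen
        (fun x y : Fin N.dots => N.parent (.inl x) = some y) x z := by
    intro a b h
    induction h with
    | refl => exact fun x hx => ⟨x, hx, .refl⟩
    | tail _ hs ih =>
      intro x hx
      obtain ⟨z, rfl, hz⟩ := ih x hx
      obtain ⟨w, rfl, hw⟩ := hs
      exact ⟨w, rfl, hz.tail hw⟩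
  obtain ⟨z, rfl, hz⟩ := key _ _ h x rfl
  exact (N.acyclic.transGen.irrefl).irrefl x (Relation.TransGen.tail' hz hy)

theorem child_unique (N : RTree) (x : Fin N.dots) (v y z : N.Elt) (hy : N.parent y = some x)
    (hz : N.parent z = some x) (hvy : N.Le v y) (hvz : N.Le v z) : y = z := by
  have key : ∀ y z : N.Elt, N.parent y = some x → N.parent z = some x → N.Le y z → y = z := by
    intro y z hy hz h
    rcases Relation.ReflTransGen.cases_head h with h | ⟨w, ⟨x', rfl, hw⟩, h⟩
    · exact h
    · obtain rfl : x = x' := Option.some.inj (hy.symm.trans hw)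
      exact (N.not_cycle x z hz h).elim
  have hu : Relator.RightUnique fun v w : N.Elt => ∃ x, w = .inl x ∧ N.parent v = some x := by
    rintro a b c ⟨x, rfl, hx⟩ ⟨x', rfl, hx'⟩
    rw [Option.some.inj (hx.symm.trans hx')]
  rcases Relation.ReflTransGen.total_of_right_unique hu hvy hvz with h | h
  · exact key y z hy hz h
  · exact (key z y hz hy h).symm

open Classical in
/-- The child of `x` that is above `v` in the partial order, if there is one. -/
noncomputable def childAbove (N : RTree) (x : Fin N.dots) (v : N.Elt) : Option N.Elt :=
  if h : ∃ y, N.parent y = some x ∧ N.Le v y then some h.choose else none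

theorem childAbove_eq_some (N : RTree) (x : Fin N.dots) (v y : N.Elt) :
    N.childAbove x v = some y ↔ N.parent y = some x ∧ N.Le v y := by
  unfold childAbove
  split_ifs with h
  · rw [Option.some.injEq]
    constructor
    · rintro rfl
      exact h.choose_spec
    · intro hy
      exact N.child_unique x v _ _ h.choose_spec.1 hy.1 h.choose_spec.2 hy.2
  · exact iff_of_false (by simp) fun hy => h ⟨y, hy⟩

end RTree

namespace PolyEndo

variable {I : Type u}

/-- `P` with operations labelled in `Y`; its trees are `P`-trees with nodes labelled in `Y`. -/
def lab (P : PolyEndo I) (Y : Type) : PolyEndo I where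
  Op := P.Op × Y
  Ar b := P.Ar b.1
  finite_ar b := P.finite_ar b.1
  src b := P.src b.1
  tgt b := P.tgt b.1

/-- The polynomial endofunctor whose trees are the subdivisions of `P`-trees: a black dot is
decorated by an operation of `P` and named by an element of `L`, a white dot has one input edge of
the same type as its output edge and is named by an element of `D`. -/
def subdiv (P : PolyEndo I) (L D : Type) : PolyEndo I where
  Op := (P.Op × L) ⊕ (I × D)
  Ar := Sum.elim (fun b => P.Ar b.1) (fun _ => PUnit)
  finite_ar b := match b with
    | .inl b => P.finite_ar b.1
    | .inr _ => (inferInstance : Finite PUnit.{u+1})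
  src b := match b with
    | .inl b => P.src b.1
    | .inr i => fun _ => i.1
  tgt := Sum.elim (fun b => P.tgt b.1) (fun i => i.1)

namespace PreTree

variable {P : PolyEndo I}

/-- Forget the labels. -/
def forget {Y : Type} : PreTree (P.lab Y) → PreTree P
  | edge i => edge i
  | node b ch => node b.1 fun e => (ch e).forget

theorem root_forget {Y : Type} (T : PreTree (P.lab Y)) : T.forget.root = T.root := by
  cases T <;> rfl

theorem valid_forget {Y : Type} (T : PreTree (P.lab Y)) (h : T.Valid) : T.forget.Valid := by
  induction T with
  | edge i => trivial
  | node b ch ih => exact fun e => ⟨(root_forget _).trans (h e).1, ih e (h e).2⟩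

/-- The label of a node. -/
def nodeLab {Y : Type} : (T : PreTree (P.lab Y)) → T.forget.Node → Y
  | edge _, n => n.elim
  | node b _, none => b.2
  | node _ ch, some n => (ch n.1).nodeLab n.2

/-- Change the labels. -/
def mapLab {Y Z : Type} (f : Y → Z) : PreTree (P.lab Y) → PreTree (P.lab Z)
  | edge i => edge i
  | node b ch => node (P := P.lab Z) (b.1, f b.2) fun e => (ch e).mapLab f

theorem forget_mapLab {Y Z : Type} (f : Y → Z) (T : PreTree (P.lab Y)) :
    (T.mapLab f).forget = T.forget := by
  induction T with
  | edge i => rfl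
  | node b ch ih => exact congrArg (node b.1) (funext ih)

theorem root_mapLab {Y Z : Type} (f : Y → Z) (T : PreTree (P.lab Y)) :
    (T.mapLab f).root = T.root := by
  cases T <;> rfl

theorem valid_mapLab {Y Z : Type} (f : Y → Z) (T : PreTree (P.lab Y)) (h : T.Valid) :
    (T.mapLab f).Valid := by
  induction T with
  | edge i => trivial
  | node b ch ih =>
    intro e
    exact ⟨(root_mapLab f (ch e)).trans (h e).1, ih e (h e).2⟩

/-- Some label is in `S`. -/
def Meets {Y : Type} (S : Set Y) : PreTree (P.lab Y) → Prop
  | edge _ => False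
  | node b ch => b.2 ∈ S ∨ ∃ e, (ch e).Meets S

open Classical in
/-- The part of the tree lying above the lowest node with label in `S` (used when such labels form
a connected part). -/
noncomputable def subtreeAt {Y : Type} (S : Set Y) : PreTree (P.lab Y) → PreTree (P.lab Y)
  | edge i => edge i
  | node b ch =>
    if b.2 ∈ S then node b ch
    else if h : ∃ e, (ch e).Meets S then (ch h.choose).subtreeAt S
    else edge (P.tgt b.1)

theorem valid_subtreeAt {Y : Type} (S : Set Y) (T : PreTree (P.lab Y)) (h : T.Valid) :
    (T.subtreeAt S).Valid := by
  induction T with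
  | edge i => trivial
  | node b ch ih =>
    unfold subtreeAt
    split_ifs
    · exact h
    · exact ih _ (h _).2
    · trivial

theorem meets_mapLab {Y Z : Type} (f : Y → Z) (S : Set Z) (T : PreTree (P.lab Y)) :
    (T.mapLab f).Meets S ↔ T.Meets (f ⁻¹' S) := by
  induction T with
  | edge i => exact Iff.rfl
  | node b ch ih => exact or_congr Iff.rfl (exists_congr ih)

theorem subtreeAt_mapLab {Y Z : Type} (f : Y → Z) (S : Set Z) (T : PreTree (P.lab Y)) :
    (T.mapLab f).subtreeAt S = (T.subtreeAt (f ⁻¹' S)).mapLab f := by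
  induction T with
  | edge i => rfl
  | node b ch ih =>
    have hp : (fun e => ((ch e).mapLab f).Meets S) = fun e => (ch e).Meets (f ⁻¹' S) :=
      funext fun e => propext (meets_mapLab f S (ch e))
    have hc : ∀ (p q : P.Ar b.1 → Prop) (_ : p = q) (hp : ∃ e, p e) (hq : ∃ e, q e),
        hp.choose = hq.choose := by
      rintro p q rfl hp hq
      rfl
    by_cases h1 : f b.2 ∈ S
    · simp [subtreeAt, mapLab, h1]
    · by_cases h2 : ∃ e, (ch e).Meets (f ⁻¹' S)
      · have h3 : ∃ e, ((ch e).mapLab f).Meets S := by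
          obtain ⟨e, he⟩ := h2
          exact ⟨e, (meets_mapLab f S (ch e)).2 he⟩
        have e1 : ((node b ch).mapLab f).subtreeAt S =
            ((ch h3.choose).mapLab f).subtreeAt S := by
          refine (if_neg h1).trans (dif_pos h3)
        have e2 : (node b ch).subtreeAt (f ⁻¹' S) = (ch h2.choose).subtreeAt (f ⁻¹' S) := by
          refine (if_neg h1).trans (dif_pos h2)
        rw [e1, e2, ih, show h3.choose = h2.choose from hc _ _ hp h3 h2]
      · have h3 : ¬ ∃ e, ((ch e).mapLab f).Meets S := by
          rintro ⟨e, he⟩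
          exact h2 ⟨e, (meets_mapLab f S (ch e)).1 he⟩
        have e1 : ((node b ch).mapLab f).subtreeAt S = edge (P.tgt b.1) :=
          (if_neg h1).trans (dif_neg h3)
        have e2 : (node b ch).subtreeAt (f ⁻¹' S) = edge (P.tgt b.1) :=
          (if_neg h1).trans (dif_neg h2)
        rw [e1, e2]
        rfl

/-- The node at the lower end of the output edge of a node, if any. -/
def parentNode : (T : PreTree P) → T.Node → Option T.Node
  | edge _, n => n.elim
  | node _ _, none => none
  | node _ ch, some n => some (((ch n.1).parentNode n.2).map fun m => ⟨n.1, m⟩)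

/-- The graph of nodes and inner edges. -/
def nodeGraph (T : PreTree P) : SimpleGraph T.Node :=
  SimpleGraph.fromRel fun m n => T.parentNode m = some n

/-- A kernel is a set of dots that spans a non-empty connected subgraph. -/
def IsKernel (T : PreTree P) (K : Set T.Node) : Prop := (T.nodeGraph.induce K).Connected


/-- The name of a dot of a subdivided tree. -/
def name {L D : Type} (T : PreTree (P.subdiv L D)) (n : T.Node) : D ⊕ L :=
  match T.dec n with
  | .inl b => .inr b.2
  | .inr i => .inl i.2

/-- Change the names. -/
def rename {L L' D D' : Type} (f : L → L') (g : D → D') :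
    PreTree (P.subdiv L D) → PreTree (P.subdiv L' D')
  | edge i => edge i
  | node (.inl b) ch => node (P := P.subdiv L' D') (.inl (b.1, f b.2)) fun e => (ch e).rename f g
  | node (.inr i) ch => node (P := P.subdiv L' D') (.inr (i.1, g i.2)) fun e => (ch e).rename f g

theorem rename_id {L D : Type} (T : PreTree (P.subdiv L D)) : T.rename id id = T := by
  induction T with
  | edge i => rfl
  | node b ch ih =>
    rcases b with b | b
    · exact congrArg (node (P := P.subdiv L D) (.inl b)) (funext ih)
    · exact congrArg (node (P := P.subdiv L D) (.inr b)) (funext ih)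

theorem rename_rename {L L' L'' D D' D'' : Type} (f : L → L') (g : D → D') (f' : L' → L'')
    (g' : D' → D'') (T : PreTree (P.subdiv L D)) :
    (T.rename f g).rename f' g' = T.rename (f' ∘ f) (g' ∘ g) := by
  induction T with
  | edge i => rfl
  | node b ch ih =>
    rcases b with b | b
    · exact congrArg (node (P := P.subdiv L'' D'') (.inl (b.1, f' (f b.2)))) (funext ih)
    · exact congrArg (node (P := P.subdiv L'' D'') (.inr (b.1, g' (g b.2)))) (funext ih)

/-- Erase the white dots, keeping the names of the black ones. -/
def erase {L D : Type} : PreTree (P.subdiv L D) → PreTree (P.lab L)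
  | edge i => edge i
  | node (.inl b) ch => node (P := P.lab L) b fun e => (ch e).erase
  | node (.inr _) ch => (ch PUnit.unit).erase

theorem valid_erase {L D : Type} (T : PreTree (P.subdiv L D)) (h : T.Valid) :
    T.erase.Valid ∧ T.erase.root = T.root := by
  induction T with
  | edge i => exact ⟨trivial, rfl⟩
  | node b ch ih =>
    rcases b with b | b
    · exact ⟨fun e => ⟨(ih e (h e).2).2.trans (h e).1, (ih e (h e).2).1⟩, rfl⟩
    · exact ⟨(ih PUnit.unit (h _).2).1, (ih PUnit.unit (h _).2).2.trans (h PUnit.unit).1⟩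

theorem erase_rename {L L' D D' : Type} (f : L → L') (g : D → D') (T : PreTree (P.subdiv L D)) :
    (T.rename f g).erase = T.erase.mapLab f := by
  induction T with
  | edge i => rfl
  | node b ch ih =>
    rcases b with b | b
    · exact congrArg (node (P := P.lab L') (b.1, f b.2)) (funext ih)
    · exact ih PUnit.unit

end PreTree

end PolyEndo

namespace PolyMonad

open PolyEndo PreTree

variable {I : Type u} (P : PolyMonad I)

/-- Regard the white dots as nodes decorated by units of `P`. -/
def fillWhite {L D : Type} :
    (P.toPolyEndo.subdiv L D).PreTree → (P.toPolyEndo.lab (D ⊕ L)).PreTree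
  | edge i => edge i
  | node (.inl b) ch => node (P := P.toPolyEndo.lab (D ⊕ L)) (b.1, .inr b.2)
      fun e => fillWhite (ch e)
  | node (.inr i) ch => node (P := P.toPolyEndo.lab (D ⊕ L)) (P.one i.1, .inl i.2)
      fun _ => fillWhite (ch PUnit.unit)

theorem valid_fillWhite {L D : Type} (T : (P.toPolyEndo.subdiv L D).PreTree) (h : T.Valid) :
    (P.fillWhite T).Valid ∧ (P.fillWhite T).root = T.root := by
  induction T with
  | edge i => exact ⟨trivial, rfl⟩
  | node b ch ih =>
    rcases b with b | b
    · exact ⟨fun e => ⟨(ih e (h e).2).2.trans (h e).1, (ih e (h e).2).1⟩, rfl⟩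
    · refine ⟨fun e => ⟨((ih PUnit.unit (h _).2).2.trans (h PUnit.unit).1).trans ?_,
        (ih PUnit.unit (h _).2).1⟩, P.tgt_one b.1⟩
      exact (P.src_pt b.1).symm.trans (congrArg _ (P.eq_pt b.1 e).symm)

theorem fillWhite_rename {L L' D D' : Type} (f : L → L') (g : D → D')
    (T : (P.toPolyEndo.subdiv L D).PreTree) :
    P.fillWhite (T.rename f g) = (P.fillWhite T).mapLab (Sum.map g f) := by
  induction T with
  | edge i => rfl
  | node b ch ih =>
    rcases b with b | b
    · exact congrArg (node (P := P.toPolyEndo.lab (D' ⊕ L')) (b.1, .inr (f b.2))) (funext ih)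
    · exact congrArg (node (P := P.toPolyEndo.lab (D' ⊕ L')) (P.one b.1, .inl (g b.2)))
        (funext fun _ => ih PUnit.unit)

/-- Labelled `P`-trees with root edge `i`. -/
abbrev TreeOver (Z : Type) (i : I) : Type u :=
  {U : (P.toPolyEndo.lab Z).PreTree // U.root = i ∧ U.Valid}

/-- An operation with output type `i` and a labelled tree on each of its inputs. -/
structure Part (Z : Type) (i : I) where
  op : P.Op
  tgt_op : P.tgt op = i
  ch : ∀ e : P.Ar op, P.TreeOver Z (P.src op e)

variable {P}

/-- The unit operation with a given tree on its input. -/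
def Part.hang {Z : Type} {i : I} (U : P.TreeOver Z i) : P.Part Z i where
  op := P.one i
  tgt_op := P.tgt_one i
  ch e := ⟨U.1, U.2.1.trans ((P.src_pt i).symm.trans (congrArg _ (P.eq_pt i e).symm)), U.2.2⟩

/-- Compose `b` with the operations given on its inputs. -/
def Part.comp {Z : Type} (b : P.Op) (X : ∀ e : P.Ar b, P.Part Z (P.src b e)) :
    P.Part Z (P.tgt b) where
  op := P.mul b ⟨fun e => (X e).op, fun e => (X e).tgt_op⟩
  tgt_op := P.tgt_mul _ _
  ch q :=
    let p := (P.pos b ⟨fun e => (X e).op, fun e => (X e).tgt_op⟩).symm q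
    ⟨((X p.1).ch p.2).1, ((X p.1).ch p.2).2.1.trans ((P.src_pos b _ p).symm.trans
      (congrArg _ ((P.pos b ⟨fun e => (X e).op, fun e => (X e).tgt_op⟩).apply_symm_apply q))),
      ((X p.1).ch p.2).2.2⟩

/-- Regard the operation as a node with label `z`. -/
def Part.toTree {Z : Type} {i : I} (X : P.Part Z i) (z : Z) : P.TreeOver Z i :=
  ⟨node (P := P.toPolyEndo.lab Z) (X.op, z) fun e => (X.ch e).1, X.tgt_op, fun e => (X.ch e).2⟩

/-- For the part `X z` of a tree having colour `z` at the root: the contracted tree, when `o` is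
the colour of the root node. Without a colour the tree is cut at the root edge. -/
def Part.pick {Z : Type} {i : I} (o : Option Z) (X : Z → P.Part Z i) : P.TreeOver Z i :=
  match o with
  | none => ⟨edge i, rfl, trivial⟩
  | some z => (X z).toTree z

open Classical in
/-- The connected part of colour `z` at the root, when `o` is the colour of the root node. -/
noncomputable def Part.select {Z : Type} {i : I} (o : Option Z) (X : Z → P.Part Z i) (z : Z) :
    P.Part Z i :=
  if o = some z then X z else Part.hang (Part.pick o X)

variable (P)

/-- By recursion on a tree: for each colour `z` the composite of the connected part of colour `z`
at the root, with the contracted trees on its inputs, and the contracted tree itself. -/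
noncomputable def contractAux {Y Z : Type} (c : Y → Option Z) :
    (T : (P.toPolyEndo.lab Y).PreTree) → T.Valid → (i : I) → T.root = i →
      (Z → P.Part Z i) × P.TreeOver Z i
  | edge j, _, _, h => (fun _ => Part.hang ⟨edge j, h, trivial⟩, ⟨edge j, h, trivial⟩)
  | node b ch, v, _, rfl =>
    let X : Z → P.Part Z (P.tgt b.1) := fun z =>
      Part.comp b.1 fun e => (contractAux c (ch e) (v e).2 (P.src b.1 e) (v e).1).1 z
    (Part.select (c b.2) X, Part.pick (c b.2) X)

/-- Given a colouring of some of the labels, cut off the tree at the nodes without a colour and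
contract each inner edge joining two nodes of the same colour, using the monad structure. The nodes
of the result are labelled by the colours. -/
noncomputable def contract {Y Z : Type} (c : Y → Option Z) (T : (P.toPolyEndo.lab Y).PreTree)
    (v : T.Valid) : (P.toPolyEndo.lab Z).PreTree :=
  (P.contractAux c T v T.root rfl).2.1

theorem valid_contract {Y Z : Type} (c : Y → Option Z) (T : (P.toPolyEndo.lab Y).PreTree)
    (v : T.Valid) : (P.contract c T v).Valid :=
  (P.contractAux c T v T.root rfl).2.2.2

/-- Change the labels. -/
def mapTreeOver {Z Z' : Type} (g : Z → Z') {i : I} (U : P.TreeOver Z i) : P.TreeOver Z' i :=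
  ⟨U.1.mapLab g, (root_mapLab g U.1).trans U.2.1, valid_mapLab g U.1 U.2.2⟩

/-- Change the labels. -/
def mapPart {Z Z' : Type} (g : Z → Z') {i : I} (X : P.Part Z i) : P.Part Z' i :=
  ⟨X.op, X.tgt_op, fun e => P.mapTreeOver g (X.ch e)⟩

theorem pick_map {Z Z' : Type} (g : Z → Z') {i : I} (o : Option Z) (X : Z → P.Part Z i)
    (X' : Z' → P.Part Z' i) (h : ∀ z, X' (g z) = P.mapPart g (X z)) :
    Part.pick (o.map g) X' = P.mapTreeOver g (Part.pick o X) := by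
  cases o with
  | none => rfl
  | some z =>
    refine (congrArg (fun X => Part.toTree X (g z)) (h z)).trans ?_
    rfl

theorem select_map {Z Z' : Type} (g : Z → Z') (hg : Function.Injective g) {i : I} (o : Option Z)
    (X : Z → P.Part Z i) (X' : Z' → P.Part Z' i) (h : ∀ z, X' (g z) = P.mapPart g (X z)) (z : Z) :
    Part.select (o.map g) X' (g z) = P.mapPart g (Part.select o X z) := by
  have e : o.map g = some (g z) ↔ o = some z := by
    cases o with
    | none => simp
    | some w => simp [hg.eq_iff]
  unfold Part.select
  by_cases ho : o = some z
  · rw [if_pos ho, if_pos (e.2 ho), h]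
  · rw [if_neg ho, if_neg (fun h => ho (e.1 h)), P.pick_map g o X X' h]
    rfl

theorem contractAux_mapLab {Y Y' Z Z' : Type} (c : Y → Option Z) (c' : Y' → Option Z')
    (f : Y → Y') (g : Z → Z') (hg : Function.Injective g) (hc : ∀ y, c' (f y) = (c y).map g)
    (T : (P.toPolyEndo.lab Y).PreTree) (v : T.Valid) (v' : (T.mapLab f).Valid) (i : I)
    (h : T.root = i) (h' : (T.mapLab f).root = i) :
    (P.contractAux c' (T.mapLab f) v' i h').2 = P.mapTreeOver g (P.contractAux c T v i h).2 ∧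
    ∀ z, (P.contractAux c' (T.mapLab f) v' i h').1 (g z) =
      P.mapPart g ((P.contractAux c T v i h).1 z) := by
  induction T generalizing i with
  | edge j => exact ⟨rfl, fun z => rfl⟩
  | node b ch ih =>
    subst h
    have H : ∀ z, (Part.comp b.1 fun e => (P.contractAux c' ((ch e).mapLab f) (v' e).2
        (P.src b.1 e) (v' e).1).1 (g z)) = P.mapPart g (Part.comp b.1 fun e =>
          (P.contractAux c (ch e) (v e).2 (P.src b.1 e) (v e).1).1 z) := by
      intro z
      refine (congrArg (Part.comp b.1) (funext fun e =>
        (ih e (v e).2 (v' e).2 _ (v e).1 (v' e).1).2 z)).trans ?_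
      rfl
    have key : ∀ (o' : Option Z') (ho : o' = (c b.2).map g) (X' : Z' → P.Part Z' (P.tgt b.1))
        (X : Z → P.Part Z (P.tgt b.1)) (hX : ∀ z, X' (g z) = P.mapPart g (X z)),
        Part.pick o' X' = P.mapTreeOver g (Part.pick (c b.2) X) ∧
        ∀ z, Part.select o' X' (g z) = P.mapPart g (Part.select (c b.2) X z) := by
      rintro o' rfl X' X hX
      exact ⟨P.pick_map g _ X X' hX, P.select_map g hg _ X X' hX⟩
    exact key _ (hc b.2) _ _ H

end PolyMonad

namespace PolyEndo

open PreTree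

/-- A `P`-constellation: an abstract tree `nest` (the nesting), and a subdivision `tree` of a
`P`-tree, with bijections from its black dots to the leaves of `nest` and from its white dots to
the null-dots of `nest`, such that for each dot `x` of `nest` the dots of `tree` corresponding to
elements below `x` form a kernel. The bijections are given by naming the dots of `tree`. The dots
of `nest` are the spheres of the constellation, or its layers; its leaves are the dots. -/
structure Constellation {I : Type u} (P : PolyEndo I) where
  nest : RTree
  tree : (P.subdiv (Fin nest.leaves) (Fin nest.dots)).Tree
  name_injective : Function.Injective tree.1.name
  leaf_named : ∀ l, ∃ n, tree.1.name n = .inr l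
  dot_named : ∀ x, (∃ n, tree.1.name n = .inl x) ↔ nest.IsNull x
  kernel_rule : ∀ x, tree.1.IsKernel {n | nest.Le (tree.1.name n) (.inl x)}

namespace Constellation

variable {I : Type u} {P : PolyEndo I}

/-- Isomorphisms of `P`-constellations. As subdivided `P`-trees are rigid and `tree` stands for
its isomorphism class, these are isomorphisms of the nestings that match the names. -/
structure Iso (C C' : P.Constellation) where
  dot : Fin C.nest.dots ≃ Fin C'.nest.dots
  leaf : Fin C.nest.leaves ≃ Fin C'.nest.leaves
  parent_map : ∀ v, C'.nest.parent (Sum.map dot leaf v) = (C.nest.parent v).map dot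
  tree_eq : C.tree.1.rename leaf dot = C'.tree.1

/-- The identity. -/
def Iso.refl (C : P.Constellation) : Iso C C where
  dot := Equiv.refl _
  leaf := Equiv.refl _
  parent_map v := by simp
  tree_eq := rename_id _

/-- The inverse. -/
def Iso.symm {C C' : P.Constellation} (f : Iso C C') : Iso C' C where
  dot := f.dot.symm
  leaf := f.leaf.symm
  parent_map v := by
    have h := f.parent_map (Sum.map f.dot.symm f.leaf.symm v)
    have hv : Sum.map f.dot f.leaf (Sum.map f.dot.symm f.leaf.symm v) = v := by
      cases v <;> simp
    rw [hv] at h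
    rw [h, Option.map_map]
    simp
  tree_eq := by
    rw [← f.tree_eq, rename_rename]
    simp [rename_id]

/-- Composition. -/
def Iso.trans {C C' C'' : P.Constellation} (f : Iso C C') (g : Iso C' C'') : Iso C C'' where
  dot := f.dot.trans g.dot
  leaf := f.leaf.trans g.leaf
  parent_map v := by
    have h := g.parent_map (Sum.map f.dot f.leaf v)
    rw [f.parent_map, Option.map_map, Sum.map_map] at h
    exact h
  tree_eq := by
    rw [← g.tree_eq, ← f.tree_eq, rename_rename]
    rfl

theorem Iso.le_map {C C' : P.Constellation} (f : Iso C C') {v w : C.nest.Elt}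
    (h : C.nest.Le v w) : C'.nest.Le (Sum.map f.dot f.leaf v) (Sum.map f.dot f.leaf w) := by
  induction h with
  | refl => exact .refl
  | tail _ hs ih =>
    obtain ⟨x, rfl, hx⟩ := hs
    refine ih.tail ⟨f.dot x, rfl, ?_⟩
    rw [f.parent_map, hx]
    rfl

theorem Iso.map_symm {C C' : P.Constellation} (f : Iso C C') (v : C.nest.Elt) :
    Sum.map f.symm.dot f.symm.leaf (Sum.map f.dot f.leaf v) = v := by
  cases v <;> simp [Iso.symm]

theorem Iso.le_map_iff {C C' : P.Constellation} (f : Iso C C') (v w : C.nest.Elt) :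
    C'.nest.Le (Sum.map f.dot f.leaf v) (Sum.map f.dot f.leaf w) ↔ C.nest.Le v w := by
  refine ⟨fun h => ?_, f.le_map⟩
  have := f.symm.le_map h
  rwa [f.map_symm, f.map_symm] at this

theorem Iso.childAbove {C C' : P.Constellation} (f : Iso C C') (x : Fin C.nest.dots)
    (v : C.nest.Elt) : C'.nest.childAbove (f.dot x) (Sum.map f.dot f.leaf v) =
      (C.nest.childAbove x v).map (Sum.map f.dot f.leaf) := by
  have hinj : Function.Injective f.dot := f.dot.injective
  ext w
  obtain ⟨w, rfl⟩ : ∃ w', Sum.map f.dot f.leaf w' = w :=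
    ⟨Sum.map f.dot.symm f.leaf.symm w, by cases w <;> simp⟩
  have hm : Function.Injective (Sum.map f.dot f.leaf) := hinj.sumMap f.leaf.injective
  simp only [RTree.childAbove_eq_some, Option.map_eq_some_iff, f.le_map_iff,
    f.parent_map]
  constructor
  · rintro ⟨⟨x', hx', hxx⟩, h2⟩
    exact ⟨w, ⟨by rw [hx', hinj hxx], h2⟩, rfl⟩
  · rintro ⟨w', ⟨h1, h2⟩, h3⟩
    obtain rfl := hm h3
    exact ⟨⟨x, h1, rfl⟩, h2⟩

/-- Isomorphism of `P`-constellations. -/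
def setoid (P : PolyEndo I) : Setoid P.Constellation where
  r C C' := Nonempty (Iso C C')
  iseqv := ⟨fun C => ⟨.refl C⟩, fun ⟨f⟩ => ⟨f.symm⟩, fun ⟨f⟩ ⟨g⟩ => ⟨f.trans g⟩⟩

/-- Isomorphism of `P`-constellations with a marked layer. -/
def markedSetoid (P : PolyEndo I) : Setoid (Σ C : P.Constellation, Fin C.nest.dots) where
  r C C' := ∃ f : Iso C.1 C'.1, f.dot C.2 = C'.2
  iseqv := ⟨fun C => ⟨.refl C.1, rfl⟩,
    fun ⟨f, hf⟩ => ⟨f.symm, by rw [← hf]; exact f.dot.symm_apply_apply _⟩,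
    fun ⟨f, hf⟩ ⟨g, hg⟩ => ⟨f.trans g, by rw [← hg, ← hf]; rfl⟩⟩

end Constellation

/-- The set `const(P)` of isomorphism classes of `P`-constellations. -/
def Const {I : Type u} (P : PolyEndo I) : Type u := Quotient (Constellation.setoid P)

/-- The set `const°(P)` of isomorphism classes of `P`-constellations with a marked layer. -/
def MarkedConst {I : Type u} (P : PolyEndo I) : Type u := Quotient (Constellation.markedSetoid P)

namespace Constellation

variable {I : Type u} {P : PolyEndo I}

/-- The isomorphism class. -/
def cls (C : P.Constellation) : P.Const := Quotient.mk _ C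

/-- The isomorphism class of `C` with the layer `x` marked. -/
def markedCls (C : P.Constellation) (x : Fin C.nest.dots) : P.MarkedConst := Quotient.mk _ ⟨C, x⟩

/-- The underlying `P`-tree, with its dots labelled by the leaves of the nesting. -/
def underLab (C : P.Constellation) : (P.lab (Fin C.nest.leaves)).PreTree := C.tree.1.erase

/-- The underlying `P`-tree. -/
def underlying (C : P.Constellation) : P.Tree :=
  ⟨C.underLab.forget, valid_forget _ (valid_erase _ C.tree.2).1⟩

theorem Iso.underlying_eq {C C' : P.Constellation} (f : Iso C C') :
    C.underlying = C'.underlying := by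
  refine Subtype.ext ?_
  simp only [underlying, underLab]
  rw [← f.tree_eq, erase_rename, forget_mapLab]

end Constellation

/-- Forget the mark. -/
def MarkedConst.unmark {I : Type u} {P : PolyEndo I} : P.MarkedConst → P.Const :=
  Quotient.map' (fun C => C.1) fun _ _ ⟨f, _⟩ => ⟨f⟩

/-- The underlying `P`-tree, on isomorphism classes. -/
def Const.underlying {I : Type u} {P : PolyEndo I} : P.Const → P.Tree :=
  Quotient.lift Constellation.underlying fun _ _ ⟨f⟩ => f.underlying_eq

theorem MarkedConst.finite {I : Type u} {P : PolyEndo I} (c : P.Const) :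
    Finite {q : P.MarkedConst // q.unmark = c} := by
  induction c using Quotient.inductionOn with
  | _ C =>
    refine Finite.of_surjective (α := Fin C.nest.dots) (fun x => ⟨C.markedCls x, rfl⟩) ?_
    rintro ⟨q, hq⟩
    induction q using Quotient.inductionOn with
    | _ q =>
      obtain ⟨f⟩ := Quotient.exact hq
      exact ⟨f.dot q.2, Subtype.ext (Quotient.sound ⟨f.symm, f.dot.symm_apply_apply _⟩)⟩

end PolyEndo

namespace PolyMonad

open PolyEndo PreTree

variable {I : Type u} (P : PolyMonad I)

/-- `P`-constellations, for a polynomial monad. -/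
abbrev Constel : Type u := P.toPolyEndo.Constellation

variable {P}

/-- The `P`-tree seen in the layer `x`: the tree contained in the sphere `x`, with the part
contained in each child of `x` contracted to a node, which is labelled by that child. For a null
sphere it is the unit tree. -/
noncomputable def layerLab (C : P.Constel) (x : Fin C.nest.dots) :
    (P.toPolyEndo.lab C.nest.Elt).PreTree :=
  P.contract (C.nest.childAbove x)
    ((P.fillWhite C.tree.1).subtreeAt {v | C.nest.Le v (.inl x)})
    (valid_subtreeAt _ _ (P.valid_fillWhite _ C.tree.2).1)

/-- The `P`-tree seen in the layer `x`. -/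
noncomputable def layerTree (C : P.Constel) (x : Fin C.nest.dots) : P.toPolyEndo.Tree :=
  ⟨(layerLab C x).forget, valid_forget _ (P.valid_contract _ _ _)⟩

theorem layerLab_iso {C C' : P.Constel} (f : Constellation.Iso C C') (x : Fin C.nest.dots) :
    layerLab C' (f.dot x) = (layerLab C x).mapLab (Sum.map f.dot f.leaf) := by
  have key : ∀ (T T' : (P.toPolyEndo.lab C'.nest.Elt).PreTree) (_ : T = T') (v : T.Valid)
      (v' : T'.Valid), P.contract (C'.nest.childAbove (f.dot x)) T v =
        P.contract (C'.nest.childAbove (f.dot x)) T' v' := by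
    rintro T T' rfl v v'
    rfl
  have hS : Sum.map f.dot f.leaf ⁻¹' {v | C'.nest.Le v (.inl (f.dot x))} =
      {v | C.nest.Le v (.inl x)} := by
    ext v
    exact f.le_map_iff v (.inl x)
  have hT : (P.fillWhite C'.tree.1).subtreeAt {v | C'.nest.Le v (.inl (f.dot x))} =
      ((P.fillWhite C.tree.1).subtreeAt {v | C.nest.Le v (.inl x)}).mapLab
        (Sum.map f.dot f.leaf) := by
    rw [← f.tree_eq, P.fillWhite_rename, subtreeAt_mapLab, hS]
  have v := valid_subtreeAt {v | C.nest.Le v (.inl x)} _ (P.valid_fillWhite _ C.tree.2).1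
  refine (key _ _ hT _ (valid_mapLab _ _ v)).trans ?_
  have := (P.contractAux_mapLab (C.nest.childAbove x) (C'.nest.childAbove (f.dot x))
    (Sum.map f.dot f.leaf) (Sum.map f.dot f.leaf)
    (f.dot.injective.sumMap f.leaf.injective) (f.childAbove x) _ v (valid_mapLab _ _ v) _
    (root_mapLab _ _).symm rfl).1
  refine (congrArg Subtype.val this).trans ?_
  have key2 : ∀ (T : (P.toPolyEndo.lab C.nest.Elt).PreTree) (v : T.Valid) (i j : I)
      (h : T.root = i) (h' : T.root = j), (P.contractAux (C.nest.childAbove x) T v i h).2.1 =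
        (P.contractAux (C.nest.childAbove x) T v j h').2.1 := by
    rintro T v i j rfl rfl
    rfl
  exact congrArg (mapLab _) (key2 _ v _ _ _ _)

theorem layerTree_iso {C C' : P.Constel} (f : Constellation.Iso C C') (x : Fin C.nest.dots) :
    layerTree C x = layerTree C' (f.dot x) := by
  refine Subtype.ext ?_
  simp only [layerTree]
  rw [layerLab_iso f x, forget_mapLab]

variable (P)

/-- The `P`-tree seen in the marked layer, on isomorphism classes. -/
noncomputable def layerOf : P.toPolyEndo.MarkedConst → P.toPolyEndo.Tree :=
  Quotient.lift (fun C : Σ C : P.Constel, Fin C.nest.dots => layerTree C.1 C.2) (by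
    rintro ⟨C, x⟩ ⟨C', x'⟩ ⟨f, hf⟩
    exact (layerTree_iso f x).trans (congrArg (layerTree C') hf))

/-- The polynomial endofunctor `tr(P) ← const°(P) → const(P) → tr(P)`: return the tree seen in the
marked layer, forget the mark, return the underlying tree. -/
noncomputable def constEndo : PolyEndo P.plus.Op where
  Op := P.toPolyEndo.Const
  Ar c := {q : P.toPolyEndo.MarkedConst // q.unmark = c}
  finite_ar := MarkedConst.finite
  src _ q := P.layerOf q.1
  tgt := Const.underlying

variable {P}

/-- `D` is obtained from `C` by substituting, into each layer `x`, the constellation `F x`, whose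
underlying tree is the tree seen in the layer `x`; `s` tells which spheres of `D` come from which
sphere of `F x`. The underlying trees of `C` and `D` are the same (`k` matches their dots). The map
`g` sends a sphere or dot of `C` to what takes its place in `D`: for a dot this is the dot itself,
for a sphere `x` it is the outermost element of `F x`. The map `h x` sends the elements of `F x` to
elements of `D`: spheres to spheres, and a dot of `F x`, which is a node of the tree seen in the
layer `x` and hence a child of `x`, to what takes the place of that child. The tree seen in a layer
of `D` is the one seen in the corresponding layer of `F x`. -/
def IsSubst (C : P.Constel) (F : Fin C.nest.dots → P.Constel) (D : P.Constel)
    (s : (Σ x, Fin (F x).nest.dots) ≃ Fin D.nest.dots) : Prop :=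
  ∃ (g : C.nest.Elt → D.nest.Elt) (h : ∀ x, (F x).nest.Elt → D.nest.Elt)
    (k : Fin C.nest.leaves → Fin D.nest.leaves),
    D.underLab = C.underLab.mapLab k ∧
    (∀ l, g (.inr l) = .inr (k l)) ∧
    (∀ x, g (.inl x) = h x (F x).nest.root) ∧
    g C.nest.root = D.nest.root ∧
    (∀ x y, h x (.inl y) = .inl (s ⟨x, y⟩)) ∧
    (∀ x, (F x).underLab.mapLab (fun l => h x (.inr l)) = (layerLab C x).mapLab g) ∧
    ∀ x y, layerLab D (s ⟨x, y⟩) = (layerLab (F x) y).mapLab (h x)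

/-- `m` is the monad structure of the `P`-constellation monad: the unit sends a tree to the
constellation having a single sphere around that tree, and the multiplication is substitution of
constellations into layers. -/
structure IsConstellationMonad (m : P.constEndo.MonadStr) : Prop where
  one_iff : ∀ (T : P.toPolyEndo.Tree) (C : P.Constel),
    m.one T = C.cls ↔ C.nest.dots = 1 ∧ C.underlying = T
  mul_iff : ∀ (C : P.Constel) (c : P.constEndo.Fam C.cls) (F : Fin C.nest.dots → P.Constel),
    (∀ x, c.1 ⟨C.markedCls x, rfl⟩ = (F x).cls) → ∀ D : P.Constel,
      (m.mul C.cls c = D.cls ↔ ∃ s, IsSubst C F D s)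
  pos_eq : ∀ (C : P.Constel) (c : P.constEndo.Fam C.cls) (F : Fin C.nest.dots → P.Constel)
    (hF : ∀ x, c.1 ⟨C.markedCls x, rfl⟩ = (F x).cls) (D : P.Constel) (s), IsSubst C F D s →
      ∀ x y, (m.pos C.cls c ⟨⟨C.markedCls x, rfl⟩, ⟨(F x).markedCls y, (hF x).symm⟩⟩).1 =
        D.markedCls (s ⟨x, y⟩)

/-- The composition tree of a constellation, above a sphere or dot: it is the tree given by the
nesting, with each layer `x` decorated by the `P`-tree seen in it, the input edges being indexed by
the nodes of that tree, i.e. by the children of `x`; the leaf given by a dot is decorated by the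
local bouquet of that dot. The nodes are labelled by the layers. -/
inductive CompTree (C : P.Constel) :
    C.nest.Elt → (P.plus.toPolyEndo.lab (Fin C.nest.dots)).PreTree → Prop
  | leaf (n : C.tree.1.Node) (b : P.Op) (l : Fin C.nest.leaves)
      (h : C.tree.1.dec n = .inl (b, l)) : CompTree C (.inr l) (.edge b)
  | dot (x : Fin C.nest.dots)
      (ch : (layerTree C x).1.Node → (P.plus.toPolyEndo.lab (Fin C.nest.dots)).PreTree)
      (h : ∀ n, CompTree C ((layerLab C x).nodeLab n) (ch n)) :
      CompTree C (.inl x) (.node (layerTree C x, x) ch)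

/-- `M` is the composition tree of `C`, and `ν` sends each layer to the corresponding node. -/
def IsCompositionTree (C : P.Constel) (M : P.plus.toPolyEndo.PreTree)
    (ν : Fin C.nest.dots → M.Node) : Prop :=
  ∃ M' : (P.plus.toPolyEndo.lab (Fin C.nest.dots)).PreTree,
    CompTree C C.nest.root M' ∧ M'.forget = M ∧
    ∀ n, (⟨M'.forget, n⟩ : Σ T : P.plus.toPolyEndo.PreTree, T.Node) = ⟨M, ν (M'.nodeLab n)⟩

end PolyMonad

/-- An isomorphism of polynomial monads on `Set/I`: an invertible cartesian morphism over `I`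
compatible with the units and multiplications. -/
structure PolyMonadIso {I : Type u} (P Q : PolyMonad I) where
  op : P.Op ≃ Q.Op
  ar : ∀ b, P.Ar b ≃ Q.Ar (op b)
  tgt_op : ∀ b, Q.tgt (op b) = P.tgt b
  src_ar : ∀ b e, Q.src (op b) (ar b e) = P.src b e
  op_one : ∀ i, op (P.one i) = Q.one i
  op_mul : ∀ b (c : P.Fam b) (c' : Q.Fam (op b)), (∀ e, c'.1 (ar b e) = op (c.1 e)) →
    op (P.mul b c) = Q.mul (op b) c'
  ar_pos : ∀ b (c : P.Fam b) (c' : Q.Fam (op b)), (∀ e, c'.1 (ar b e) = op (c.1 e)) →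
    ∀ (e : P.Ar b) (f : P.Ar (c.1 e)) (f' : Q.Ar (c'.1 (ar b e))),
      (⟨_, ar _ f⟩ : Q.Input) = ⟨_, f'⟩ →
      (⟨_, ar _ (P.pos b c ⟨e, f⟩)⟩ : Q.Input) = ⟨_, Q.pos (op b) c' ⟨ar b e, f'⟩⟩

/-! A constellation and a `P⁺`-tree carry the same information. Given a constellation, decorating
each sphere of the nesting by the tree seen in its layer yields a tree of `P`-trees. Conversely, a
tree `M` of `P`-trees is expanded (`expand`): each leaf of `M` becomes a one-node tree, and from the
leaves downwards the trees obtained for the children of a node are substituted into the nodes of its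
decoration. A node decorated by a unit tree has no children and would leave nothing visible; it
contributes a dot decorated by a unit of `P`, which is the white dot. The expansion is the
subdivided tree with white dots regarded as units, and the elements of each branch of `M` span a
connected part of it: these parts are the spheres.

That the two passages are inverse rests on two facts about labelled trees. Contracting the trees
that have been substituted gives back the original tree (`contract_lsub`), and a tree whose colour
classes are connected is recovered from its contraction by substituting these classes
(`isLsub_contract`). Since spheres are nested, a connected part of a connected part can be cut out
in one step (`kern_kern`), so both facts apply layer by layer. They give a composition tree for each
constellation (`exists_named`, `exists_pres`), a constellation for each `P⁺`-tree
(`exists_constel`), and an isomorphism between constellations with the same composition tree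
(`Pres.exists_iso`). As subdivided trees are rigid once named, the composition tree also determines
the layers as its nodes (`Named.unique`), which settles the marked case.

The source maps agree because layers are decorations. The target maps agree because white dots are
units: removing them does not change composites, so erasing them from the expansion leaves the
composite of `M` in `P⁺` (`unwhite_expand`).

The monad structure of `P⁺⁺` is then transported along these bijections (`EndoIso.monadStr`), and
the remaining point is that the transported multiplication is substitution of constellations into
layers. The layers of a substituted `P⁺`-tree are the layers of the trees substituted, with renamed
nodes (`lay_subst`). Hence the composition tree of a result of substitution is the substituted tree
(`IsSubst.tree_eq`), and conversely a constellation with that composition tree is a result of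
substitution (`exists_isSubst`). Uniqueness of the structure is direct: its description fixes the
unit, the multiplication and the bijections on inputs. -/

namespace PolyEndo.PreTree

/-! ### Connected parts of labelled trees -/

variable {I : Type u} {P : PolyEndo I} {Y Z : Type}

/-- If the root is a node with label in `A`, the labels in `A` form a connected part at the root;
otherwise no label is in `A`. -/
def AtRoot (A : Set Y) : PreTree (P.lab Y) → Prop
  | edge _ => True
  | node b ch => (b.2 ∈ A ∧ ∀ e, (ch e).AtRoot A) ∨ ¬ (node b ch).Meets A

/-- The nodes with label in `A` form a non-empty connected part. -/
def Conn (A : Set Y) : PreTree (P.lab Y) → Prop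
  | edge _ => False
  | node b ch => (b.2 ∈ A ∧ ∀ e, (ch e).AtRoot A) ∨
      (b.2 ∉ A ∧ ∃ e, (ch e).Conn A ∧ ∀ e', e' ≠ e → ¬ (ch e').Meets A)

/-- The root is not a node with label in `A`. -/
def RootNot (A : Set Y) : PreTree (P.lab Y) → Prop
  | edge _ => True
  | node b _ => b.2 ∉ A

/-- All labels are in `A`. -/
def Within (A : Set Y) : PreTree (P.lab Y) → Prop
  | edge _ => True
  | node b ch => b.2 ∈ A ∧ ∀ e, (ch e).Within A

/-- `S` is the part of `T` above some edge. -/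
def Sub (S : PreTree P) : PreTree P → Prop
  | edge i => S = edge i
  | node b ch => S = node b ch ∨ ∃ e, S.Sub (ch e)

theorem sub_refl (T : PreTree P) : T.Sub T := by
  cases T with
  | edge i => exact rfl
  | node b ch => exact .inl rfl

open Classical in
/-- Cut off the tree at the nodes with label outside `A`. -/
noncomputable def prune (A : Set Y) : PreTree (P.lab Y) → PreTree (P.lab Y)
  | edge i => edge i
  | node b ch => if b.2 ∈ A then node b fun e => (ch e).prune A else edge (P.tgt b.1)

/-- The connected part formed by the labels in `A`. -/
noncomputable def kern (A : Set Y) (T : PreTree (P.lab Y)) : PreTree (P.lab Y) :=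
  (T.subtreeAt A).prune A

section basic
variable {A B : Set Y} {b : (P.lab Y).Op} {ch : (P.lab Y).Ar b → PreTree (P.lab Y)}

theorem prune_of_mem (h : b.2 ∈ A) :
    (node b ch).prune A = node b fun e => (ch e).prune A := if_pos h

theorem prune_of_not_mem (h : b.2 ∉ A) : (node b ch).prune A = edge (P.tgt b.1) := if_neg h

theorem subtreeAt_of_mem (h : b.2 ∈ A) : (node b ch).subtreeAt A = node b ch := if_pos h

/-- `subtreeAt` chooses some child meeting `A`; when only one child meets `A` the choice is forced.
-/
theorem subtreeAt_of_child (h : b.2 ∉ A) (e : (P.lab Y).Ar b) (he : (ch e).Meets A)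
    (he' : ∀ e', e' ≠ e → ¬ (ch e').Meets A) :
    (node b ch).subtreeAt A = (ch e).subtreeAt A := by
  have hex : ∃ e, (ch e).Meets A := ⟨e, he⟩
  have : hex.choose = e := by
    by_contra hne
    exact he' _ hne hex.choose_spec
  refine (if_neg h).trans ((dif_pos hex).trans ?_)
  rw [this]

theorem kern_of_mem (h : b.2 ∈ A) :
    (node b ch).kern A = node b fun e => (ch e).prune A := by
  rw [kern, subtreeAt_of_mem h, prune_of_mem h]

theorem kern_of_child (h : b.2 ∉ A) (e : (P.lab Y).Ar b) (he : (ch e).Meets A)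
    (he' : ∀ e', e' ≠ e → ¬ (ch e').Meets A) : (node b ch).kern A = (ch e).kern A := by
  rw [kern, subtreeAt_of_child h e he he', kern]

theorem root_prune (A : Set Y) (T : PreTree (P.lab Y)) : (T.prune A).root = T.root := by
  cases T with
  | edge i => rfl
  | node b ch =>
    by_cases h : b.2 ∈ A
    · rw [prune_of_mem h]; rfl
    · rw [prune_of_not_mem h]; rfl

theorem valid_prune (A : Set Y) (T : PreTree (P.lab Y)) (hT : T.Valid) : (T.prune A).Valid := by
  induction T with
  | edge i => trivial
  | node b ch ih =>
    by_cases h : b.2 ∈ A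
    · rw [prune_of_mem h]
      exact fun e => ⟨(root_prune A _).trans (hT e).1, ih e (hT e).2⟩
    · rw [prune_of_not_mem h]; trivial

theorem valid_kern (A : Set Y) (T : PreTree (P.lab Y)) (hT : T.Valid) : (T.kern A).Valid :=
  valid_prune A _ (valid_subtreeAt A T hT)

theorem Meets.mono (h : B ⊆ A) {T : PreTree (P.lab Y)} (hT : T.Meets B) : T.Meets A := by
  induction T with
  | edge i => exact hT
  | node b ch ih => exact hT.imp (fun hb => h hb) fun ⟨e, he⟩ => ⟨e, ih e he⟩

theorem Within.mono (h : B ⊆ A) {T : PreTree (P.lab Y)} (hT : T.Within B) : T.Within A := by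
  induction T with
  | edge i => trivial
  | node b ch ih => exact ⟨h hT.1, fun e => ih e (hT.2 e)⟩

theorem Within.not_meets {T : PreTree (P.lab Y)} (hT : T.Within A) (h : Disjoint A B) :
    ¬ T.Meets B := by
  induction T with
  | edge i => exact id
  | node b ch ih =>
    rintro (hb | ⟨e, he⟩)
    · exact Set.disjoint_left.1 h hT.1 hb
    · exact ih e (hT.2 e) he

theorem Conn.meets {T : PreTree (P.lab Y)} (hT : T.Conn A) : T.Meets A := by
  induction T with
  | edge i => exact hT
  | node b ch ih =>
    rcases hT with ⟨hb, _⟩ | ⟨_, e, he, _⟩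
    · exact .inl hb
    · exact .inr ⟨e, ih e he⟩

theorem atRoot_of_not_meets {T : PreTree (P.lab Y)} (h : ¬ T.Meets A) : T.AtRoot A := by
  cases T with
  | edge i => trivial
  | node b ch => exact .inr h

theorem within_prune (A : Set Y) (T : PreTree (P.lab Y)) : (T.prune A).Within A := by
  induction T with
  | edge i => trivial
  | node b ch ih =>
    by_cases h : b.2 ∈ A
    · rw [prune_of_mem h]; exact ⟨h, ih⟩
    · rw [prune_of_not_mem h]; trivial

theorem within_kern (A : Set Y) (T : PreTree (P.lab Y)) : (T.kern A).Within A :=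
  within_prune A _

theorem Within.atRoot {T : PreTree (P.lab Y)} (h : T.Within A) : T.AtRoot A := by
  induction T with
  | edge i => trivial
  | node b ch ih => exact .inl ⟨h.1, fun e => ih e (h.2 e)⟩

theorem Within.prune_eq {T : PreTree (P.lab Y)} (h : T.Within A) : T.prune A = T := by
  induction T with
  | edge i => rfl
  | node b ch ih => rw [prune_of_mem h.1, funext fun e => ih e (h.2 e)]

theorem Within.conn_node (h : (node b ch).Within A) : (node b ch).Conn A :=
  .inl ⟨h.1, fun e => (h.2 e).atRoot⟩

theorem Within.kern_node (h : (node b ch).Within A) : (node b ch).kern A = node b ch := by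
  rw [kern, subtreeAt_of_mem h.1, h.prune_eq]

theorem prune_prune (h : B ⊆ A) (T : PreTree (P.lab Y)) :
    (T.prune A).prune B = T.prune B := by
  induction T with
  | edge i => rfl
  | node b ch ih =>
    by_cases hb : b.2 ∈ A
    · rw [prune_of_mem hb]
      by_cases hb' : b.2 ∈ B
      · rw [prune_of_mem hb', prune_of_mem hb', funext ih]
      · rw [prune_of_not_mem hb', prune_of_not_mem hb']
    · rw [prune_of_not_mem hb, prune_of_not_mem fun h' => hb (h h')]
      rfl

/-- Under `AtRoot A` no label in `A` lies above a node with label outside `A`, so what `prune A`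
cuts off carries no label of `A`, hence none of `B`. -/
theorem meets_prune (h : B ⊆ A) {T : PreTree (P.lab Y)} (hT : T.AtRoot A) :
    (T.prune A).Meets B ↔ T.Meets B := by
  induction T with
  | edge i => exact Iff.rfl
  | node b ch ih =>
    rcases hT with ⟨hb, hc⟩ | hn
    · rw [prune_of_mem hb]
      exact or_congr Iff.rfl (exists_congr fun e => ih e (hc e))
    · rw [prune_of_not_mem fun hb => hn (.inl hb)]
      exact iff_of_false id fun hm => hn (hm.mono h)

theorem atRoot_prune (h : B ⊆ A) {T : PreTree (P.lab Y)} (hT : T.AtRoot A) :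
    (T.prune A).AtRoot B ↔ T.AtRoot B := by
  induction T with
  | edge i => exact Iff.rfl
  | node b ch ih =>
    have hm := meets_prune h hT
    rcases hT with ⟨hb, hc⟩ | hn
    · rw [prune_of_mem hb] at hm ⊢
      exact or_congr (and_congr Iff.rfl (forall_congr' fun e => ih e (hc e))) (not_congr hm)
    · rw [prune_of_not_mem fun hb => hn (.inl hb)]
      exact iff_of_true trivial (atRoot_of_not_meets fun hm => hn (hm.mono h))

theorem conn_prune (h : B ⊆ A) {T : PreTree (P.lab Y)} (hT : T.AtRoot A) :
    (T.prune A).Conn B ↔ T.Conn B := by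
  induction T with
  | edge i => exact Iff.rfl
  | node b ch ih =>
    rcases hT with ⟨hb, hc⟩ | hn
    · rw [prune_of_mem hb]
      exact or_congr (and_congr Iff.rfl (forall_congr' fun e => atRoot_prune h (hc e)))
        (and_congr Iff.rfl (exists_congr fun e => and_congr (ih e (hc e))
          (forall_congr' fun e' => imp_congr Iff.rfl (not_congr (meets_prune h (hc e'))))))
    · rw [prune_of_not_mem fun hb => hn (.inl hb)]
      exact iff_of_false id fun hm => hn (hm.meets.mono h)

theorem kern_prune (h : B ⊆ A) {T : PreTree (P.lab Y)} (hT : T.AtRoot A) (hB : T.Conn B) :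
    (T.prune A).kern B = T.kern B := by
  induction T with
  | edge i => rfl
  | node b ch ih =>
    have hb : b.2 ∈ A := by
      by_contra hb
      rcases hT with hT | hn
      · exact hb hT.1
      · exact hn (hB.meets.mono h)
    have hc : ∀ e, (ch e).AtRoot A := by
      rcases hT with hT | hn
      · exact hT.2
      · exact absurd (.inl hb) hn
    rw [prune_of_mem hb]
    rcases hB with ⟨hb', _⟩ | ⟨hb', e, he, he'⟩
    · rw [kern_of_mem hb', kern_of_mem hb', funext fun e => prune_prune h _]
    · rw [kern_of_child hb' e he.meets he', ← ih e (hc e) he]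
      exact kern_of_child hb' e ((meets_prune h (hc e)).2 he.meets)
        fun e' h' hm => he' e' h' ((meets_prune h (hc e')).1 hm)

theorem Conn.atRoot_subtreeAt {T : PreTree (P.lab Y)} (hA : T.Conn A) :
    (T.subtreeAt A).AtRoot A := by
  induction T with
  | edge i => trivial
  | node b ch ih =>
    rcases hA with hA | ⟨hb, e, he, he'⟩
    · rw [subtreeAt_of_mem hA.1]; exact .inl hA
    · rw [subtreeAt_of_child hb e he.meets he']; exact ih e he

theorem conn_subtreeAt (h : B ⊆ A) {T : PreTree (P.lab Y)} (hA : T.Conn A) :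
    (T.subtreeAt A).Conn B ↔ T.Conn B := by
  induction T with
  | edge i => exact Iff.rfl
  | node b ch ih =>
    rcases hA with hA | ⟨hb, e, he, he'⟩
    · rw [subtreeAt_of_mem hA.1]
    · rw [subtreeAt_of_child hb e he.meets he', ih e he]
      refine ⟨fun hB => .inr ⟨fun h' => hb (h h'), e, hB, fun e' h' hm => he' e' h' (hm.mono h)⟩, ?_⟩
      rintro (hB | ⟨_, e', hB, _⟩)
      · exact absurd (h hB.1) hb
      · by_cases hee : e' = e
        · rwa [← hee]
        · exact absurd (hB.meets.mono h) (he' e' hee)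

theorem kern_subtreeAt (h : B ⊆ A) {T : PreTree (P.lab Y)} (hA : T.Conn A) (hB : T.Conn B) :
    (T.subtreeAt A).kern B = T.kern B := by
  induction T with
  | edge i => rfl
  | node b ch ih =>
    rcases hA with hA | ⟨hb, e, he, he'⟩
    · rw [subtreeAt_of_mem hA.1]
    · rw [subtreeAt_of_child hb e he.meets he']
      rcases hB with hB | ⟨hb', e', hB, hB'⟩
      · exact absurd (h hB.1) hb
      · have hee : e' = e := by
          by_contra hee
          exact absurd (hB.meets.mono h) (he' e' hee)
        subst hee
        rw [kern_of_child hb' e' hB.meets hB']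
        exact ih e' he hB

theorem conn_kern (h : B ⊆ A) {T : PreTree (P.lab Y)} (hA : T.Conn A) :
    (T.kern A).Conn B ↔ T.Conn B :=
  (conn_prune h hA.atRoot_subtreeAt).trans (conn_subtreeAt h hA)

/-- A connected part contained in a larger connected part is the same tree whether it is cut out of
the whole or out of the larger part. For nested spheres this allows each layer to be studied inside
its own sphere. -/
theorem kern_kern (h : B ⊆ A) {T : PreTree (P.lab Y)} (hA : T.Conn A) (hB : T.Conn B) :
    (T.kern A).kern B = T.kern B :=
  (kern_prune h hA.atRoot_subtreeAt ((conn_subtreeAt h hA).2 hB)).trans (kern_subtreeAt h hA hB)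

end basic

section graft
variable {A : Set Y}

theorem meets_graft (K : PreTree (P.lab Y)) (g : K.Leaf → PreTree (P.lab Y)) :
    (K.graft g).Meets A ↔ K.Meets A ∨ ∃ l, (g l).Meets A := by
  induction K with
  | edge i => exact ⟨fun h => .inr ⟨PUnit.unit, h⟩, fun h => h.elim False.elim fun ⟨_, h⟩ => h⟩
  | node b ch ih =>
    refine (or_congr Iff.rfl (exists_congr fun e => ih e _)).trans ?_
    constructor
    · rintro (h | ⟨e, h | ⟨l, h⟩⟩)
      · exact .inl (.inl h)
      · exact .inl (.inr ⟨e, h⟩)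
      · exact .inr ⟨⟨e, l⟩, h⟩
    · rintro ((h | ⟨e, h⟩) | ⟨⟨e, l⟩, h⟩)
      · exact .inl h
      · exact .inr ⟨e, .inl h⟩
      · exact .inr ⟨e, .inr ⟨l, h⟩⟩

theorem within_graft {K : PreTree (P.lab Y)} {g : K.Leaf → PreTree (P.lab Y)}
    (hK : K.Within A) (hg : ∀ l, (g l).Within A) : (K.graft g).Within A := by
  induction K with
  | edge i => exact hg _
  | node b ch ih => exact ⟨hK.1, fun e => ih e (hK.2 e) fun l => hg ⟨e, l⟩⟩

theorem atRoot_graft {K : PreTree (P.lab Y)} {g : K.Leaf → PreTree (P.lab Y)}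
    (hK : K.AtRoot A) (hg : ∀ l, ¬ (g l).Meets A) : (K.graft g).AtRoot A := by
  induction K with
  | edge i => exact atRoot_of_not_meets (hg _)
  | node b ch ih =>
    rcases hK with hK | hK
    · exact .inl ⟨hK.1, fun e => ih e (hK.2 e) fun l => hg ⟨e, l⟩⟩
    · refine .inr fun h => ?_
      rcases (meets_graft (node b ch) g).1 h with h | ⟨l, h⟩
      · exact hK h
      · exact hg l h

/-- A grafted tree without labels in `A` is pruned down to its root edge, which has the type of the
leaf it was grafted on. -/
theorem prune_graft {K : PreTree (P.lab Y)} {g : K.Leaf → PreTree (P.lab Y)}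
    (hr : ∀ l, (g l).root = K.leafType l) (hg : ∀ l, ¬ (g l).Meets A) :
    (K.graft g).prune A = K.prune A := by
  induction K with
  | edge i =>
    have h1 := hr PUnit.unit
    have h2 := hg PUnit.unit
    change (g PUnit.unit).prune A = edge i
    revert h1 h2
    cases g PUnit.unit with
    | edge j => exact fun h1 _ => congrArg edge h1
    | node b ch =>
      intro h1 h2
      exact (prune_of_not_mem (fun h => h2 (.inl h))).trans (congrArg edge h1)
  | node b ch ih =>
    have H := fun e => ih e (g := fun l => g ⟨e, l⟩) (fun l => hr ⟨e, l⟩) fun l => hg ⟨e, l⟩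
    by_cases hb : b.2 ∈ A
    · refine (prune_of_mem hb).trans ((congrArg (node b) (funext H)).trans (prune_of_mem hb).symm)
    · exact (prune_of_not_mem hb).trans (prune_of_not_mem hb).symm

theorem conn_graft_left {K : PreTree (P.lab Y)} {g : K.Leaf → PreTree (P.lab Y)}
    (hr : ∀ l, (g l).root = K.leafType l) (hg : ∀ l, ¬ (g l).Meets A) (hK : K.Conn A) :
    (K.graft g).Conn A ∧ (K.graft g).kern A = K.kern A := by
  induction K with
  | edge i => exact hK.elim
  | node b ch ih =>
    rcases hK with ⟨hb, hc⟩ | ⟨hb, e, he, he'⟩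
    · refine ⟨.inl ⟨hb, fun e => atRoot_graft (hc e) fun l => hg ⟨e, l⟩⟩, ?_⟩
      refine (kern_of_mem hb).trans (Eq.trans ?_ (kern_of_mem hb).symm)
      exact congrArg (node b) (funext fun e => prune_graft (fun l => hr ⟨e, l⟩) fun l => hg ⟨e, l⟩)
    · obtain ⟨h1, h2⟩ := ih e (g := fun l => g ⟨e, l⟩) (fun l => hr ⟨e, l⟩) (fun l => hg ⟨e, l⟩) he
      have h3 : ∀ e', e' ≠ e → ¬ ((ch e').graft fun l => g ⟨e', l⟩).Meets A := fun e' h h' =>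
        ((meets_graft _ _).1 h').elim (he' e' h) fun ⟨l, hl⟩ => hg ⟨e', l⟩ hl
      exact ⟨.inr ⟨hb, e, h1, h3⟩, (kern_of_child hb e h1.meets h3).trans
        (h2.trans (kern_of_child hb e he.meets he').symm)⟩

theorem conn_graft_right {K : PreTree (P.lab Y)} {g : K.Leaf → PreTree (P.lab Y)}
    (hK : ¬ K.Meets A) (l : K.Leaf) (hl : (g l).Conn A) (hl' : ∀ l', l' ≠ l → ¬ (g l').Meets A) :
    (K.graft g).Conn A ∧ (K.graft g).kern A = (g l).kern A := by
  induction K with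
  | edge i => exact ⟨hl, rfl⟩
  | node b ch ih =>
    obtain ⟨e, l⟩ := l
    have h0 : ∀ e, ¬ (ch e).Meets A := fun e he => hK (.inr ⟨e, he⟩)
    obtain ⟨h1, h2⟩ := ih e (g := fun l => g ⟨e, l⟩) (h0 e) l hl
      fun l' h => hl' ⟨e, l'⟩ fun h' => h (eq_of_heq (Sigma.mk.inj h').2)
    have h3 : ∀ e', e' ≠ e → ¬ ((ch e').graft fun l => g ⟨e', l⟩).Meets A := fun e' h h' =>
      ((meets_graft _ _).1 h').elim (h0 e') fun ⟨l', h''⟩ =>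
        hl' ⟨e', l'⟩ (fun h' => h (Sigma.mk.inj h').1) h''
    exact ⟨.inr ⟨fun hb => hK (.inl hb), e, h1, h3⟩,
      (kern_of_child (fun hb => hK (.inl hb)) e h1.meets h3).trans h2⟩

/-- Different grafted trees are joined only through `K`, which has no label in `A`; so a connected
part lies in a single one of them. -/
theorem conn_of_conn_graft {K : PreTree (P.lab Y)} {g : K.Leaf → PreTree (P.lab Y)}
    (hK : ¬ K.Meets A) (hc : (K.graft g).Conn A) (l : K.Leaf) (hl : (g l).Meets A) :
    (g l).Conn A ∧ (g l).kern A = (K.graft g).kern A := by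
  induction K with
  | edge i => exact ⟨hc, rfl⟩
  | node b ch ih =>
    obtain ⟨e, l⟩ := l
    rcases hc with hc | ⟨hb, e', he, he'⟩
    · exact absurd (.inl hc.1) hK
    · have hee : e = e' := by
        by_contra h
        exact he' e h ((meets_graft _ _).2 (.inr ⟨l, hl⟩))
      subst hee
      obtain ⟨h1, h2⟩ := ih e (g := fun l => g ⟨e, l⟩) (fun h => hK (.inr ⟨e, h⟩)) he l hl
      exact ⟨h1, h2.trans (kern_of_child hb e he.meets he').symm⟩

/-- Pruning cuts at the first nodes outside `A`, so the pieces cut off sit on the leaves of the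
pruned tree. This separates the part of one colour at the root from the rest, on which a recursion
can continue. -/
theorem exists_graft_prune (A : Set Y) (T : PreTree (P.lab Y)) (hT : T.Valid) :
    ∃ g : (T.prune A).Leaf → PreTree (P.lab Y), T = (T.prune A).graft g ∧
      (∀ l, (g l).root = (T.prune A).leafType l) ∧ (∀ l, (g l).Valid) ∧
      (∀ l, (g l).RootNot A) ∧ (T.AtRoot A → ∀ l, ¬ (g l).Meets A) ∧ ∀ l, (g l).Sub T := by
  induction T with
  | edge i => exact ⟨fun _ => edge i, rfl, fun _ => rfl, fun _ => hT, fun _ => trivial,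
      fun _ _ => id, fun _ => rfl⟩
  | node b ch ih =>
    by_cases hb : b.2 ∈ A
    · rw [prune_of_mem hb]
      choose g h1 h2 h3 h4 h5 h6 using fun e => ih e (hT e).2
      refine ⟨fun l => g l.1 l.2, congrArg (node b) (funext h1), fun l => h2 l.1 l.2,
        fun l => h3 l.1 l.2, fun l => h4 l.1 l.2, ?_, fun l => .inr ⟨l.1, h6 l.1 l.2⟩⟩
      rintro (h | h) l
      · exact h5 l.1 (h.2 l.1) l.2
      · exact absurd (.inl hb) h
    · rw [prune_of_not_mem hb]
      refine ⟨fun _ => node b ch, rfl, fun _ => rfl, fun _ => hT, fun _ => hb, ?_,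
        fun _ => .inl rfl⟩
      rintro (h | h) l
      · exact absurd h.1 hb
      · exact h

/-- The pieces cut off in `exists_graft_prune` begin at arbitrary height, so induction over the
immediate branches alone would not reach them. -/
theorem sub_induction {p : PreTree P → Prop} (h0 : ∀ i, p (edge i))
    (h1 : ∀ b ch, (∀ e S, S.Sub (ch e) → p S) → p (node b ch)) (T : PreTree P) : p T := by
  suffices h : ∀ S : PreTree P, S.Sub T → p S from h T (sub_refl T)
  induction T with
  | edge i => rintro _ rfl; exact h0 i
  | node b ch ih =>
    rintro S (rfl | ⟨e, he⟩)
    · exact h1 b ch ih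
    · exact ih e S he

end graft

end PolyEndo.PreTree

/-! ### Labellings and forgetting them -/

namespace PolyEndo.PreTree

variable {I : Type u} {P : PolyEndo I} {Y Z : Type}

/-- Forgetting the labels does not change the leaves. -/
def leafForget : (T : PreTree (P.lab Y)) → T.Leaf ≃ T.forget.Leaf
  | edge _ => Equiv.refl _
  | node b ch => Equiv.sigmaCongrRight (β₂ := fun e : P.Ar b.1 => (ch e).forget.Leaf)
      fun e => (ch e).leafForget

theorem leafType_leafForget (T : PreTree (P.lab Y)) (l : T.Leaf) :
    T.forget.leafType (T.leafForget l) = T.leafType l := by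
  induction T with
  | edge i => rfl
  | node b ch ih => exact ih l.1 l.2

/-- Label the nodes of a tree. -/
def mkLab : (T : PreTree P) → (T.Node → Y) → PreTree (P.lab Y)
  | edge i, _ => edge i
  | node b ch, a => node (P := P.lab Y) (b, a none) fun e => (ch e).mkLab fun n => a (some ⟨e, n⟩)

theorem forget_mkLab (T : PreTree P) (a : T.Node → Y) : (T.mkLab a).forget = T := by
  induction T with
  | edge i => rfl
  | node b ch ih => exact congrArg (node b) (funext fun e => ih e _)

theorem mkLab_nodeLab (T : PreTree (P.lab Y)) : T.forget.mkLab T.nodeLab = T := by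
  induction T with
  | edge i => rfl
  | node b ch ih => exact congrArg (node (P := P.lab Y) b) (funext ih)

theorem mapLab_mkLab (f : Y → Z) (T : PreTree P) (a : T.Node → Y) :
    (T.mkLab a).mapLab f = T.mkLab (f ∘ a) := by
  induction T with
  | edge i => rfl
  | node b ch ih => exact congrArg (node (P := P.lab Z) (b, f (a none))) (funext fun e => ih e _)

/-- The labellings live on different trees until these are known to agree, hence the comparison of
pairs. -/
theorem mkLab_sigma_eq {T T' : PreTree P} {a : T.Node → Y} {a' : T'.Node → Y}
    (h : T.mkLab a = T'.mkLab a') : (⟨T, a⟩ : Σ T : PreTree P, (T.Node → Y)) = ⟨T', a'⟩ := by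
  induction T generalizing T' with
  | edge i =>
    cases T' with
    | edge j =>
      obtain rfl := PreTree.edge.inj h
      exact Sigma.ext rfl (heq_of_eq (funext fun x => x.elim))
    | node b' ch' => cases h
  | node b ch ih =>
    cases T' with
    | edge j => cases h
    | node b' ch' =>
      obtain ⟨h1, h2⟩ := PreTree.node.inj h
      obtain ⟨rfl, h3⟩ := Prod.mk.inj h1
      have h4 := fun e => ih e (congrFun (eq_of_heq h2) e)
      obtain rfl : ch = ch' := funext fun e => (Sigma.mk.inj (h4 e)).1
      refine Sigma.ext rfl (heq_of_eq (funext fun x => ?_))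
      match x with
      | none => exact h3
      | some ⟨e, n⟩ => exact congrFun (eq_of_heq (Sigma.mk.inj (h4 e)).2) n

theorem mkLab_injective {T : PreTree P} {a a' : T.Node → Y} (h : T.mkLab a = T.mkLab a') :
    a = a' := eq_of_heq (Sigma.mk.inj (mkLab_sigma_eq h)).2

end PolyEndo.PreTree

/-! ### Contraction and substitution of labelled trees are inverse -/

namespace PolyMonad

open PolyEndo PreTree

variable {I : Type u} (P : PolyMonad I) {Y Z : Type}

/-- The leaves of a labelled tree are the inputs of its total operation. -/
def lleaf (T : (P.toPolyEndo.lab Y).PreTree) (v : T.Valid) :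
    T.Leaf ≃ P.Ar (P.tot T.forget (valid_forget T v)).1 :=
  T.leafForget.trans (P.leafAr _ _)

theorem src_lleaf (T : (P.toPolyEndo.lab Y).PreTree) (v : T.Valid) (l : T.Leaf) :
    P.src _ (P.lleaf T v l) = T.leafType l :=
  (P.src_leafAr _ _ _).trans (leafType_leafForget _ _)

/-- The composite of a tree, with trees hung on its leaves. -/
def graftPart (K : (P.toPolyEndo.lab Y).PreTree) (vK : K.Valid)
    (U : ∀ l, P.TreeOver Z (K.leafType l)) (i : I) (h : K.root = i) : P.Part Z i where
  op := (P.tot K.forget (valid_forget K vK)).1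
  tgt_op := (P.tot K.forget _).2.trans ((root_forget K).trans h)
  ch e := ⟨(U ((P.lleaf K vK).symm e)).1, (U ((P.lleaf K vK).symm e)).2.1.trans
    ((P.src_lleaf K vK _).symm.trans (congrArg _ ((P.lleaf K vK).apply_symm_apply e))),
    (U ((P.lleaf K vK).symm e)).2.2⟩

/-- The part of colour `z` at the root is empty here, so its composite is a unit, with the whole
contracted tree hung on its input. -/
theorem contractAux_of_rootNot (c : Y → Option Z) (z : Z) (T : (P.toPolyEndo.lab Y).PreTree)
    (v : T.Valid) (h : T.RootNot {y | c y = some z}) (i : I) (hi : T.root = i) :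
    (P.contractAux c T v i hi).1 z = Part.hang (P.contractAux c T v i hi).2 := by
  subst hi
  cases T with
  | edge i => rfl
  | node b ch => exact if_neg h

/-- `tot` and `leafAr` are built from `P.mul` and `P.pos` in the same way as `Part.comp`, so
composing the root part of colour `z` gives the total operation of `K` definitionally once the
branches are known. -/
theorem contractAux_graft (c : Y → Option Z) (z : Z) (K : (P.toPolyEndo.lab Y).PreTree)
    (vK : K.Valid) (g : K.Leaf → (P.toPolyEndo.lab Y).PreTree) (vg : ∀ l, (g l).Valid)
    (hr : ∀ l, (g l).root = K.leafType l) (hK : K.Within {y | c y = some z})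
    (hg : ∀ l, (g l).RootNot {y | c y = some z}) (v : (K.graft g).Valid) (i : I)
    (h : (K.graft g).root = i) (hi : K.root = i) :
    (P.contractAux c (K.graft g) v i h).1 z =
      P.graftPart K vK (fun l => (P.contractAux c (g l) (vg l) _ (hr l)).2) i hi := by
  induction K generalizing i with
  | edge j =>
    subst hi
    exact P.contractAux_of_rootNot c z (g PUnit.unit) (vg _) (hg _) _ _
  | node b ch ih =>
    subst hi
    have H := fun e => ih e (vK e).2 (fun l => g ⟨e, l⟩) (fun l => vg ⟨e, l⟩)
      (fun l => hr ⟨e, l⟩) (hK.2 e) (fun l => hg ⟨e, l⟩) (v e).2 (P.src b.1 e) (v e).1 (vK e).1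
    refine (if_pos hK.1).trans ?_
    exact congrArg (Part.comp b.1) (funext H)

theorem contract_eq (c : Y → Option Z) (T : (P.toPolyEndo.lab Y).PreTree) (v : T.Valid) (i : I)
    (h : T.root = i) : (P.contractAux c T v i h).2.1 = P.contract c T v := by
  subst h
  rfl

/-- If the part of colour `z` at the root is not empty, it is contracted to a node. -/
theorem contract_graft (c : Y → Option Z) (z : Z) (K : (P.toPolyEndo.lab Y).PreTree)
    (vK : K.Valid) (g : K.Leaf → (P.toPolyEndo.lab Y).PreTree) (vg : ∀ l, (g l).Valid)
    (hr : ∀ l, (g l).root = K.leafType l) (hK : K.Within {y | c y = some z})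
    (hg : ∀ l, (g l).RootNot {y | c y = some z}) (v : (K.graft g).Valid)
    (hn : ¬ K.RootNot {y | c y = some z}) :
    P.contract c (K.graft g) v = node (P := P.toPolyEndo.lab Z)
      ((P.tot K.forget (valid_forget K vK)).1, z)
      fun e => P.contract c (g ((P.lleaf K vK).symm e)) (vg _) := by
  cases K with
  | edge i => exact absurd trivial hn
  | node b ch =>
    have H := fun e => P.contractAux_graft c z (ch e) (vK e).2 (fun l => g ⟨e, l⟩)
      (fun l => vg ⟨e, l⟩) (fun l => hr ⟨e, l⟩) (hK.2 e) (fun l => hg ⟨e, l⟩) (v e).2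
      (P.src b.1 e) (v e).1 (vK e).1
    have hb : c b.2 = some z := hK.1
    have h1 : P.contract c ((node b ch).graft g) v = (Part.pick (c b.2) fun z =>
      Part.comp b.1 fun e => (P.contractAux c ((ch e).graft fun l => g ⟨e, l⟩) (v e).2
        (P.src b.1 e) (v e).1).1 z).1 := rfl
    rw [h1, hb]
    refine (congrArg (fun X => (Part.toTree (Part.comp b.1 X) z).1) (funext H)).trans ?_
    refine congrArg (node (P := P.toPolyEndo.lab Z)
      ((P.tot (node b ch).forget (valid_forget _ vK)).1, z)) (funext fun e => ?_)
    exact P.contract_eq c (g ((P.lleaf (node b ch) vK).symm e)) (vg _) _ (hr _)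

theorem contract_congr (c : Y → Option Z) {T T' : (P.toPolyEndo.lab Y).PreTree} (h : T = T')
    (v : T.Valid) (v' : T'.Valid) : P.contract c T v = P.contract c T' v' := by
  subst h
  rfl

/-- Labels outside `A` have no colour, and the contraction already cuts the tree at nodes without a
colour. -/
theorem contractAux_prune (c : Y → Option Z) (A : Set Y) (hA : ∀ y z, c y = some z → y ∈ A)
    (T : (P.toPolyEndo.lab Y).PreTree) (v : T.Valid) (v' : (T.prune A).Valid) (i : I)
    (h : T.root = i) (h' : (T.prune A).root = i) :
    P.contractAux c (T.prune A) v' i h' = P.contractAux c T v i h := by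
  induction T generalizing i with
  | edge j => rfl
  | node b ch ih =>
    by_cases hb : b.2 ∈ A
    -- The recursion depends on a validity proof for its tree, so the equation for `prune` is
    -- substituted for a variable tree instead of being rewritten. The same device serves in later
    -- steps called `key`.
    · have key : ∀ (T' : (P.toPolyEndo.lab Y).PreTree) (v' : T'.Valid) (h' : T'.root = i),
          T' = node b (fun e => (ch e).prune A) →
          P.contractAux c T' v' i h' = P.contractAux c (node b ch) v i h := by
        rintro _ v' h' rfl
        subst h
        have H := fun e => ih e (v e).2 (v' e).2 (P.src b.1 e) (v e).1 (v' e).1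
        have : (fun z => Part.comp b.1 fun e => (P.contractAux c ((ch e).prune A) (v' e).2
            (P.src b.1 e) (v' e).1).1 z) = fun z => Part.comp b.1 fun e =>
              (P.contractAux c (ch e) (v e).2 (P.src b.1 e) (v e).1).1 z :=
          funext fun z => congrArg (Part.comp b.1) (funext fun e => by rw [H e])
        exact congrArg (fun X => (Part.select (c b.2) X, Part.pick (c b.2) X)) this
      exact key _ v' h' (prune_of_mem hb)
    · have hc : c b.2 = none := Option.eq_none_iff_forall_ne_some.2 fun z hz => hb (hA _ z hz)
      have key : ∀ (T' : (P.toPolyEndo.lab Y).PreTree) (v' : T'.Valid) (h' : T'.root = i),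
          T' = edge (P.tgt b.1) →
          P.contractAux c T' v' i h' = P.contractAux c (node b ch) v i h := by
        rintro _ v' h' rfl
        subst h
        have : ∀ (o : Option Z) (_ : o = none) (X : Z → P.Part Z (P.tgt b.1)),
            (Part.select o X, Part.pick o X) =
              (fun _ => Part.hang ⟨edge (P.tgt b.1), rfl, trivial⟩,
                ⟨edge (P.tgt b.1), rfl, trivial⟩) := by
          rintro _ rfl X
          rfl
        exact (this _ hc _).symm
      exact key _ v' h' (prune_of_not_mem hb)

theorem contract_prune (c : Y → Option Z) (A : Set Y) (hA : ∀ y z, c y = some z → y ∈ A)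
    (T : (P.toPolyEndo.lab Y).PreTree) (v : T.Valid) (v' : (T.prune A).Valid) :
    P.contract c (T.prune A) v' = P.contract c T v :=
  (P.contract_eq c _ v' _ (root_prune A T)).symm.trans
    (congrArg (fun X => X.2.1) (P.contractAux_prune c A hA T v v' _ rfl (root_prune A T)))

/-- Labelled trees with compatible decorations. -/
abbrev VTree (Y : Type) : Type u := {W : (P.toPolyEndo.lab Y).PreTree // W.Valid}

variable {P}

/-- The total operation. -/
def VTree.op (W : P.VTree Y) : P.Op := (P.tot W.1.forget (valid_forget W.1 W.2)).1

/-- If `W` has total operation `b`, its leaves are the inputs of `b`. -/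
def VTree.leafTo (W : P.VTree Y) {b : P.Op} (h : W.op = b) : W.1.Leaf ≃ P.Ar b :=
  (P.lleaf W.1 W.2).trans (Equiv.cast (congrArg P.Ar h))

/-- Forget the labels. -/
def VTree.tree (W : P.VTree Y) : P.toPolyEndo.Tree := ⟨W.1.forget, valid_forget W.1 W.2⟩

theorem VTree.leafTo_eq (W : P.VTree Y) {b : P.Op} (h : W.op = b) (l : W.1.Leaf) :
    P.leafTo W.tree h (W.1.leafForget l) = W.leafTo h l := rfl

theorem VTree.src_leafTo (W : P.VTree Y) {b : P.Op} (h : W.op = b) (l : W.1.Leaf) :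
    P.src b (W.leafTo h l) = W.1.leafType l :=
  (P.src_leafTo W.tree h _).trans (leafType_leafForget _ _)

theorem VTree.contract_graft (c : Y → Option Z) (z : Z) (K : P.VTree Y) {b : P.Op} (h : K.op = b)
    (g : K.1.Leaf → (P.toPolyEndo.lab Y).PreTree) (vg : ∀ l, (g l).Valid)
    (hr : ∀ l, (g l).root = K.1.leafType l) (hK : K.1.Within {y | c y = some z})
    (hg : ∀ l, (g l).RootNot {y | c y = some z}) (v : (K.1.graft g).Valid)
    (hn : ¬ K.1.RootNot {y | c y = some z}) :
    P.contract c (K.1.graft g) v = node (P := P.toPolyEndo.lab Z) (b, z)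
      fun e => P.contract c (g ((K.leafTo h).symm e)) (vg _) := by
  subst h
  exact P.contract_graft c z K.1 K.2 g vg hr hK hg v hn

/-- Substitute a labelled tree into each node. -/
def lsub : (T : P.PTree) → (F : T.Node → P.VTree Y) → (∀ n, (F n).op = T.dec n) →
    (P.toPolyEndo.lab Y).PreTree
  | edge i, _, _ => edge i
  | node _ ch, F, h => (F none).1.graft fun l =>
      lsub (ch ((F none).leafTo (h none) l)) (fun n => F (some ⟨_, n⟩)) fun n => h (some ⟨_, n⟩)

theorem valid_lsub (T : P.PTree) (F : T.Node → P.VTree Y) (h : ∀ n, (F n).op = T.dec n)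
    (v : T.Valid) : (lsub T F h).Valid ∧ (lsub T F h).root = T.root := by
  induction T with
  | edge i => exact ⟨trivial, rfl⟩
  | node b ch ih =>
    have H := fun l => ih ((F none).leafTo (h none) l) (fun n => F (some ⟨_, n⟩))
      (fun n => h (some ⟨_, n⟩)) (v _).2
    have H2 := fun l => (H l).2.trans ((v _).1.trans ((F none).src_leafTo (h none) l))
    refine ⟨valid_graft _ _ (F none).2 H2 fun l => (H l).1, (root_graft _ _ H2).trans ?_⟩
    exact (root_forget _).symm.trans ((P.tot _ _).2.symm.trans (congrArg P.tgt (h none)))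

theorem lsub_within (A : Set Y) (T : P.PTree) (F : T.Node → P.VTree Y)
    (h : ∀ n, (F n).op = T.dec n) (hF : ∀ n, (F n).1.Within A) : (lsub T F h).Within A := by
  induction T with
  | edge i => trivial
  | node b ch ih => exact within_graft (hF none) fun l => ih _ _ _ fun n => hF (some ⟨_, n⟩)

theorem lsub_not_meets (A : Set Y) (T : P.PTree) (F : T.Node → P.VTree Y)
    (h : ∀ n, (F n).op = T.dec n) (hF : ∀ n, ¬ (F n).1.Meets A) : ¬ (lsub T F h).Meets A := by
  induction T with
  | edge i => exact id
  | node b ch ih =>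
    intro hm
    rcases (meets_graft _ _).1 hm with hm | ⟨l, hm⟩
    · exact hF none hm
    · exact ih _ _ (fun n => h (some ⟨_, n⟩)) (fun n => hF (some ⟨_, n⟩)) hm

/-- A connected part of a tree substituted is a connected part of the result. -/
theorem conn_lsub (A : Set Y) (T : P.PTree) (F : T.Node → P.VTree Y)
    (h : ∀ n, (F n).op = T.dec n) (v : T.Valid) (n : T.Node) (hn : (F n).1.Conn A)
    (hn' : ∀ m, m ≠ n → ¬ (F m).1.Meets A) :
    (lsub T F h).Conn A ∧ (lsub T F h).kern A = (F n).1.kern A := by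
  induction T with
  | edge i => exact n.elim
  | node b ch ih =>
    match n with
    | none =>
      refine conn_graft_left (fun l => (valid_lsub _ _ _ (v _).2).2.trans
        ((v _).1.trans ((F none).src_leafTo (h none) l)))
        (fun l => lsub_not_meets A _ _ _ fun n => hn' _ (Option.some_ne_none _)) hn
    | some ⟨e, n⟩ =>
      obtain ⟨l, rfl⟩ := ((F none).leafTo (h none)).surjective e
      obtain ⟨h1, h2⟩ := ih ((F none).leafTo (h none) l) (fun n => F (some ⟨_, n⟩))
        (fun n => h (some ⟨_, n⟩)) (v _).2 n hn fun m hm => hn' _ fun h' =>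
          hm (eq_of_heq (Sigma.mk.inj (Option.some.inj h')).2)
      obtain ⟨h3, h4⟩ := conn_graft_right (K := (F none).1) (g := fun l =>
        lsub (ch ((F none).leafTo (h none) l)) (fun n => F (some ⟨_, n⟩))
          fun n => h (some ⟨_, n⟩)) (hn' none (Option.some_ne_none _).symm) l h1 fun l' hl' =>
            lsub_not_meets A _ _ _ fun n => hn' _ fun h' => hl'
              (((F none).leafTo (h none)).injective (Sigma.mk.inj (Option.some.inj h')).1)
      exact ⟨h3, h4.trans h2⟩

theorem rootNot_lsub (A : Set Y) (T : P.PTree) (F : T.Node → P.VTree Y)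
    (h : ∀ n, (F n).op = T.dec n) (hF : ∀ n, (F n).1.Within Aᶜ) : (lsub T F h).RootNot A := by
  have := lsub_within _ T F h hF
  revert this
  cases lsub T F h with
  | edge i => exact fun _ => trivial
  | node b ch => exact fun h => h.1

/-- Contracting the trees that have been substituted. -/
theorem contract_lsub (c : Y → Option Z) (T : P.PTree) (F : T.Node → P.VTree Y)
    (h : ∀ n, (F n).op = T.dec n) (vT : T.Valid) (a : T.Node → Z) (ha : Function.Injective a)
    (hF : ∀ n, (F n).1.Within {y | c y = some (a n)}) (hF' : ∀ n, ∃ b ch, (F n).1 = node b ch)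
    (v : (lsub T F h).Valid) : P.contract c (lsub T F h) v = T.mkLab a := by
  induction T with
  | edge i => rfl
  | node b ch ih =>
    have hr : ∀ l, (lsub (ch ((F none).leafTo (h none) l)) (fun n => F (some ⟨_, n⟩))
        fun n => h (some ⟨_, n⟩)).root = (F none).1.leafType l := fun l =>
      (valid_lsub _ _ _ (vT _).2).2.trans ((vT _).1.trans ((F none).src_leafTo (h none) l))
    -- The part of colour `a none` at the root is exactly `F none`: the trees grafted on it carry
    -- colours `a (some _)`, which differ from `a none` by injectivity.
    have H := (F none).contract_graft c (a none) (h none) _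
      (fun l => (valid_lsub _ _ _ (vT ((F none).leafTo (h none) l)).2).1) hr (hF none)
      (fun l => rootNot_lsub _ _ _ _ fun n => (hF _).mono fun y hy hy' => by
        have := ha (Option.some.inj (hy.symm.trans hy'))
        exact Option.some_ne_none _ this) v (by
        obtain ⟨b', ch', h'⟩ := hF' none
        have := hF none
        rw [h'] at this ⊢
        exact fun h => h this.1)
    refine H.trans (congrArg (node (P := P.toPolyEndo.lab Z) _) (funext fun e => ?_))
    have H2 : ∀ l, P.contract c (lsub (ch ((F none).leafTo (h none) l)) (fun n => F (some ⟨_, n⟩))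
        fun n => h (some ⟨_, n⟩)) (valid_lsub _ _ _ (vT _).2).1 =
        (ch ((F none).leafTo (h none) l)).mkLab fun n => a (some ⟨_, n⟩) := fun l =>
      ih _ _ _ (vT _).2 _ (fun m n hmn => eq_of_heq (Sigma.mk.inj (Option.some.inj (ha hmn))).2)
        (fun n => hF _) (fun n => hF' _) _
    refine (H2 _).trans ?_
    have : (F none).leafTo (h none) (((F none).leafTo (h none)).symm e) = e :=
      ((F none).leafTo (h none)).apply_symm_apply e
    exact congrArg (fun e => (ch e).mkLab fun n => a (some ⟨e, n⟩)) this

/-- `W` arises from `U` by substituting `κ z` into the nodes with label `z`. -/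
def IsLsub (κ : Z → P.VTree Y) (U : (P.toPolyEndo.lab Z).PreTree)
    (W : (P.toPolyEndo.lab Y).PreTree) : Prop :=
  ∃ h : ∀ n, (κ (U.nodeLab n)).op = U.forget.dec n,
    W = lsub U.forget (fun n => κ (U.nodeLab n)) h

/-- One step of the reconstruction of a tree from its contraction: the branches are indexed by the
inputs of the total operation of `κ z` on one side and by the leaves of `κ z` on the other, and
`lleaf` matches them. -/
theorem isLsub_node (κ : Z → P.VTree Y) (z : Z) (g : (κ z).1.Leaf → (P.toPolyEndo.lab Y).PreTree)
    (ch : P.Ar (κ z).op → (P.toPolyEndo.lab Z).PreTree)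
    (H : ∀ e, IsLsub κ (ch e) (g ((P.lleaf (κ z).1 (κ z).2).symm e))) :
    IsLsub κ (node (P := P.toPolyEndo.lab Z) ((κ z).op, z) ch) ((κ z).1.graft g) := by
  choose h1 h2 using H
  refine ⟨fun n => ?_, ?_⟩
  · match n with
    | none => rfl
    | some ⟨e, n⟩ => exact h1 e n
  · refine congrArg (PreTree.graft (κ z).1) (funext fun l => ?_)
    have := h2 (P.lleaf (κ z).1 (κ z).2 l)
    rw [Equiv.symm_apply_apply] at this
    exact this

/-- If the labels of each colour form a connected part, the tree is recovered from the contracted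
tree by substituting these parts into its nodes. -/
theorem isLsub_contract (c : Y → Option Z) (κ : Z → P.VTree Y)
    (W : (P.toPolyEndo.lab Y).PreTree) (v : W.Valid) (hW : W.Within {y | (c y).isSome})
    (hc : ∀ z, W.Meets {y | c y = some z} →
      W.Conn {y | c y = some z} ∧ W.kern {y | c y = some z} = (κ z).1) :
    IsLsub κ (P.contract c W v) W := by
  induction W using sub_induction with
  | h0 i => exact ⟨fun n => n.elim, rfl⟩
  | h1 b ch ih =>
    obtain ⟨z, hz⟩ := Option.isSome_iff_exists.1 hW.1
    obtain ⟨h1, h2⟩ := hc z (.inl hz)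
    have hA : b.2 ∈ {y | c y = some z} := hz
    rw [kern_of_mem hA] at h2
    have hroot : ∀ e, (ch e).AtRoot {y | c y = some z} :=
      h1.elim (fun h => h.2) fun h => absurd hA h.1
    -- With `z` the colour of the root, each branch is cut where colour `z` stops. Then `K` below is
    -- the part of colour `z` and `G` lists the trees above it.
    choose g g1 g2 g3 g4 g5 g6 using fun e => exists_graft_prune {y | c y = some z} (ch e) (v e).2
    let K : (P.toPolyEndo.lab Y).PreTree := node b fun e => (ch e).prune {y | c y = some z}
    let G : K.Leaf → (P.toPolyEndo.lab Y).PreTree := fun l => g l.1 l.2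
    have hK : node b ch = K.graft G := congrArg (node b) (funext g1)
    have vK : K.Valid := fun e => ⟨(root_prune _ _).trans (v e).1, valid_prune _ _ (v e).2⟩
    have vKG : (K.graft G).Valid := hK ▸ v
    have hwK : K.Within {y | c y = some z} := ⟨hA, fun e => within_prune _ _⟩
    have H := P.contract_graft c z K vK G (fun l => g3 l.1 l.2) (fun l => g2 l.1 l.2) hwK
      (fun l => g4 l.1 l.2) vKG (fun h => h hA)
    rw [P.contract_congr c hK v vKG, H]
    have hW' : (K.graft G).Within {y | (c y).isSome} := hK ▸ hW
    have hsub : ∀ l, IsLsub κ (P.contract c (G l) (g3 l.1 l.2)) (G l) := by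
      intro l
      have hwG : (G l).Within {y | (c y).isSome} := by
        have : ∀ (S T : (P.toPolyEndo.lab Y).PreTree), S.Sub T → T.Within {y | (c y).isSome} →
            S.Within {y | (c y).isSome} := by
          intro S T
          induction T with
          | edge i => rintro rfl h; exact h
          | node b ch ih =>
            rintro (rfl | ⟨e, he⟩) h
            · exact h
            · exact ih e he (h.2 e)
        exact this _ _ (g6 l.1 l.2) (hW.2 l.1)
      refine ih l.1 (G l) (g6 l.1 l.2) (g3 l.1 l.2) hwG fun z' hz' => ?_
      -- Connectedness puts every node of colour `z` into `K`. The other colours do not occur in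
      -- `K`, so each of them forms a connected part within a single `G l`, and the induction
      -- hypothesis applies.
      have hne : z' ≠ z := by
        rintro rfl
        exact g5 l.1 (hroot l.1) l.2 hz'
      have hKn : ¬ K.Meets {y | c y = some z'} := hwK.not_meets
        (Set.disjoint_left.2 fun y hy hy' => hne (Option.some.inj (hy'.symm.trans hy)))
      have hm : (node b ch).Meets {y | c y = some z'} := by
        rw [hK]
        exact (meets_graft _ _).2 (.inr ⟨l, hz'⟩)
      obtain ⟨h3, h4⟩ := hc z' hm
      rw [hK] at h3 h4
      obtain ⟨h5, h6⟩ := conn_of_conn_graft hKn h3 l hz'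
      exact ⟨h5, h6.trans h4⟩
    have hκ : κ z = ⟨K, vK⟩ := Subtype.ext h2.symm
    have key : ∀ (k : P.VTree Y) (_ : κ z = k) (G : k.1.Leaf → (P.toPolyEndo.lab Y).PreTree)
        (vG : ∀ l, (G l).Valid) (_ : ∀ l, IsLsub κ (P.contract c (G l) (vG l)) (G l)),
        IsLsub κ (node (P := P.toPolyEndo.lab Z) (k.op, z) fun e =>
          P.contract c (G ((P.lleaf k.1 k.2).symm e)) (vG _)) (k.1.graft G) := by
      rintro k rfl G vG hG
      exact isLsub_node κ z G _ fun e => hG _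
    exact (congrArg (IsLsub κ _) hK).mpr (key ⟨K, vK⟩ hκ G _ hsub)

end PolyMonad

/-! ### Kernels as connected subgraphs and as recursive connected parts -/

/-- A parent function that lowers a depth makes the graph a forest. Following parents inside `K`
must stop, at an element whose parent is not in `K`, and each component has exactly one such local
root. -/
theorem SimpleGraph.connected_induce_fromRel_iff {α : Type*} (p : α → Option α) (d : α → ℕ)
    (hd : ∀ a b, p a = some b → d a = d b + 1) (K : Set α) :
    ((SimpleGraph.fromRel fun a b => p a = some b).induce K).Connected ↔
      ∃! a, a ∈ K ∧ ∀ b, p a = some b → b ∉ K := by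
  set G := (SimpleGraph.fromRel fun a b => p a = some b).induce K
  have hreach : ∀ n, ∀ a : K, d a = n → ∃ t : K, (∀ b, p t = some b → b ∉ K) ∧ G.Reachable a t := by
    intro n
    induction n using Nat.strong_induction_on with
    | _ n ih =>
      intro a ha
      by_cases h : ∀ b, p a = some b → b ∉ K
      · exact ⟨a, h, .refl a⟩
      · push Not at h
        obtain ⟨b, hb, hK⟩ := h
        have hdb := hd _ _ hb
        obtain ⟨t, ht, hr⟩ := ih (d b) (by omega) ⟨b, hK⟩ rfl
        refine ⟨t, ht, SimpleGraph.Reachable.trans (SimpleGraph.Adj.reachable ?_) hr⟩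
        refine ⟨fun h => ?_, .inl hb⟩
        have : (a : α) = b := h
        rw [this] at hdb
        omega
  constructor
  · intro hc
    obtain ⟨a⟩ := hc.nonempty
    obtain ⟨t, ht, -⟩ := hreach _ a rfl
    refine ⟨t, ⟨t.2, ht⟩, ?_⟩
    rintro s ⟨hs, hs'⟩
    -- Invariant along a walk from the local root `t`: every vertex reached leads back to `t`
    -- through parents inside `K`. A step of the walk to a parent only shortens this chain, and `t`
    -- itself has no parent in `K`.
    have key : ∀ x : K, G.Reachable t x →
        Relation.ReflTransGen (fun a b : K => p a = some b.1) x t := by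
      intro x hx
      rw [SimpleGraph.reachable_iff_reflTransGen] at hx
      induction hx with
      | refl => exact .refl
      | tail _ h ih =>
        rcases h.2 with h | h
        · rcases Relation.ReflTransGen.cases_head ih with ih | ⟨z, hz, ih⟩
          · rw [ih] at h
            exact absurd (Subtype.property _) (ht _ h)
          · have := Subtype.ext (Option.some.inj (hz.symm.trans h))
            exact this ▸ ih
        · exact .head h ih
    rcases Relation.ReflTransGen.cases_head (key ⟨s, hs⟩ (hc.preconnected t ⟨s, hs⟩)) with h | ⟨z, hz, -⟩
    · exact congrArg Subtype.val h
    · exact absurd z.2 (hs' _ hz)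
  · rintro ⟨t, ⟨ht, ht'⟩, hu⟩
    have : ∀ a : K, G.Reachable a ⟨t, ht⟩ := by
      intro a
      obtain ⟨s, hs, hr⟩ := hreach _ a rfl
      have : s = ⟨t, ht⟩ := Subtype.ext (hu s ⟨s.2, hs⟩)
      exact this ▸ hr
    have hne : Nonempty K := ⟨⟨t, ht⟩⟩
    exact ⟨fun a b => (this a).trans (this b).symm⟩

namespace PolyEndo.PreTree

variable {I : Type u} {P : PolyEndo I} {Y Z : Type}

/-- The distance of a node from the root node. -/
def depth : (T : PreTree P) → T.Node → ℕ
  | edge _, n => n.elim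
  | node _ _, none => 0
  | node _ ch, some n => (ch n.1).depth n.2 + 1

theorem depth_parent (T : PreTree P) (n m : T.Node) (h : T.parentNode n = some m) :
    T.depth n = T.depth m + 1 := by
  induction T with
  | edge i => exact n.elim
  | node b ch ih =>
    match n with
    | none => cases h
    | some ⟨e, n⟩ =>
      have h' : some (((ch e).parentNode n).map fun m => (⟨e, m⟩ : Σ e, (ch e).Node)) = some m := h
      obtain rfl := Option.some.inj h'
      cases hp : (ch e).parentNode n with
      | none =>
        have : (ch e).depth n = 0 := by
          clear ih h h'
          revert n
          cases ch e with
          | edge i => exact fun n => n.elim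
          | node b ch => exact fun n => match n with
            | none => fun _ => rfl
            | some n => fun h => by cases h
        change (ch e).depth n + 1 = 0 + 1
        rw [this]
      | some k =>
        change (ch e).depth n + 1 = (ch e).depth k + 1 + 1
        rw [ih e n k hp]

theorem isKernel_iff (T : PreTree P) (K : Set T.Node) :
    T.IsKernel K ↔ ∃! n, n ∈ K ∧ ∀ m, T.parentNode n = some m → m ∉ K :=
  SimpleGraph.connected_induce_fromRel_iff T.parentNode T.depth T.depth_parent K

/-- The lowest nodes with label in `A`. -/
def Lowest (A : Set Y) (T : PreTree (P.lab Y)) (n : T.Node) : Prop :=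
  (T.dec n).2 ∈ A ∧ ∀ m, T.parentNode n = some m → (T.dec m).2 ∉ A

theorem lowest_none {A : Set Y} {b : (P.lab Y).Op} {ch : (P.lab Y).Ar b → PreTree (P.lab Y)} :
    (node b ch).Lowest A none ↔ b.2 ∈ A :=
  ⟨fun h => h.1, fun h => ⟨h, fun m hm => by cases hm⟩⟩

/-- Parents inside a branch are unchanged; only the root node of the branch acquires a parent, the
root node of the whole tree. -/
theorem lowest_some {A : Set Y} {b : (P.lab Y).Op} {ch : (P.lab Y).Ar b → PreTree (P.lab Y)}
    (e : (P.lab Y).Ar b) (n : (ch e).Node) :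
    (node b ch).Lowest A (some ⟨e, n⟩) ↔
      (ch e).Lowest A n ∧ ((ch e).parentNode n = none → b.2 ∉ A) := by
  have hp : (node b ch).parentNode (some ⟨e, n⟩) =
    some (((ch e).parentNode n).map fun m => ⟨e, m⟩) := rfl
  unfold Lowest
  rw [hp]
  cases h : (ch e).parentNode n with
  | none =>
    exact ⟨fun H => ⟨⟨H.1, fun m hm => by cases hm⟩, fun _ => H.2 none rfl⟩,
      fun H => ⟨H.1.1, fun m hm => Option.some.inj hm ▸ H.2 rfl⟩⟩
  | some k =>
    exact ⟨fun H => ⟨⟨H.1, fun m hm => Option.some.inj hm ▸ H.2 (some ⟨e, k⟩) rfl⟩, fun h => by cases h⟩,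
      fun H => ⟨H.1.1, fun m hm => Option.some.inj hm ▸ H.1.2 k rfl⟩⟩

theorem meets_iff {A : Set Y} (T : PreTree (P.lab Y)) : T.Meets A ↔ ∃ n, (T.dec n).2 ∈ A := by
  induction T with
  | edge i => exact ⟨False.elim, fun ⟨n, _⟩ => n.elim⟩
  | node b ch ih =>
    constructor
    · rintro (h | ⟨e, h⟩)
      · exact ⟨none, h⟩
      · obtain ⟨n, hn⟩ := (ih e).1 h
        exact ⟨some ⟨e, n⟩, hn⟩
    · rintro ⟨n, hn⟩
      match n with
      | none => exact .inl hn
      | some ⟨e, n⟩ => exact .inr ⟨e, (ih e).2 ⟨n, hn⟩⟩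

theorem meets_iff_lowest {A : Set Y} (T : PreTree (P.lab Y)) : T.Meets A ↔ ∃ n, T.Lowest A n := by
  induction T with
  | edge i => exact ⟨False.elim, fun ⟨n, _⟩ => n.elim⟩
  | node b ch ih =>
    refine ⟨fun h => ?_, fun ⟨n, hn⟩ => (meets_iff _).2 ⟨n, hn.1⟩⟩
    by_cases hb : b.2 ∈ A
    · exact ⟨none, lowest_none.2 hb⟩
    · rcases h with h | ⟨e, h⟩
      · exact absurd h hb
      · obtain ⟨n, hn⟩ := (ih e).1 h
        exact ⟨some ⟨e, n⟩, (lowest_some e n).2 ⟨hn, fun _ => hb⟩⟩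

theorem atRoot_iff {A : Set Y} (T : PreTree (P.lab Y)) :
    T.AtRoot A ↔ ∀ n, T.Lowest A n → T.parentNode n = none := by
  induction T with
  | edge i => exact ⟨fun _ n => n.elim, fun _ => trivial⟩
  | node b ch ih =>
    constructor
    · rintro (⟨hb, h⟩ | h) n hn
      · match n with
        | none => rfl
        | some ⟨e, n⟩ =>
          obtain ⟨h1, h2⟩ := (lowest_some e n).1 hn
          exact absurd hb (h2 ((ih e).1 (h e) n h1))
      · exact absurd ((meets_iff_lowest _).2 ⟨n, hn⟩) h
    · intro H
      have H' : ∀ e n, ¬ (node b ch).Lowest A (some ⟨e, n⟩) := fun e n hn => by cases H _ hn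
      by_cases hb : b.2 ∈ A
      · refine .inl ⟨hb, fun e => (ih e).2 fun n hn => ?_⟩
        by_contra hp
        exact H' e n ((lowest_some e n).2 ⟨hn, fun h => absurd h hp⟩)
      · refine .inr ?_
        rintro (h | ⟨e, h⟩)
        · exact hb h
        · obtain ⟨n, hn⟩ := (meets_iff_lowest _).1 h
          exact H' e n ((lowest_some e n).2 ⟨hn, fun _ => hb⟩)

/-- In a tree, connectedness amounts to having a single lowest node; this ties the recursive
condition, convenient for induction, to the graph-theoretic one. -/
theorem conn_iff {A : Set Y} (T : PreTree (P.lab Y)) : T.Conn A ↔ ∃! n, T.Lowest A n := by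
  induction T with
  | edge i => exact ⟨False.elim, fun ⟨n, _⟩ => n.elim⟩
  | node b ch ih =>
    by_cases hb : b.2 ∈ A
    · have h1 : (node b ch).Conn A ↔ ∀ e, (ch e).AtRoot A :=
        ⟨fun h => h.elim (fun h => h.2) fun h => absurd hb h.1, fun h => .inl ⟨hb, h⟩⟩
      rw [h1]
      constructor
      · intro h
        refine ⟨none, lowest_none.2 hb, fun n hn => ?_⟩
        match n with
        | none => rfl
        | some ⟨e, n⟩ =>
          obtain ⟨h2, h3⟩ := (lowest_some e n).1 hn
          exact absurd hb (h3 ((atRoot_iff _).1 (h e) n h2))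
      · rintro h e
        refine (atRoot_iff _).2 fun n hn => ?_
        by_contra hp
        have := h.unique (lowest_none.2 hb) ((lowest_some e n).2 ⟨hn, fun h => absurd h hp⟩)
        cases this
    · have hs : ∀ e n, (node b ch).Lowest A (some ⟨e, n⟩) ↔ (ch e).Lowest A n := fun e n =>
        (lowest_some e n).trans (and_iff_left fun _ => hb)
      constructor
      · rintro (h | ⟨-, e, h, h'⟩)
        · exact absurd h.1 hb
        · obtain ⟨n, hn, hu⟩ := (ih e).1 h
          refine ⟨some ⟨e, n⟩, (hs e n).2 hn, fun m hm => ?_⟩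
          match m with
          | none => exact absurd (lowest_none.1 hm) hb
          | some ⟨e', m⟩ =>
            have hm := (hs e' m).1 hm
            by_cases hee : e' = e
            · subst hee
              rw [hu m hm]
            · exact absurd ((meets_iff_lowest _).2 ⟨m, hm⟩) (h' e' hee)
      · rintro ⟨n, hn, hu⟩
        match n with
        | none => exact absurd (lowest_none.1 hn) hb
        | some ⟨e, n⟩ =>
          refine .inr ⟨hb, e, (ih e).2 ⟨n, (hs e n).1 hn, fun m hm => ?_⟩, fun e' he' hm => ?_⟩
          · have := hu _ ((hs e m).2 hm)
            exact eq_of_heq (Sigma.mk.inj (Option.some.inj this)).2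
          · obtain ⟨m, hm⟩ := (meets_iff_lowest _).1 hm
            exact he' (Sigma.mk.inj (Option.some.inj (hu _ ((hs e' m).2 hm)))).1

end PolyEndo.PreTree

/-! ### White dots as units -/

namespace PolyMonad

open PolyEndo PreTree

variable {I : Type u} (P : PolyMonad I) {L D : Type}

/-- Regarding white dots as nodes does not change the set of dots. -/
def fillNode : (T : (P.toPolyEndo.subdiv L D).PreTree) → T.Node ≃ (P.fillWhite T).Node
  | edge _ => Equiv.refl _
  | node (.inl b) ch => Equiv.optionCongr (Equiv.sigmaCongrRight
      (β₂ := fun e : P.Ar b.1 => (P.fillWhite (ch e)).Node) fun e => fillNode (ch e))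
  | node (.inr i) ch => Equiv.optionCongr
      -- A unit has the single input `P.pt`, so the one branch above a white dot is the one branch
      -- above the unit.
      { toFun := fun n => ⟨P.pt i.1, fillNode (ch PUnit.unit) n.2⟩
        invFun := fun n => ⟨PUnit.unit, (fillNode (ch PUnit.unit)).symm n.2⟩
        left_inv := fun n => Sigma.ext rfl (heq_of_eq ((fillNode (ch PUnit.unit)).symm_apply_apply n.2))
        right_inv := fun n => Sigma.ext (P.eq_pt i.1 n.1).symm
          (heq_of_eq ((fillNode (ch PUnit.unit)).apply_symm_apply n.2)) }

theorem label_fillNode (T : (P.toPolyEndo.subdiv L D).PreTree) (n : T.Node) :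
    ((P.fillWhite T).dec (P.fillNode T n)).2 = T.name n := by
  induction T with
  | edge i => exact n.elim
  | node b ch ih =>
    rcases b with b | b
    · match n with
      | none => rfl
      | some ⟨e, n⟩ => exact ih e n
    · match n with
      | none => rfl
      | some ⟨e, n⟩ => exact ih _ n

theorem dec_fillNode (T : (P.toPolyEndo.subdiv L D).PreTree) (n : T.Node) (b : P.Op) (l : L)
    (h : T.dec n = .inl (b, l)) : (P.fillWhite T).dec (P.fillNode T n) = (b, .inr l) := by
  induction T with
  | edge i => exact n.elim
  | node b' ch ih =>
    rcases b' with b' | b'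
    · match n with
      | none =>
        obtain rfl := Sum.inl.inj h
        rfl
      | some ⟨e, n⟩ => exact ih e n h
    · match n with
      | none => cases h
      | some ⟨e, n⟩ => exact ih _ n h

theorem dec_of_fillNode (T : (P.toPolyEndo.subdiv L D).PreTree) (n : T.Node) (b : P.Op) (l : L)
    (h : (P.fillWhite T).dec (P.fillNode T n) = (b, .inr l)) : T.dec n = .inl (b, l) := by
  induction T with
  | edge i => exact n.elim
  | node b' ch ih =>
    rcases b' with b' | b'
    · match n with
      | none =>
        obtain ⟨h1, h2⟩ := Prod.mk.inj h
        exact congrArg Sum.inl (Prod.ext h1 (Sum.inr.inj h2))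
      | some ⟨e, n⟩ => exact ih e n h
    · match n with
      | none => cases (Prod.mk.inj h).2
      | some ⟨e, n⟩ => exact ih _ n h

theorem dec_fillNode_white (T : (P.toPolyEndo.subdiv L D).PreTree) (n : T.Node) (x : D)
    (h : T.name n = .inl x) : ∃ i, (P.fillWhite T).dec (P.fillNode T n) = (P.one i, .inl x) := by
  induction T with
  | edge i => exact n.elim
  | node b' ch ih =>
    rcases b' with b' | b'
    · match n with
      | none => cases h
      | some ⟨e, n⟩ => exact ih e n h
    · match n with
      | none =>
        obtain rfl := Sum.inl.inj h
        exact ⟨_, rfl⟩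
      | some ⟨e, n⟩ => exact ih _ n h

theorem parentNode_fillNode (T : (P.toPolyEndo.subdiv L D).PreTree) (n : T.Node) :
    (P.fillWhite T).parentNode (P.fillNode T n) = (T.parentNode n).map (P.fillNode T) := by
  induction T with
  | edge i => exact n.elim
  | node b ch ih =>
    rcases b with b | b
    · match n with
      | none => rfl
      | some ⟨e, n⟩ =>
        have h := ih e n
        change some (((P.fillWhite (ch e)).parentNode (P.fillNode (ch e) n)).map _) =
          Option.map _ (some (((ch e).parentNode n).map _))
        rw [h]
        cases (ch e).parentNode n <;> rfl
    · match n with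
      | none => rfl
      | some ⟨PUnit.unit, n⟩ =>
        have h := ih PUnit.unit n
        change some (((P.fillWhite (ch PUnit.unit)).parentNode (P.fillNode (ch PUnit.unit) n)).map _) =
          Option.map _ (some (((ch PUnit.unit).parentNode n).map _))
        rw [h]
        cases (ch PUnit.unit).parentNode n <;> rfl

/-- Filling white dots with units preserves names and parents, hence the lowest dots; the kernel
rule can therefore be tested on an ordinary labelled `P`-tree. -/
theorem isKernel_iff_conn (T : (P.toPolyEndo.subdiv L D).PreTree) (A : Set (D ⊕ L)) :
    T.IsKernel {n | T.name n ∈ A} ↔ (P.fillWhite T).Conn A := by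
  rw [isKernel_iff, conn_iff]
  refine Equiv.existsUnique_congr (P.fillNode T) fun {n} => ?_
  unfold Lowest
  rw [P.label_fillNode, P.parentNode_fillNode]
  refine and_congr Iff.rfl ⟨fun h m hm => ?_, fun h m hm => ?_⟩
  · obtain ⟨k, hk, rfl⟩ := Option.map_eq_some_iff.1 hm
    rw [P.label_fillNode]
    exact h k hk
  · have := h (P.fillNode T m) (by rw [hm]; rfl)
    rwa [P.label_fillNode] at this

/-- The names separate black dots from white ones, and the type of a white dot is the output type of
its unit. -/
theorem fillWhite_injective (T T' : (P.toPolyEndo.subdiv L D).PreTree)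
    (h : P.fillWhite T = P.fillWhite T') : T = T' := by
  induction T generalizing T' with
  | edge i =>
    rcases T' with j | ⟨b | b, ch'⟩
    · exact congrArg edge (PreTree.edge.inj h)
    · cases h
    · cases h
  | node b ch ih =>
    rcases T' with j | ⟨b', ch'⟩
    · rcases b with b | b <;> cases h
    · rcases b with b | b <;> rcases b' with b' | b'
      · obtain ⟨h1, h2⟩ := PreTree.node.inj h
        obtain ⟨h3, h4⟩ := Prod.mk.inj h1
        obtain rfl : b = b' := Prod.ext h3 (Sum.inr.inj h4)
        refine congrArg (node (P := P.toPolyEndo.subdiv L D) (.inl b)) (funext fun e => ih e _ ?_)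
        exact congrFun (eq_of_heq h2) e
      · obtain ⟨h1, h2⟩ := PreTree.node.inj h
        cases (Prod.mk.inj h1).2
      · obtain ⟨h1, h2⟩ := PreTree.node.inj h
        cases (Prod.mk.inj h1).2
      · obtain ⟨h1, h2⟩ := PreTree.node.inj h
        obtain ⟨h3, h4⟩ := Prod.mk.inj h1
        have h5 : b.1 = b'.1 := (P.tgt_one _).symm.trans ((congrArg P.tgt h3).trans (P.tgt_one _))
        obtain rfl : b = b' := Prod.ext h5 (Sum.inl.inj h4)
        refine congrArg (node (P := P.toPolyEndo.subdiv L D) (.inr b)) (funext fun e => ih e _ ?_)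
        exact congrFun (eq_of_heq h2) (P.pt b.1)

/-- White dots are decorated by units. -/
def WhiteUnit : (P.toPolyEndo.lab (D ⊕ L)).PreTree → Prop
  | edge _ => True
  | node b ch => (∀ x, b.2 = .inl x → ∃ i, b.1 = P.one i) ∧ ∀ e, (WhiteUnit (ch e))

/-- `WhiteUnit` describes the image of `fillWhite` among valid trees: a unit has only one input, so
a node decorated by a unit can be read as a dot on an edge. -/
theorem exists_fillWhite (W : (P.toPolyEndo.lab (D ⊕ L)).PreTree) (v : W.Valid)
    (hW : P.WhiteUnit W) : ∃ T : (P.toPolyEndo.subdiv L D).PreTree,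
      T.Valid ∧ T.root = W.root ∧ P.fillWhite T = W := by
  induction W with
  | edge i => exact ⟨edge i, trivial, rfl, rfl⟩
  | node b ch ih =>
    choose T h1 h2 h3 using fun e => ih e (v e).2 (hW.2 e)
    obtain ⟨b, x | l⟩ := b
    · obtain ⟨i, rfl⟩ : ∃ i, b = P.one i := hW.1 x rfl
      refine ⟨node (P := P.toPolyEndo.subdiv L D) (.inr (i, x)) fun _ => T (P.pt i),
        fun _ => ⟨(h2 _).trans ((v _).1.trans (P.src_pt i)), h1 _⟩, (P.tgt_one i).symm, ?_⟩
      refine congrArg (node (P := P.toPolyEndo.lab (D ⊕ L)) (P.one i, .inl x)) (funext fun e => ?_)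
      rw [P.eq_pt i e]
      exact h3 _
    · exact ⟨node (P := P.toPolyEndo.subdiv L D) (.inl (b, l)) T,
        fun e => ⟨(h2 e).trans (v e).1, h1 e⟩, rfl,
        congrArg (node (P := P.toPolyEndo.lab (D ⊕ L)) (b, .inr l)) (funext h3)⟩

end PolyMonad

/-! ### Expanding a tree of `P`-trees -/

namespace PolyEndo.PreTree

variable {I : Type u} {P : PolyEndo I} {Y : Type}

theorem graft_eq_mkLab (K : PreTree (P.lab Y)) (g : K.Leaf → PreTree (P.lab Y)) :
    K.graft g = (K.forget.graft fun l => (g (K.leafForget.symm l)).forget).mkLab fun q =>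
      Sum.elim K.nodeLab (fun m => (g (K.leafForget.symm m.1)).nodeLab m.2)
        (K.forget.graftNode (fun l => (g (K.leafForget.symm l)).forget) q) := by
  induction K with
  | edge i => exact (mkLab_nodeLab _).symm
  | node b ch ih =>
    refine congrArg (node (P := P.lab Y) b) (funext fun e => (ih e fun l => g ⟨e, l⟩).trans ?_)
    refine congrArg (mkLab _) (funext fun q => ?_)
    change _ = Sum.elim (node b ch).nodeLab _ (Sum.map _ _ ((ch e).forget.graftNode
      (fun l => (g ⟨e, (ch e).leafForget.symm l⟩).forget) q))
    rcases (ch e).forget.graftNode (fun l => (g ⟨e, (ch e).leafForget.symm l⟩).forget) q with m | m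
      <;> rfl

/-- The name of the root node, or of the leaf if there is no node. -/
def rt {D L : Type*} : (T : PreTree P) → (T.Node → D) → (T.Leaf → L) → D ⊕ L
  | edge _, _, f => .inr (f PUnit.unit)
  | node _ _, d, _ => .inl (d none)

end PolyEndo.PreTree

namespace PolyMonad

open PolyEndo PreTree

variable {I : Type u} {P : PolyMonad I} {Y D L : Type}

theorem leafTo_eq_of_input {b : P.Op} (K K' : P.toPolyEndo.Tree) (h : P.target K = b)
    (h' : P.target K' = b) (l : K.1.Leaf) (l' : K'.1.Leaf)
    (hl : (⟨_, P.leafAr K.1 K.2 l⟩ : P.Input) = ⟨_, P.leafAr K'.1 K'.2 l'⟩) :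
    P.leafTo K h l = P.leafTo K' h' l' :=
  eq_of_heq (Sigma.mk.inj ((P.leafTo_of_input K h l _ hl).trans
    (P.leafTo_of_input K' h' l' _ rfl).symm)).2

theorem tot_congr {T T' : P.PTree} (h : T = T') (v : T.Valid) (v' : T'.Valid) :
    (P.tot T v).1 = (P.tot T' v').1 := by
  subst h
  rfl

/-- Relates substitution of labelled trees to the multiplication of `P⁺`: the underlying tree is
given by `subst`, and `substNode` tells from which substituted tree a node takes its label. -/
theorem lsub_eq_mkLab (T : P.PTree) (F : T.Node → P.VTree Y) (h : ∀ n, (F n).op = T.dec n) :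
    lsub T F h = (P.subst T (fun n => (F n).tree) h).mkLab fun q =>
      (F (P.substNode T (fun n => (F n).tree) h q).1).1.nodeLab
        (P.substNode T (fun n => (F n).tree) h q).2 := by
  induction T with
  | edge i => rfl
  | node b ch ih =>
    let X : ∀ e : P.Ar b, Σ T : P.PTree, (T.Node → Y) := fun e =>
      ⟨P.subst (ch e) (fun n => (F (some ⟨e, n⟩)).tree) (fun n => h (some ⟨e, n⟩)), fun q =>
        (F (some ⟨e, (P.substNode (ch e) (fun n => (F (some ⟨e, n⟩)).tree)
          (fun n => h (some ⟨e, n⟩)) q).1⟩)).1.nodeLab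
        (P.substNode (ch e) (fun n => (F (some ⟨e, n⟩)).tree)
          (fun n => h (some ⟨e, n⟩)) q).2⟩
    have H : ∀ e, lsub (ch e) (fun n => F (some ⟨e, n⟩)) (fun n => h (some ⟨e, n⟩)) =
        (X e).1.mkLab (X e).2 := fun e => ih e _ _
    have H1 : lsub (node b ch) F h =
        (F none).1.graft fun l => (X ((F none).leafTo (h none) l)).1.mkLab
          (X ((F none).leafTo (h none) l)).2 :=
      congrArg (PreTree.graft (F none).1) (funext fun l => H _)
    have key : ∀ (Z : (F none).1.forget.Leaf → Σ T : P.PTree, (T.Node → Y))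
        (g : (F none).1.Leaf → (P.toPolyEndo.lab Y).PreTree)
        (_ : Z = fun l => ⟨(g ((F none).1.leafForget.symm l)).forget,
          (g ((F none).1.leafForget.symm l)).nodeLab⟩),
        (F none).1.graft g = ((F none).1.forget.graft fun l => (Z l).1).mkLab fun q =>
          Sum.elim (F none).1.nodeLab (fun m => (Z m.1).2 m.2)
            ((F none).1.forget.graftNode (fun l => (Z l).1) q) := by
      rintro _ g rfl
      exact graft_eq_mkLab _ _
    refine H1.trans ((key (fun l => X (P.leafTo (F none).tree (h none) l)) _ ?_).trans ?_)
    · funext l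
      have hl : (F none).leafTo (h none) ((F none).1.leafForget.symm l) =
          P.leafTo (F none).tree (h none) l := by
        rw [← VTree.leafTo_eq, Equiv.apply_symm_apply]
      rw [hl]
      exact (mkLab_sigma_eq (mkLab_nodeLab _)).symm
    · refine congrArg (mkLab _) (funext fun q => ?_)
      have fin : ∀ s : (F none).1.forget.Node ⊕
          Σ l, (X (P.leafTo (F none).tree (h none) l)).1.Node,
          Sum.elim (F none).1.nodeLab
            (fun m => (X (P.leafTo (F none).tree (h none) m.1)).2 m.2) s =
          (fun r : Σ n, (F n).tree.1.Node => (F r.1).1.nodeLab r.2) (Sum.elim (fun m => ⟨none, m⟩)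
            (fun m =>
              let r := P.substNode (ch (P.leafTo (F none).tree (h none) m.1))
                (fun n => (F (some ⟨_, n⟩)).tree) (fun n => h (some ⟨_, n⟩)) m.2
              ⟨some ⟨_, r.1⟩, r.2⟩) s) := by
        rintro (m | m) <;> rfl
      exact fin _

theorem lsub_eq_mkLab_of_eq (T : P.PTree) (F : T.Node → P.VTree Y) (h : ∀ n, (F n).op = T.dec n)
    (t : T.Node → P.toPolyEndo.Tree) (a : ∀ n, (t n).1.Node → Y)
    (hF : ∀ n, (F n).1 = (t n).1.mkLab (a n)) (ht : ∀ n, P.target (t n) = T.dec n) :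
    lsub T F h = (P.subst T t ht).mkLab fun q => a _ (P.substNode T t ht q).2 := by
  -- Underlying tree and labelling of `F n` have to be replaced simultaneously, so they are bundled.
  -- `LTree` takes labels in `Type u`, whence the lift.
  have key : ∀ (X : T.Node → P.LTree (ULift.{u} Y))
      (_ : X = fun n => ⟨(F n).tree, fun q => ⟨(F n).1.nodeLab q⟩⟩)
      (hX : ∀ n, P.target (X n).1 = T.dec n),
      lsub T F h = (P.subst T (fun n => (X n).1) hX).mkLab fun q =>
        ((X _).2 (P.substNode T (fun n => (X n).1) hX q).2).down := by
    rintro _ rfl hX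
    exact lsub_eq_mkLab T F h
  refine key (fun n => ⟨t n, fun q => ⟨a n q⟩⟩) (funext fun n => ?_) ht
  have h1 : (F n).1.forget.mkLab (F n).1.nodeLab = (t n).1.mkLab (a n) :=
    (mkLab_nodeLab _).trans (hF n)
  obtain ⟨h2, h3⟩ := Sigma.mk.inj (mkLab_sigma_eq h1)
  have : ∀ (t' : P.toPolyEndo.Tree) (a' : t'.1.Node → Y) (_ : t' = t n) (_ : HEq a' (a n)),
      (⟨t n, fun q => ⟨a n q⟩⟩ : P.LTree (ULift.{u} Y)) = ⟨t', fun q => ⟨a' q⟩⟩ := by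
    rintro _ a' rfl ha
    rw [eq_of_heq ha]
  exact this (F n).tree _ (Subtype.ext h2) h3

/-- Each tree substituted composes to the operation that it replaces, so by associativity, in the
form of `tot_subst`, the composite of the whole is unchanged. -/
theorem op_lsub (T : P.PTree) (F : T.Node → P.VTree Y) (h : ∀ n, (F n).op = T.dec n)
    (v : T.Valid) : VTree.op ⟨lsub T F h, (valid_lsub T F h v).1⟩ = (P.tot T v).1 := by
  have h1 : (lsub T F h).forget = P.subst T (fun n => (F n).tree) h := by
    rw [lsub_eq_mkLab, forget_mkLab]
  exact (tot_congr h1 _ (P.valid_subst T (fun n => (F n).tree) h v).1).trans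
    (P.tot_subst T (fun n => (F n).tree) h v _).1

/-- The one-node tree with the given label. -/
def lcorolla (b : P.Op) (y : Y) : P.VTree Y :=
  ⟨node (P := P.toPolyEndo.lab Y) (b, y) fun e => edge (P.src b e), fun _ => ⟨rfl, trivial⟩⟩

theorem op_lcorolla (b : P.Op) (y : Y) : (lcorolla b y).op = b := P.mul_one b

/-- Substitute a labelled tree into each node of `T`; if there is no node, take a unit of `P`
with label `y`. -/
def blow : (T : P.PTree) → T.Valid → Y → (F : T.Node → P.VTree Y) →
    (∀ n, (F n).op = T.dec n) → P.VTree Y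
  | edge i, _, y, _, _ => lcorolla (P.one i) y
  | node b ch, v, _, F, h => ⟨lsub (node b ch) F h, (valid_lsub _ F h v).1⟩

theorem op_blow (T : P.PTree) (v : T.Valid) (y : Y) (F : T.Node → P.VTree Y)
    (h : ∀ n, (F n).op = T.dec n) : (blow T v y F h).op = (P.tot T v).1 := by
  cases T with
  | edge i => exact op_lcorolla _ _
  | node b ch => exact op_lsub _ F h v

/-- The subdivided `P`-tree whose sphere structure is given by the tree `M` of `P`-trees: its
dots are the leaves and null-dots of `M`. -/
noncomputable def expand : (M : P.plus.PTree) → M.Valid → (M.Node → D) → (M.Leaf → L) →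
    {W : P.VTree (D ⊕ L) // W.op = M.root}
  | edge b, _, _, f => ⟨lcorolla b (.inr (f PUnit.unit)), op_lcorolla _ _⟩
  | node T ch, v, d, f => ⟨blow T.1 T.2 (.inl (d none))
      (fun n => (expand (ch n) (v n).2 (fun m => d (some ⟨n, m⟩)) fun l => f ⟨n, l⟩).1)
      (fun n => (expand (ch n) (v n).2 (fun m => d (some ⟨n, m⟩)) fun l => f ⟨n, l⟩).2.trans (v n).1),
      op_blow _ _ _ _ _⟩

/-- The names of the nodes and leaves. -/
def names {I : Type u} {Q : PolyEndo I} {M : Q.PreTree} (d : M.Node → D) (f : M.Leaf → L) :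
    Set (D ⊕ L) :=
  Set.range (Sum.map d f)

theorem blow_induction {p : P.VTree Y → Prop} (T : P.PTree) (v : T.Valid) (y : Y)
    (F : T.Node → P.VTree Y) (h : ∀ n, (F n).op = T.dec n)
    (h0 : ∀ i, T = edge i → p (lcorolla (P.one i) y))
    (h1 : ∀ _ : T.Node, p ⟨lsub T F h, (valid_lsub T F h v).1⟩) : p (blow T v y F h) := by
  cases T with
  | edge i => exact h0 i rfl
  | node b ch => exact h1 none

theorem expand_within (M : P.plus.PTree) (v : M.Valid) (d : M.Node → D) (f : M.Leaf → L) :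
    (expand M v d f).1.1.Within (names d f) := by
  induction M with
  | edge b => exact ⟨⟨.inr PUnit.unit, rfl⟩, fun _ => trivial⟩
  | node T ch ih =>
    refine blow_induction (p := fun W : P.VTree (D ⊕ L) => W.1.Within (names d f)) T.1 T.2
      (.inl (d none)) _ _ (fun i _ => ?_) fun _ => ?_
    · exact ⟨⟨.inl none, rfl⟩, fun _ => trivial⟩
    · refine lsub_within _ _ _ _ fun n => (ih n _ _ _).mono ?_
      rintro _ ⟨m | l, rfl⟩
      · exact ⟨.inl (some ⟨n, m⟩), rfl⟩
      · exact ⟨.inr ⟨n, l⟩, rfl⟩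

theorem graft_eq_node (K : (P.toPolyEndo.lab Y).PreTree) (hK : ∃ b ch, K = node b ch)
    (g : K.Leaf → (P.toPolyEndo.lab Y).PreTree) : ∃ b ch, K.graft g = node b ch := by
  obtain ⟨b, ch, rfl⟩ := hK
  exact ⟨b, _, rfl⟩

/-- A leaf contributes a black dot and a node decorated by a unit tree a white one; this is why no
sphere is empty. -/
theorem expand_eq_node (M : P.plus.PTree) (v : M.Valid) (d : M.Node → D) (f : M.Leaf → L) :
    ∃ b ch, (expand M v d f).1.1 = node b ch := by
  induction M with
  | edge b => exact ⟨_, _, rfl⟩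
  | node T ch ih =>
    obtain ⟨T, vT⟩ := T
    cases T with
    | edge i => exact ⟨_, _, rfl⟩
    | node b c => exact graft_eq_node _ (ih none _ _ _) _

theorem whiteUnit_graft (K : (P.toPolyEndo.lab (D ⊕ L)).PreTree)
    (g : K.Leaf → (P.toPolyEndo.lab (D ⊕ L)).PreTree) (hK : P.WhiteUnit K)
    (hg : ∀ l, P.WhiteUnit (g l)) : P.WhiteUnit (K.graft g) := by
  induction K with
  | edge i => exact hg _
  | node b ch ih => exact ⟨hK.1, fun e => ih e _ (hK.2 e) fun l => hg ⟨e, l⟩⟩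

theorem whiteUnit_lsub (T : P.PTree) (F : T.Node → P.VTree (D ⊕ L))
    (h : ∀ n, (F n).op = T.dec n) (hF : ∀ n, P.WhiteUnit (F n).1) :
    P.WhiteUnit (lsub T F h) := by
  induction T with
  | edge i => trivial
  | node b ch ih => exact whiteUnit_graft _ _ (hF none) fun l => ih _ _ _ fun n => hF _

theorem whiteUnit_expand (M : P.plus.PTree) (v : M.Valid) (d : M.Node → D) (f : M.Leaf → L) :
    P.WhiteUnit (expand M v d f).1.1 := by
  induction M with
  | edge b => exact ⟨fun x hx => (Sum.inr_ne_inl hx).elim, fun _ => trivial⟩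
  | node T ch ih =>
    refine blow_induction (p := fun W : P.VTree (D ⊕ L) => P.WhiteUnit W.1) T.1 T.2
      (.inl (d none)) _ _ (fun i _ => ?_) fun _ => ?_
    · exact ⟨fun x _ => ⟨i, rfl⟩, fun _ => trivial⟩
    · exact whiteUnit_lsub _ _ _ fun n => ih n _ _ _

/-- The tree `expand M`, labelled by the nodes and leaves of `M` themselves. -/
theorem exists_expand_eq (M : P.plus.PTree) (v : M.Valid) :
    ∃ (t : P.toPolyEndo.Tree) (a : t.1.Node → M.Node ⊕ M.Leaf), P.target t = M.root ∧
      ∀ (D L : Type) (d : M.Node → D) (f : M.Leaf → L),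
        (expand M v d f).1.1 = t.1.mkLab (Sum.map d f ∘ a) := by
  induction M with
  | edge b => exact ⟨P.corolla b, fun _ => .inr PUnit.unit, P.target_corolla b, fun _ _ _ _ => rfl⟩
  | node T ch ih =>
    choose t a ht H using fun n => ih n (v n).2
    have ht' : ∀ n, P.target (t n) = T.1.dec n := fun n => (ht n).trans (v n).1
    obtain ⟨T, vT⟩ := T
    cases T with
    | edge i =>
      exact ⟨P.corolla (P.one i), fun _ => .inl none, P.target_corolla _, fun _ _ _ _ => rfl⟩
    | node b c =>
      refine ⟨P.substTree ⟨node b c, vT⟩ t ht', fun q => Sum.map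
        (fun m => some ⟨_, m⟩) (fun l => ⟨_, l⟩) (a _ (P.substNode (node b c) t ht' q).2),
        P.target_substTree _ _ _, fun D L d f => ?_⟩
      refine (lsub_eq_mkLab_of_eq (node b c) (fun n => (expand (ch n) (v n).2
        (fun m => d (some ⟨n, m⟩)) fun l => f ⟨n, l⟩).1) (fun n => (expand (ch n) (v n).2 _ _).2.trans
          (v n).1) t _ (fun n => H n D L _ _) ht').trans ?_
      refine congrArg (mkLab _) (funext fun q => ?_)
      exact (Sum.map_map d f (fun m => some ⟨_, m⟩) (fun l => ⟨_, l⟩)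
        (a _ (P.substNode (node b c) t ht' q).2)).symm

/-- Naturality in the names: by `exists_expand_eq` they enter only through a fixed labelling by the
nodes and leaves of `M`. -/
theorem expand_map {D' L' : Type} (M : P.plus.PTree) (v : M.Valid) (d : M.Node → D)
    (f : M.Leaf → L) (p : D → D') (q : L → L') :
    (expand M v (p ∘ d) (q ∘ f)).1.1 = (expand M v d f).1.1.mapLab (Sum.map p q) := by
  obtain ⟨t, a, -, H⟩ := exists_expand_eq M v
  rw [H, H, mapLab_mkLab, ← Function.comp_assoc, Sum.map_comp_map]

open Classical in
/-- Remove the white dots. -/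
noncomputable def unwhite : (P.toPolyEndo.lab (D ⊕ L)).PreTree → (P.toPolyEndo.lab L).PreTree
  | edge i => edge i
  | node (b, .inr l) ch => node (P := P.toPolyEndo.lab L) (b, l) fun e => unwhite (ch e)
  | node (b, .inl _) ch =>
    -- For a unit there is exactly one input and the choice is forced. The last branch is a default
    -- value that does not arise for units.
    if h : Nonempty (P.Ar b) then unwhite (ch h.some) else edge (P.tgt b)

theorem unwhite_one (i : I) (x : D) (ch : P.Ar (P.one i) → (P.toPolyEndo.lab (D ⊕ L)).PreTree) :
    unwhite (node (P := P.toPolyEndo.lab (D ⊕ L)) (P.one i, .inl x) ch) = unwhite (ch (P.pt i)) := by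
  have h : Nonempty (P.Ar (P.one i)) := ⟨P.pt i⟩
  refine (dif_pos h).trans ?_
  rw [P.eq_pt i h.some]

theorem unwhite_fillWhite (T : (P.toPolyEndo.subdiv L D).PreTree) :
    unwhite (P.fillWhite T) = T.erase := by
  induction T with
  | edge i => rfl
  | node b ch ih =>
    rcases b with b | b
    · exact congrArg (node (P := P.toPolyEndo.lab L) b) (funext ih)
    · exact (unwhite_one _ _ _).trans (ih _)

theorem valid_unwhite (K : (P.toPolyEndo.lab (D ⊕ L)).PreTree) (v : K.Valid)
    (hK : P.WhiteUnit K) : (unwhite K).Valid ∧ (unwhite K).root = K.root := by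
  induction K with
  | edge i => exact ⟨trivial, rfl⟩
  | node b ch ih =>
    have H := fun e => ih e (v e).2 (hK.2 e)
    obtain ⟨b, x | l⟩ := b
    · obtain ⟨i, rfl⟩ : ∃ i, b = P.one i := hK.1 x rfl
      exact ⟨(congrArg Valid (unwhite_one i x ch)).mpr (H _).1,
        (congrArg root (unwhite_one i x ch)).trans ((H _).2.trans ((v _).1.trans
          ((P.src_pt i).trans (P.tgt_one i).symm)))⟩
    · exact ⟨fun e => ⟨(H e).2.trans (v e).1, (H e).1⟩, rfl⟩

/-- By the unit laws, removing units changes neither the total operation nor the input that a leaf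
represents. So leaves before and after the removal are matched through the inputs of the common
operation, and grafting respects this matching. -/
theorem unwhite_graft (K : (P.toPolyEndo.lab (D ⊕ L)).PreTree) (v : K.Valid)
    (hK : P.WhiteUnit K) (K' : (P.toPolyEndo.lab L).PreTree) (hKK : K' = unwhite K)
    (v' : K'.Valid) :
    (P.tot K.forget (valid_forget K v)).1 = (P.tot K'.forget (valid_forget K' v')).1 ∧
    ∀ (g : K.Leaf → (P.toPolyEndo.lab (D ⊕ L)).PreTree)
      (g' : K'.Leaf → (P.toPolyEndo.lab L).PreTree),
      (∀ l l', (⟨_, P.lleaf K v l⟩ : P.Input) = ⟨_, P.lleaf K' v' l'⟩ → unwhite (g l) = g' l') →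
        unwhite (K.graft g) = K'.graft g' := by
  induction K generalizing K' with
  | edge i =>
    subst hKK
    exact ⟨rfl, fun g g' h => h PUnit.unit PUnit.unit rfl⟩
  | node b ch ih =>
    have H := fun e => ih e (v e).2 (hK.2 e)
    obtain ⟨b, x | l⟩ := b
    · obtain ⟨i, rfl⟩ : ∃ i, b = P.one i := hK.1 x rfl
      obtain ⟨h1, h2⟩ := H (P.pt i) K' (hKK.trans (unwhite_one i x ch)) v'
      refine ⟨(P.one_mul i _).trans h1, fun g g' h => (unwhite_one i x _).trans ?_⟩
      exact h2 _ _ fun l l' hl => h ⟨P.pt i, l⟩ l' ((P.one_mul_pos i _ _).trans hl)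
    · subst hKK
      have H := fun e => H e _ rfl (v' e).2
      have hfam : P.totFam b (fun e => (ch e).forget) (valid_forget _ v) =
          P.totFam b (fun e => (unwhite (ch e)).forget) (valid_forget _ v') :=
        Subtype.ext (funext fun e => (H e).1)
      refine ⟨congrArg (P.mul b) hfam, fun g g' h => ?_⟩
      refine congrArg (node (P := P.toPolyEndo.lab L) (b, l)) (funext fun e => ?_)
      exact (H e).2 _ _ fun l l' hl => h ⟨e, l⟩ ⟨e, l'⟩ (P.pos_congr b hfam e _ _ hl)

theorem unwhite_lsub (T : P.PTree) (F : T.Node → P.VTree (D ⊕ L)) (F' : T.Node → P.VTree L)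
    (h : ∀ n, (F n).op = T.dec n) (h' : ∀ n, (F' n).op = T.dec n)
    (hF : ∀ n, P.WhiteUnit (F n).1) (hF' : ∀ n, (F' n).1 = unwhite (F n).1) :
    unwhite (lsub T F h) = lsub T F' h' := by
  induction T with
  | edge i => rfl
  | node b ch ih =>
    refine (unwhite_graft (F none).1 (F none).2 (hF none) (F' none).1 (hF' none) (F' none).2).2 _ _
      fun l l' hl => ?_
    refine (ih _ _ (fun n => F' (some ⟨_, n⟩)) _ (fun n => h' (some ⟨_, n⟩)) (fun n => hF _)
      fun n => hF' _).trans ?_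
    have := leafTo_eq_of_input (F none).tree (F' none).tree (h none) (h' none)
      ((F none).1.leafForget l) ((F' none).1.leafForget l') hl
    exact congrArg (fun e => lsub (ch e) (fun n => F' (some ⟨e, n⟩)) fun n => h' (some ⟨e, n⟩)) this

/-- Removing the white dots from `expand M` gives the composite of `M`, its nodes being the leaves
of `M`. -/
theorem unwhite_expand (M : P.plus.PTree) (v : M.Valid) (d : M.Node → D) (f : M.Leaf → L) :
    unwhite (expand M v d f).1.1 =
      (P.plus.tot M v).1.1.mkLab fun q => f ((P.plus.leafAr M v).symm q) := by
  induction M with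
  | edge b => rfl
  | node T ch ih =>
    have H := fun n => ih n (v n).2 (fun m => d (some ⟨n, m⟩)) fun l => f ⟨n, l⟩
    obtain ⟨T, vT⟩ := T
    cases T with
    | edge i =>
      -- The expansion is a single white dot; removing it leaves the unit tree, which is the
      -- composite in `P⁺` of a node decorated by a unit tree.
      refine (unwhite_one _ _ _).trans ?_
      exact congrArg edge (P.src_pt i)
    | node b c =>
      let F' : (node b c).Node → P.VTree L := fun n => ⟨unwhite (expand (ch n) (v n).2
        (fun m => d (some ⟨n, m⟩)) fun l => f ⟨n, l⟩).1.1,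
        (valid_unwhite _ (expand (ch n) (v n).2 _ _).1.2 (whiteUnit_expand _ _ _ _)).1⟩
      have h' : ∀ n, (F' n).op = (node b c : P.PTree).dec n := fun n =>
        (unwhite_graft _ (expand (ch n) (v n).2 _ _).1.2 (whiteUnit_expand _ _ _ _) _ rfl
          (F' n).2).1.symm.trans ((expand (ch n) (v n).2 _ _).2.trans (v n).1)
      refine (unwhite_lsub (node b c) (fun n => (expand (ch n) (v n).2
        (fun m => d (some ⟨n, m⟩)) fun l => f ⟨n, l⟩).1) F' (fun n => (expand (ch n) (v n).2 _ _).2.trans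
          (v n).1) h' (fun n => whiteUnit_expand _ _ _ _)
        fun n => rfl).trans ?_
      refine (lsub_eq_mkLab_of_eq (node b c) F' h' (fun n => (P.plus.tot (ch n) (v n).2).1) _ H
        (fun n => (P.plus.tot (ch n) (v n).2).2.trans (v n).1)).trans ?_
      refine congrArg (mkLab _) (funext fun q => ?_)
      -- The inverse of the bijection on inputs of `P⁺` is `substNode` by construction, so the leaf
      -- of `M` found on the right is the one read off on the left.
      rfl

end PolyMonad

/-! ### Parts consisting of a single node -/

namespace PolyEndo.PreTree

variable {I : Type u} {P : PolyEndo I} {Y : Type} {A B : Set Y}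

theorem prune_of_not_meets {T : PreTree (P.lab Y)} (h : ¬ T.Meets A) :
    T.prune A = edge T.root := by
  cases T with
  | edge i => rfl
  | node b ch => exact prune_of_not_mem fun hb => h (.inl hb)

theorem not_meets_of_prune_eq_edge {T : PreTree (P.lab Y)} (h : T.AtRoot A) (i : I)
    (hi : T.prune A = edge i) : ¬ T.Meets A := by
  cases T with
  | edge i => exact id
  | node b ch =>
    rcases h with h | h
    · rw [prune_of_mem h.1] at hi
      cases hi
    · exact h

theorem Within.prune {T : PreTree (P.lab Y)} (h : T.Within B) (A : Set Y) :
    (T.prune A).Within B := by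
  induction T with
  | edge i => trivial
  | node b ch ih =>
    by_cases hb : b.2 ∈ A
    · rw [prune_of_mem hb]
      exact ⟨h.1, fun e => ih e (h.2 e)⟩
    · rw [prune_of_not_mem hb]
      trivial

theorem Within.subtreeAt {T : PreTree (P.lab Y)} (h : T.Within B) (A : Set Y) :
    (T.subtreeAt A).Within B := by
  induction T with
  | edge i => trivial
  | node b ch ih =>
    unfold PreTree.subtreeAt
    split_ifs
    · exact h
    · exact ih _ (h.2 _)
    · trivial

theorem Within.kern {T : PreTree (P.lab Y)} (h : T.Within B) (A : Set Y) :
    (T.kern A).Within B := (h.subtreeAt A).prune A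

theorem Within.inter {T : PreTree (P.lab Y)} (hA : T.Within A) (hB : T.Within B) :
    T.Within (A ∩ B) := by
  induction T with
  | edge i => trivial
  | node b ch ih => exact ⟨⟨hA.1, hB.1⟩, fun e => ih e (hA.2 e) (hB.2 e)⟩

theorem within_iff {T : PreTree (P.lab Y)} : T.Within A ↔ ∀ n, (T.dec n).2 ∈ A := by
  induction T with
  | edge i => exact ⟨fun _ n => n.elim, fun _ => trivial⟩
  | node b ch ih =>
    constructor
    · intro h n
      match n with
      | none => exact h.1
      | some ⟨e, n⟩ => exact (ih e).1 (h.2 e) n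
    · exact fun h => ⟨h none, fun e => (ih e).2 fun n => h (some ⟨e, n⟩)⟩

/-- If no label occurs twice, a single node is a connected part. -/
theorem conn_singleton (T : PreTree (P.lab Y)) (v : T.Valid)
    (hT : Function.Injective fun n => (T.dec n).2) (n : T.Node) :
    T.Conn {(T.dec n).2} ∧
      T.kern {(T.dec n).2} = node (T.dec n) fun e => edge ((P.lab Y).src _ e) := by
  induction T with
  | edge i => exact n.elim
  | node b ch ih =>
    have hs : ∀ e, Function.Injective fun n => ((ch e).dec n).2 := fun e n m h =>
      eq_of_heq (Sigma.mk.inj (Option.some.inj (hT (a₁ := some ⟨e, n⟩) (a₂ := some ⟨e, m⟩) h))).2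
    match n with
    | none =>
      change (node b ch).Conn {b.2} ∧ (node b ch).kern {b.2} = node b _
      have hc : ∀ e, ¬ (ch e).Meets {b.2} := fun e h => by
        obtain ⟨m, hm⟩ := (meets_iff _).1 h
        exact Option.some_ne_none _ (hT (a₁ := some ⟨e, m⟩) (a₂ := none) hm)
      refine ⟨.inl ⟨rfl, fun e => atRoot_of_not_meets (hc e)⟩, ?_⟩
      rw [kern_of_mem (Set.mem_singleton _)]
      refine congrArg (node b) (funext fun e => ?_)
      rw [prune_of_not_meets (hc e), (v e).1]
      rfl
    | some ⟨e, n⟩ =>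
      obtain ⟨h1, h2⟩ := ih e (v e).2 (hs e) n
      change (node b ch).Conn {((ch e).dec n).2} ∧ (node b ch).kern {((ch e).dec n).2} = _
      have hb : b.2 ∉ ({((ch e).dec n).2} : Set Y) := fun h =>
        Option.some_ne_none _ (hT (a₁ := none) (a₂ := some ⟨e, n⟩) h).symm
      have hc : ∀ e', e' ≠ e → ¬ (ch e').Meets {((ch e).dec n).2} := fun e' he h => by
        obtain ⟨m, hm⟩ := (meets_iff _).1 h
        exact he (Sigma.mk.inj (Option.some.inj
          (hT (a₁ := some ⟨e', m⟩) (a₂ := some ⟨e, n⟩) hm))).1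
      refine ⟨.inr ⟨hb, e, h1, hc⟩, ?_⟩
      rw [kern_of_child hb e h1.meets hc]
      exact h2

/-- If the part cut out by one label is a single node, neither a node above it nor a node in another
branch has that label. This is how the names in an expansion are shown to be distinct. -/
theorem eq_of_kern_singleton (T : PreTree (P.lab Y)) (y : Y) (hc : T.Conn {y})
    (b : (P.lab Y).Op) (i : (P.lab Y).Ar b → I) (hk : T.kern {y} = node b fun e => edge (i e))
    (n m : T.Node) (hn : (T.dec n).2 = y) (hm : (T.dec m).2 = y) : n = m := by
  induction T with
  | edge i => exact n.elim
  | node b' ch ih =>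
    rcases hc with ⟨hb, h⟩ | ⟨hb, e, h, h'⟩
    · rw [kern_of_mem hb] at hk
      have hno : ∀ e, ¬ (ch e).Meets {y} := by
        obtain ⟨rfl, hk⟩ := PreTree.node.inj hk
        exact fun e => not_meets_of_prune_eq_edge (h e) (i e) (congrFun (eq_of_heq hk) e)
      have : ∀ n, ((node b' ch).dec n).2 = y → n = none := fun n hn => match n with
        | none => rfl
        | some ⟨e, n⟩ => absurd ((meets_iff _).2 ⟨n, hn⟩) (hno e)
      exact (this n hn).trans (this m hm).symm
    · rw [kern_of_child hb e h.meets h'] at hk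
      have : ∀ n, ((node b' ch).dec n).2 = y → ∃ k : (ch e).Node, n = some ⟨e, k⟩ ∧
          ((ch e).dec k).2 = y := fun n hn => match n with
        | none => absurd hn hb
        | some ⟨e', n⟩ => by
          by_cases he : e' = e
          · subst he
            exact ⟨n, rfl, hn⟩
          · exact absurd ((meets_iff _).2 ⟨n, hn⟩) (h' e' he)
      obtain ⟨k, rfl, hk1⟩ := this n hn
      obtain ⟨k', rfl, hk2⟩ := this m hm
      rw [ih e h hk k k' hk1 hk2]

/-- Forgetting the labels does not change the nodes. -/
def nodeForget : (T : PreTree (P.lab Y)) → T.Node ≃ T.forget.Node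
  | edge _ => Equiv.refl _
  | node b ch => Equiv.optionCongr (Equiv.sigmaCongrRight
      (β₂ := fun e : P.Ar b.1 => (ch e).forget.Node) fun e => (ch e).nodeForget)

theorem dec_nodeForget (T : PreTree (P.lab Y)) (n : T.Node) :
    T.dec n = (T.forget.dec (T.nodeForget n), T.nodeLab (T.nodeForget n)) := by
  induction T with
  | edge i => exact n.elim
  | node b ch ih =>
    match n with
    | none => rfl
    | some ⟨e, n⟩ => exact ih e n

theorem meets_iff_nodeLab (T : PreTree (P.lab Y)) : T.Meets A ↔ ∃ n, T.nodeLab n ∈ A := by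
  rw [meets_iff, ← T.nodeForget.exists_congr_right]
  simp only [dec_nodeForget]

end PolyEndo.PreTree

/-! ### The order on a nesting -/

namespace RTree

theorem le_inr {N : RTree} {v : N.Elt} {l : Fin N.leaves} (h : N.Le v (.inr l)) :
    v = .inr l := by
  rcases Relation.ReflTransGen.cases_tail h with h | ⟨w, -, x, hx, -⟩
  · exact h.symm
  · cases hx

theorem le_inl_iff {N : RTree} {v : N.Elt} {x : Fin N.dots} :
    N.Le v (.inl x) ↔ v = .inl x ∨ ∃ y, N.parent y = some x ∧ N.Le v y := by
  constructor
  · intro h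
    rcases Relation.ReflTransGen.cases_tail h with h | ⟨w, h, x', hx, hw⟩
    · exact .inl h.symm
    · cases hx
      exact .inr ⟨w, hw, h⟩
  · rintro (rfl | ⟨y, hy, h⟩)
    · exact .refl
    · exact h.tail ⟨x, rfl, hy⟩

theorem elt_induction {N : RTree} {p : N.Elt → Prop} (h0 : ∀ l, p (.inr l))
    (h1 : ∀ x, (∀ y, N.parent y = some x → p y) → p (.inl x)) (v : N.Elt) : p v := by
  rcases v with x | l
  · induction x using N.acyclic.induction with
    | _ x ih =>
      refine h1 x fun y hy => ?_
      rcases y with y | l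
      · exact ih y hy
      · exact h0 l
  · exact h0 l

theorem parent_root (N : RTree) : N.parent N.root = none := N.existsUnique_root.choose_spec.1

theorem eq_root {N : RTree} {v : N.Elt} (h : N.parent v = none) : v = N.root :=
  N.existsUnique_root.choose_spec.2 v h

/-- The axiom `acyclic` supports induction from children to parents. Reaching the root needs the
opposite direction, which is well-founded because the set of dots is finite. -/
theorem le_root (N : RTree) (v : N.Elt) : N.Le v N.root := by
  have hT : WellFounded (Relation.TransGen fun x y : Fin N.dots => N.parent (.inl x) = some y) :=
    N.acyclic.transGen
  have hirr := hT.irrefl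
  have hw : WellFounded (fun y x : Fin N.dots =>
      Relation.TransGen (fun x y : Fin N.dots => N.parent (.inl x) = some y) x y) := by
    have : IsTrans (Fin N.dots) (fun y x : Fin N.dots =>
      Relation.TransGen (fun x y : Fin N.dots => N.parent (.inl x) = some y) x y) :=
        ⟨fun a b c h1 h2 => h2.trans h1⟩
    have : Std.Irrefl (fun y x : Fin N.dots =>
      Relation.TransGen (fun x y : Fin N.dots => N.parent (.inl x) = some y) x y) :=
        ⟨fun a => hirr.irrefl a⟩
    exact Finite.wellFounded_of_trans_of_irrefl _
  have key : ∀ x : Fin N.dots, N.Le (.inl x) N.root := by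
    intro x
    induction x using hw.induction with
    | _ x ih =>
      cases h : N.parent (.inl x) with
      | none => rw [eq_root h]; exact .refl
      | some y => exact .head ⟨y, rfl, h⟩ (ih y (.single h))
  cases h : N.parent v with
  | none => rw [eq_root h]; exact .refl
  | some y => exact .head ⟨y, rfl, h⟩ (key y)

end RTree

/-! ### The layers of a constellation -/

namespace PolyMonad

open PolyEndo PreTree

variable {I : Type u} {P : PolyMonad I} {Y Z D L : Type}

/-- A node of the contracted tree is created only by `Part.pick`, with the colour of a node of the
original tree as label. -/
theorem within_contractAux (c : Y → Option Z) (T : (P.toPolyEndo.lab Y).PreTree) (v : T.Valid)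
    (i : I) (h : T.root = i) :
    (∀ z e, (((P.contractAux c T v i h).1 z).ch e).1.Within {z | ∃ y, c y = some z}) ∧
    (P.contractAux c T v i h).2.1.Within {z | ∃ y, c y = some z} := by
  induction T generalizing i with
  | edge j => exact ⟨fun _ _ => trivial, trivial⟩
  | node b ch ih =>
    subst h
    let X : Z → P.Part Z (P.tgt b.1) := fun z =>
      Part.comp b.1 fun e => (P.contractAux c (ch e) (v e).2 (P.src b.1 e) (v e).1).1 z
    have hX : ∀ z e, ((X z).ch e).1.Within {z | ∃ y, c y = some z} := fun z e =>
      (ih _ _ _ _).1 z _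
    have key : ∀ o, c b.2 = o →
        (∀ z e, ((Part.select o X z).ch e).1.Within {z | ∃ y, c y = some z}) ∧
        (Part.pick o X).1.Within {z | ∃ y, c y = some z} := by
      intro o ho
      have hp : (Part.pick o X).1.Within {z | ∃ y, c y = some z} := by
        cases o with
        | none => trivial
        | some z => exact ⟨⟨_, ho⟩, fun e => hX z e⟩
      refine ⟨fun z => ?_, hp⟩
      by_cases hz : o = some z
      · rw [show Part.select o X z = X z from if_pos hz]
        exact hX z
      · rw [show Part.select o X z = Part.hang (Part.pick o X) from if_neg hz]
        exact fun e => hp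
    exact key _ rfl

theorem blow_eq_lsub (T : P.PTree) (v : T.Valid) (y : Y) (F : T.Node → P.VTree Y)
    (h : ∀ n, (F n).op = T.dec n) (n : T.Node) : (blow T v y F h).1 = lsub T F h := by
  cases T with
  | edge i => exact n.elim
  | node b ch => rfl

/-- The subdivided tree of a constellation, labelled by the elements of the nesting. -/
def filled (C : P.Constel) : P.VTree C.nest.Elt :=
  ⟨P.fillWhite C.tree.1, (P.valid_fillWhite _ C.tree.2).1⟩

/-- The elements below `v`. -/
def below (C : P.Constel) (v : C.nest.Elt) : Set C.nest.Elt := {w | C.nest.Le w v}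

/-- The part of the subdivided tree that is contained in `v`. -/
noncomputable def inside (C : P.Constel) (v : C.nest.Elt) : P.VTree C.nest.Elt :=
  ⟨(filled C).1.kern (below C v), valid_kern _ _ (filled C).2⟩

theorem label_injective (C : P.Constel) :
    Function.Injective fun n => ((filled C).1.dec n).2 := by
  intro n m h
  obtain ⟨n, rfl⟩ := (P.fillNode C.tree.1).surjective n
  obtain ⟨m, rfl⟩ := (P.fillNode C.tree.1).surjective m
  rw [C.name_injective ((P.label_fillNode _ _).symm.trans (h.trans (P.label_fillNode _ _)))]

theorem below_inr (C : P.Constel) (l : Fin C.nest.leaves) : below C (.inr l) = {.inr l} :=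
  Set.ext fun _ => ⟨fun h => RTree.le_inr h, fun h => h ▸ .refl⟩

theorem below_null (C : P.Constel) (x : Fin C.nest.dots) (hx : C.nest.IsNull x) :
    below C (.inl x) = {.inl x} :=
  Set.ext fun _ => ⟨fun h => (RTree.le_inl_iff.1 h).elim id fun ⟨y, hy, _⟩ => absurd hy (hx y),
    fun h => h ▸ .refl⟩

theorem inside_leaf (C : P.Constel) (n : C.tree.1.Node) (b : P.Op) (l : Fin C.nest.leaves)
    (h : C.tree.1.dec n = .inl (b, l)) :
    (filled C).1.Conn (below C (.inr l)) ∧ inside C (.inr l) = lcorolla b (.inr l) := by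
  have h1 := conn_singleton (filled C).1 (filled C).2 (label_injective C) (P.fillNode _ n)
  have h2 : (filled C).1.dec (P.fillNode _ n) = (b, .inr l) := P.dec_fillNode _ n b l h
  rw [h2] at h1
  rw [below_inr]
  refine ⟨h1.1, Subtype.ext ?_⟩
  change (filled C).1.kern (below C _) = _
  rw [below_inr]
  exact h1.2

theorem exists_black (C : P.Constel) (l : Fin C.nest.leaves) :
    ∃ n b, C.tree.1.dec n = .inl (b, l) := by
  obtain ⟨n, hn⟩ := C.leaf_named l
  refine ⟨n, ?_⟩
  unfold name at hn
  rcases h : C.tree.1.dec n with b | i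
  · rw [h] at hn
    obtain rfl := Sum.inr.inj hn
    exact ⟨b.1, rfl⟩
  · rw [h] at hn
    cases hn

theorem inside_null (C : P.Constel) (x : Fin C.nest.dots) (hx : C.nest.IsNull x) :
    ∃ i, inside C (.inl x) = lcorolla (P.one i) (.inl x) := by
  obtain ⟨n, hn⟩ := (C.dot_named x).2 hx
  obtain ⟨i, hi⟩ := P.dec_fillNode_white _ n x hn
  have h1 := conn_singleton (filled C).1 (filled C).2 (label_injective C) (P.fillNode _ n)
  have h2 : (filled C).1.dec (P.fillNode _ n) = (P.one i, .inl x) := hi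
  rw [h2] at h1
  refine ⟨i, Subtype.ext ?_⟩
  change (filled C).1.kern (below C _) = _
  rw [below_null C x hx]
  exact h1.2

/-- For a sphere this is the kernel rule; a leaf of the nesting names a single black dot. -/
theorem conn_below (C : P.Constel) (v : C.nest.Elt) : (filled C).1.Conn (below C v) := by
  rcases v with x | l
  · exact (P.isKernel_iff_conn C.tree.1 (below C (.inl x))).1 (C.kernel_rule x)
  · obtain ⟨n, b, h⟩ := exists_black C l
    exact (inside_leaf C n b l h).1

/-- The layer is defined by contracting everything above the bottom of the sphere. Dots outside the
sphere lie under no child of `x`, so they have no colour and may be cut off beforehand. -/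
theorem layerLab_eq (C : P.Constel) (x : Fin C.nest.dots) :
    layerLab C x = P.contract (C.nest.childAbove x) (inside C (.inl x)).1 (inside C (.inl x)).2 := by
  refine (P.contract_prune _ (below C (.inl x)) (fun y z h => ?_) _ _ _).symm
  obtain ⟨h1, h2⟩ := (C.nest.childAbove_eq_some x y z).1 h
  exact RTree.le_inl_iff.2 (.inr ⟨z, h1, h2⟩)

theorem below_subset (C : P.Constel) {x : Fin C.nest.dots} {y : C.nest.Elt}
    (h : C.nest.parent y = some x) : below C y ⊆ below C (.inl x) :=
  fun _ hw => RTree.le_inl_iff.2 (.inr ⟨y, h, hw⟩)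

theorem layerLab_null (C : P.Constel) (x : Fin C.nest.dots) (hx : C.nest.IsNull x) :
    ∃ i, layerLab C x = edge i ∧ inside C (.inl x) = lcorolla (P.one i) (.inl x) := by
  obtain ⟨i, hi⟩ := inside_null C x hx
  refine ⟨i, ?_, hi⟩
  rw [layerLab_eq, P.contract_congr _ (congrArg Subtype.val hi) _ (lcorolla _ _).2]
  have hc : C.nest.childAbove x (.inl x) = none := Option.eq_none_iff_forall_ne_some.2 fun z hz =>
    hx z ((C.nest.childAbove_eq_some x _ z).1 hz).1
  have key : ∀ (o : Option C.nest.Elt) (_ : o = none) (X : C.nest.Elt → P.Part C.nest.Elt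
      (P.tgt (P.one i))), (Part.pick o X).1 = edge i := by
    rintro _ rfl X
    exact congrArg edge (P.tgt_one i)
  exact key _ hc _

/-- Colour each dot by the child of `x` whose sphere contains it. The colour classes are the spheres
of the children, which are connected, so `isLsub_contract` applies. -/
theorem isLsub_layer (C : P.Constel) (x : Fin C.nest.dots) (hx : ¬ C.nest.IsNull x) :
    IsLsub (inside C) (layerLab C x) (inside C (.inl x)).1 := by
  have hcol : ∀ y z, C.nest.childAbove x y = some z ↔ C.nest.parent z = some x ∧ y ∈ below C z :=
    fun y z => C.nest.childAbove_eq_some x y z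
  rw [layerLab_eq]
  refine isLsub_contract _ _ _ _ ?_ fun z hz => ?_
  · have h1 : (filled C).1.Within {y | ∃ n, C.tree.1.name n = y} := within_iff.2 fun n => by
      obtain ⟨n, rfl⟩ := (P.fillNode C.tree.1).surjective n
      exact ⟨n, (P.label_fillNode _ n).symm⟩
    -- The name of a dot inside `x` is strictly below `x`, since `x` itself names a dot only when it
    -- is null; so every dot here has a colour.
    refine ((within_kern (below C (.inl x)) _).inter (h1.kern _)).mono ?_
    rintro y ⟨hy, hn⟩
    rcases RTree.le_inl_iff.1 hy with rfl | ⟨z, hz, hyz⟩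
    · exact absurd ((C.dot_named x).1 hn) hx
    · exact Option.isSome_iff_exists.2 ⟨z, (hcol y z).2 ⟨hz, hyz⟩⟩
  · obtain ⟨n, hn⟩ := (meets_iff _).1 hz
    have hz := ((hcol _ z).1 hn).1
    have : {y | C.nest.childAbove x y = some z} = below C z :=
      Set.ext fun y => (hcol y z).trans (and_iff_right hz)
    rw [this]
    exact ⟨(conn_kern (below_subset C hz) (conn_below C _)).2 (conn_below C z),
      kern_kern (below_subset C hz) (conn_below C _) (conn_below C z)⟩

theorem parent_nodeLab (C : P.Constel) (x : Fin C.nest.dots) (n : (layerLab C x).forget.Node) :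
    C.nest.parent ((layerLab C x).nodeLab n) = some x := by
  have h := (within_contractAux (C.nest.childAbove x) (inside C (.inl x)).1 (inside C (.inl x)).2 _
    rfl).2
  have h' : (layerLab C x).Within {z | ∃ y, C.nest.childAbove x y = some z} := by
    rw [layerLab_eq]
    exact h
  obtain ⟨m, rfl⟩ := (layerLab C x).nodeForget.surjective n
  obtain ⟨y, hy⟩ := within_iff.1 h' m
  rw [dec_nodeForget] at hy
  exact ((C.nest.childAbove_eq_some x y _).1 hy).1

theorem exists_label_le (C : P.Constel) (v : C.nest.Elt) : ∃ n, ((filled C).1.dec n).2 ∈ below C v :=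
  (meets_iff _).1 (conn_below C v).meets

/-- The part inside the child `y` contains a dot. This dot lies inside `x`, hence in one of the
parts substituted into the layer, and it lies under only one child of `x`. -/
theorem exists_nodeLab_of_parent (C : P.Constel) (x : Fin C.nest.dots) (y : C.nest.Elt)
    (hy : C.nest.parent y = some x) : ∃ n, (layerLab C x).nodeLab n = y := by
  obtain ⟨h, hW⟩ := isLsub_layer C x fun hx => hx y hy
  obtain ⟨m, hm⟩ := exists_label_le C y
  have hc := (conn_singleton (filled C).1 (filled C).2 (label_injective C) m).1
  have h1 : (inside C (.inl x)).1.Conn {((filled C).1.dec m).2} :=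
    (conn_kern (Set.singleton_subset_iff.2 (below_subset C hy hm)) (conn_below C _)).2 hc
  by_contra hn
  push Not at hn
  refine lsub_not_meets {((filled C).1.dec m).2} _ _ h (fun n => ?_) (hW ▸ h1.meets)
  refine (within_kern (below C ((layerLab C x).nodeLab n)) (filled C).1).not_meets
    (Set.disjoint_singleton_right.2 fun hle => hn n ?_)
  exact C.nest.child_unique x _ _ _ (parent_nodeLab C x n) hy hle hm

theorem parent_iff (C : P.Constel) (x : Fin C.nest.dots) (y : C.nest.Elt) :
    C.nest.parent y = some x ↔ ∃ n, (layerLab C x).nodeLab n = y := by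
  refine ⟨exists_nodeLab_of_parent C x y, ?_⟩
  rintro ⟨n, rfl⟩
  exact parent_nodeLab C x n

/-- Two nodes with the same label would have the same part substituted into them, and any dot of
that part would occur twice, although the names are distinct. -/
theorem nodeLab_injective (C : P.Constel) (x : Fin C.nest.dots) :
    Function.Injective (layerLab C x).nodeLab := by
  intro n m hnm
  have hx : ¬ C.nest.IsNull x := fun hx => hx _ (parent_nodeLab C x n)
  obtain ⟨h, hW⟩ := isLsub_layer C x hx
  obtain ⟨k, hk⟩ := exists_label_le C ((layerLab C x).nodeLab n)
  obtain ⟨hc, hker⟩ := conn_singleton (filled C).1 (filled C).2 (label_injective C) k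
  have hsub : ({((filled C).1.dec k).2} : Set C.nest.Elt) ⊆ below C ((layerLab C x).nodeLab n) :=
    Set.singleton_subset_iff.2 hk
  have hsub' := hsub.trans (below_subset C (parent_nodeLab C x n))
  have h1 : (inside C (.inl x)).1.Conn {((filled C).1.dec k).2} :=
    (conn_kern hsub' (conn_below C _)).2 hc
  have h2 : (inside C (.inl x)).1.kern {((filled C).1.dec k).2} = _ :=
    (kern_kern hsub' (conn_below C _) hc).trans hker
  have h3 : (inside C ((layerLab C x).nodeLab n)).1.Meets {((filled C).1.dec k).2} :=
    ((conn_kern hsub (conn_below C _)).2 hc).meets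
  obtain ⟨q, hq⟩ := (meets_iff_nodeLab _).1 h3
  have h4 : (inside C ((layerLab C x).nodeLab m)).1.Meets {((filled C).1.dec k).2} := hnm ▸ h3
  obtain ⟨q', hq'⟩ := (meets_iff_nodeLab _).1 h4
  let F : (layerLab C x).forget.Node → P.VTree C.nest.Elt := fun n => inside C ((layerLab C x).nodeLab n)
  have hW' : (inside C (.inl x)).1 = _ := hW.trans (lsub_eq_mkLab _ F h)
  obtain ⟨r, hr⟩ := (P.substNode_bijective (layerLab C x).forget (fun n => (F n).tree) h).2 ⟨n, q⟩
  obtain ⟨r', hr'⟩ := (P.substNode_bijective (layerLab C x).forget (fun n => (F n).tree) h).2 ⟨m, q'⟩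
  -- The label of the chosen dot `k` cuts a single node out of the sphere, so it occurs only once
  -- there; the occurrences `r` and `r'` coming from the nodes `n` and `m` coincide.
  have key : ∀ (T : P.PTree) (a : T.Node → C.nest.Elt) (_ : (inside C (.inl x)).1 = T.mkLab a)
      (r r' : T.Node), a r = ((filled C).1.dec k).2 → a r' = ((filled C).1.dec k).2 → r = r' := by
    intro T a hT
    have := mkLab_sigma_eq ((mkLab_nodeLab _).trans hT)
    obtain ⟨rfl, ha⟩ := Sigma.mk.inj this
    obtain rfl := eq_of_heq ha
    intro r r' hr hr'
    obtain ⟨r, rfl⟩ := (inside C (.inl x)).1.nodeForget.surjective r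
    obtain ⟨r', rfl⟩ := (inside C (.inl x)).1.nodeForget.surjective r'
    rw [eq_of_kern_singleton _ _ h1 _ _ h2 r r' (by rw [dec_nodeForget]; exact hr)
      (by rw [dec_nodeForget]; exact hr')]
  have hrr := key _ _ hW' r r' (by rw [hr]; exact hq) (by rw [hr']; exact hq')
  rw [hrr, hr'] at hr
  exact (Sigma.mk.inj hr).1.symm

/-- The part of the tree contained in a sphere is obtained from the tree seen in the layer by
substituting the parts contained in the children. -/
theorem inside_eq_blow (C : P.Constel) (x : Fin C.nest.dots) :
    ∃ h : ∀ n, (inside C ((layerLab C x).nodeLab n)).op = (layerLab C x).forget.dec n,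
      inside C (.inl x) = blow (layerTree C x).1 (layerTree C x).2 (.inl x)
        (fun n => inside C ((layerLab C x).nodeLab n)) h := by
  by_cases hx : C.nest.IsNull x
  · obtain ⟨i, h1, h2⟩ := layerLab_null C x hx
    refine ⟨fun n => absurd (parent_nodeLab C x n) (hx _), ?_⟩
    have key : ∀ (T : P.PTree) (v : T.Valid) (_ : T = edge i) (F : T.Node → P.VTree C.nest.Elt)
        (h : ∀ n, (F n).op = T.dec n),
        inside C (.inl x) = blow T v (.inl x) F h := by
      rintro _ v rfl F h
      exact h2
    exact key _ _ (congrArg forget h1) _ _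
  · obtain ⟨h, hW⟩ := isLsub_layer C x hx
    refine ⟨h, Subtype.ext ?_⟩
    have : ∃ y, C.nest.parent y = some x := by
      unfold RTree.IsNull at hx
      push Not at hx
      exact hx
    obtain ⟨y, hy⟩ := this
    obtain ⟨n, -⟩ := (parent_iff C x y).1 hy
    exact hW.trans (blow_eq_lsub _ _ _ _ _ n).symm

end PolyMonad

/-! ### Composition trees: existence and uniqueness -/

namespace PolyMonad

open PolyEndo PreTree

variable {I : Type u} {P : PolyMonad I} {D L D' L' : Type}

/-- The tree decorating a node of `M`, its nodes being labelled by the names of the nodes and leaves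
of `M` sitting on the corresponding inputs. -/
noncomputable def lay : (M : P.plus.PTree) → (M.Node → D) → (M.Leaf → L) → M.Node →
    (P.toPolyEndo.lab (D ⊕ L)).PreTree
  | edge _, _, _, p => p.elim
  | node T ch, d, f, none =>
      T.1.mkLab fun n => rt (ch n) (fun m => d (some ⟨n, m⟩)) fun l => f ⟨n, l⟩
  | node _ ch, d, f, some p => lay (ch p.1) (fun m => d (some ⟨p.1, m⟩)) (fun l => f ⟨p.1, l⟩) p.2

theorem rt_map {D L D' L' : Type*} (M : P.plus.PTree) (d : M.Node → D) (f : M.Leaf → L)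
    (p : D → D') (q : L → L') :
    rt M (p ∘ d) (q ∘ f) = Sum.map p q (rt M d f) := by
  cases M <;> rfl

theorem lay_map (M : P.plus.PTree) (d : M.Node → D) (f : M.Leaf → L) (p : D → D') (q : L → L')
    (n : M.Node) : lay M (p ∘ d) (q ∘ f) n = (lay M d f n).mapLab (Sum.map p q) := by
  induction M with
  | edge b => exact n.elim
  | node T ch ih =>
    match n with
    | none =>
      refine Eq.trans ?_ (mapLab_mkLab _ _ _).symm
      exact congrArg T.1.mkLab (funext fun n => rt_map (ch n) _ _ p q)
    | some ⟨e, n⟩ => exact ih e _ _ n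

theorem forget_lay (M : P.plus.PTree) (d : M.Node → D) (f : M.Leaf → L) (n : M.Node) :
    (lay M d f n).forget = (M.dec n).1 := by
  induction M with
  | edge b => exact n.elim
  | node T ch ih =>
    match n with
    | none => exact forget_mkLab _ _
    | some ⟨e, n⟩ => exact ih e _ _ n

/-- `M` is the composition tree of `C` above some element; `d` and `f` name its nodes and leaves. -/
def Named (C : P.Constel) (M : P.plus.PTree) (d : M.Node → Fin C.nest.dots)
    (f : M.Leaf → Fin C.nest.leaves) : Prop :=
  (∀ p, layerLab C (d p) = lay M d f p) ∧
    ∀ l, ∃ n, C.tree.1.dec n = .inl (M.leafType l, f l)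

/-- The nodes of the layer of a sphere are its children, so the composition trees of the children
can be put on the inputs of that layer. By `inside_eq_blow` the expansion of the result is again the
part of the tree inside the sphere. The statement carries the expansion and the set of names along
because the induction needs them. -/
theorem exists_named (C : P.Constel) (v : C.nest.Elt) :
    ∃ (M : P.plus.PTree) (vM : M.Valid) (d : M.Node → Fin C.nest.dots)
      (f : M.Leaf → Fin C.nest.leaves), Named C M d f ∧ rt M d f = v ∧
        (expand M vM d f).1 = inside C v ∧ Function.Injective (Sum.map d f) ∧
        names d f = below C v := by
  induction v using RTree.elt_induction with
  | h0 l =>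
    obtain ⟨n, b, h⟩ := exists_black C l
    refine ⟨edge b, trivial, fun m => m.elim, fun _ => l, ⟨fun p => p.elim, fun _ => ⟨n, h⟩⟩, rfl,
      (inside_leaf C n b l h).2.symm, ?_, ?_⟩
    · rintro (m | m) (m' | m') h
      · exact m.elim
      · exact m.elim
      · exact m'.elim
      · rfl
    · rw [below_inr]
      refine Set.ext fun w => ⟨?_, fun h => ⟨.inr PUnit.unit, h.symm⟩⟩
      rintro ⟨m | m, rfl⟩
      · exact m.elim
      · rfl
  | h1 x ih =>
    obtain ⟨hop, hblow⟩ := inside_eq_blow C x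
    choose M vM d f hN hrt hexp hinj hnames using
      fun n : (layerTree C x).1.Node => ih _ (parent_nodeLab C x n)
    let M' : P.plus.PTree := node (P := P.plus.toPolyEndo) (layerTree C x) M
    let d' : M'.Node → Fin C.nest.dots := fun o => match o with
      | none => x
      | some m => d m.1 m.2
    let f' : M'.Leaf → Fin C.nest.leaves := fun l => f l.1 l.2
    -- The part inside a child composes to the operation decorating the corresponding node of the
    -- layer; this is the compatibility required of a `P⁺`-tree.
    have hval : M'.Valid := fun n => ⟨(expand (M n) (vM n) (d n) (f n)).2.symm.trans
      ((congrArg VTree.op (hexp n)).trans (hop n)), vM n⟩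
    have hle : ∀ n w, Sum.map (d n) (f n) w ∈ below C ((layerLab C x).nodeLab n) := fun n w =>
      hnames n ▸ ⟨w, rfl⟩
    have hnode : ∀ n m, C.nest.Le (.inl (d n m)) ((layerLab C x).nodeLab n) := fun n m =>
      hle n (.inl m)
    have hleaf : ∀ n m, C.nest.Le (.inr (f n m)) ((layerLab C x).nodeLab n) := fun n m =>
      hle n (.inr m)
    -- An element lies under at most one child of `x`, and different nodes of the layer are
    -- different children; so the names used in different branches are different.
    have huniq : ∀ w n n', C.nest.Le w ((layerLab C x).nodeLab n) →
        C.nest.Le w ((layerLab C x).nodeLab n') → n = n' := fun w n n' h h' =>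
      nodeLab_injective C x (C.nest.child_unique x w _ _ (parent_nodeLab C x n)
        (parent_nodeLab C x n') h h')
    have hx : ∀ n m, x ≠ d n m := by
      intro n m h
      refine C.nest.not_cycle x _ (parent_nodeLab C x n) ?_
      have := hnode n m
      rwa [← h] at this
    refine ⟨M', hval, d', f', ⟨fun p => ?_, fun l => (hN l.1).2 l.2⟩, rfl, ?_, ?_, ?_⟩
    · match p with
      | none =>
        refine (mkLab_nodeLab (layerLab C x)).symm.trans ?_
        exact congrArg (layerTree C x).1.mkLab (funext fun n => (hrt n).symm)
      | some ⟨n, p⟩ => exact (hN n).1 p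
    · refine Eq.trans ?_ hblow.symm
      have key : ∀ (F F' : (layerTree C x).1.Node → P.VTree C.nest.Elt) (_ : F = F')
          (h : ∀ n, (F n).op = (layerTree C x).1.dec n)
          (h' : ∀ n, (F' n).op = (layerTree C x).1.dec n),
          blow (layerTree C x).1 (layerTree C x).2 (Sum.inl x) F h =
            blow (layerTree C x).1 (layerTree C x).2 (.inl x) F' h' := by
        rintro F _ rfl h h'
        rfl
      exact key _ _ (funext hexp) _ _
    · have hd : Function.Injective d' := by
        intro m m' h
        match m, m' with
        | none, none => rfl
        | none, some ⟨n, m⟩ => exact absurd h (hx n m)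
        | some ⟨n, m⟩, none => exact absurd h.symm (hx n m)
        | some ⟨n, m⟩, some ⟨n', m'⟩ =>
          have h : d n m = d n' m' := h
          obtain rfl := huniq _ n n' (hnode n m) (h ▸ hnode n' m')
          rw [Sum.inl.inj (hinj n (a₁ := .inl m) (a₂ := .inl m') (congrArg Sum.inl h))]
      have hf : Function.Injective f' := by
        rintro ⟨n, m⟩ ⟨n', m'⟩ h
        have h : f n m = f n' m' := h
        obtain rfl := huniq _ n n' (hleaf n m) (h ▸ hleaf n' m')
        rw [Sum.inr.inj (hinj n (a₁ := .inr m) (a₂ := .inr m') (congrArg Sum.inr h))]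
      exact hd.sumMap hf
    · refine Set.ext fun w => ⟨?_, fun hw => ?_⟩
      · rintro ⟨m | m, rfl⟩
        · match m with
          | none => exact .refl
          | some ⟨n, m⟩ => exact below_subset C (parent_nodeLab C x n) (hnode n m)
        · exact below_subset C (parent_nodeLab C x m.1) (hleaf m.1 m.2)
      · rcases RTree.le_inl_iff.1 hw with rfl | ⟨y, hy, hwy⟩
        · exact ⟨.inl none, rfl⟩
        · obtain ⟨n, rfl⟩ := (parent_iff C x y).1 hy
          have : w ∈ names (d n) (f n) := hnames n ▸ hwy
          obtain ⟨m | m, rfl⟩ := this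
          · exact ⟨.inl (some ⟨n, m⟩), rfl⟩
          · exact ⟨.inr ⟨n, m⟩, rfl⟩

/-- `M` is the composition tree of `C`; `d` and `f` match its nodes and leaves with the dots and
leaves of the nesting. -/
structure Pres (C : P.Constel) (M : P.plus.toPolyEndo.Tree) (d : M.1.Node ≃ Fin C.nest.dots)
    (f : M.1.Leaf ≃ Fin C.nest.leaves) : Prop where
  named : Named C M.1 d f
  rt_eq : rt M.1 d f = C.nest.root
  expand_eq : (expand M.1 M.2 d f).1 = filled C

theorem inside_root (C : P.Constel) : inside C C.nest.root = filled C := by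
  refine Subtype.ext ?_
  have h : below C C.nest.root = Set.univ := Set.eq_univ_of_forall fun v => C.nest.le_root v
  change (filled C).1.kern (below C C.nest.root) = (filled C).1
  have hc := conn_below C C.nest.root
  have hw : ∀ T : (P.toPolyEndo.lab C.nest.Elt).PreTree, T.Within Set.univ := fun T =>
    within_iff.2 fun _ => trivial
  rw [h] at hc ⊢
  revert hc
  cases h : (filled C).1 with
  | edge i => exact False.elim
  | node b ch => exact fun _ => (hw _).kern_node

/-- Everything lies below the root, so there the injective naming of `exists_named` is onto as well.
-/
theorem exists_pres (C : P.Constel) : ∃ M d f, Pres C M d f := by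
  obtain ⟨M, vM, d, f, h1, h2, h3, h4, h5⟩ := exists_named C C.nest.root
  have hs : Function.Surjective (Sum.map d f) := fun w =>
    (h5 ▸ C.nest.le_root w : w ∈ names d f)
  have hd : Function.Bijective d := ⟨fun m m' h => Sum.inl.inj (h4 (a₁ := .inl m) (a₂ := .inl m')
    (congrArg Sum.inl h)), fun x => by
      obtain ⟨m | m, hm⟩ := hs (.inl x)
      · exact ⟨m, Sum.inl.inj hm⟩
      · cases hm⟩
  have hf : Function.Bijective f := ⟨fun m m' h => Sum.inr.inj (h4 (a₁ := .inr m) (a₂ := .inr m')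
    (congrArg Sum.inr h)), fun x => by
      obtain ⟨m | m, hm⟩ := hs (.inr x)
      · cases hm
      · exact ⟨m, Sum.inr.inj hm⟩⟩
  exact ⟨⟨M, vM⟩, .ofBijective d hd, .ofBijective f hf, h1, h2, h3.trans (inside_root C)⟩

/-- The name of the root determines the layer, and the layer determines the decoration and the names
of the roots of the branches. The recursion ends at leaves, whose names determine black dots and
hence their operations. -/
theorem Named.unique {C : P.Constel} {M M' : P.plus.PTree} {d : M.Node → Fin C.nest.dots}
    {f : M.Leaf → Fin C.nest.leaves} {d' : M'.Node → Fin C.nest.dots}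
    {f' : M'.Leaf → Fin C.nest.leaves} (h : Named C M d f) (h' : Named C M' d' f')
    (hr : rt M d f = rt M' d' f') :
    (⟨M, d, f⟩ : Σ M : P.plus.PTree, (M.Node → Fin C.nest.dots) × (M.Leaf → Fin C.nest.leaves)) =
      ⟨M', d', f'⟩ := by
  induction M generalizing M' with
  | edge b =>
    cases M' with
    | node T ch => cases hr
    | edge b' =>
      obtain ⟨n, hn⟩ := h.2 PUnit.unit
      obtain ⟨n', hn'⟩ := h'.2 PUnit.unit
      have hf : f PUnit.unit = f' PUnit.unit := Sum.inr.inj hr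
      have hnn : n = n' := by
        apply C.name_injective
        unfold name
        rw [hn, hn']
        exact congrArg Sum.inr hf
      rw [hnn, hn'] at hn
      obtain rfl : b' = b := (Prod.mk.inj (Sum.inl.inj hn)).1
      have h1 : d = d' := funext fun m => m.elim
      have h2 : f = f' := funext fun _ => hf
      rw [h1, h2]
  | node T ch ih =>
    cases M' with
    | edge b => cases hr
    | node T' ch' =>
      have hd : d none = d' none := Sum.inl.inj hr
      have h1 : lay _ d f none = lay _ d' f' none := (h.1 none).symm.trans (hd ▸ h'.1 none)
      obtain ⟨h2, h3⟩ := Sigma.mk.inj (mkLab_sigma_eq h1)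
      obtain rfl : T = T' := Subtype.ext h2
      have h3 := congrFun (eq_of_heq h3)
      have H := fun n : T.1.Node => ih n (M' := ch' n) (d := fun m => d (some ⟨n, m⟩))
        (f := fun l => f ⟨n, l⟩) (d' := fun m => d' (some ⟨n, m⟩)) (f' := fun l => f' ⟨n, l⟩)
        ⟨fun p => h.1 (some ⟨n, p⟩), fun l => h.2 ⟨n, l⟩⟩
        ⟨fun p => h'.1 (some ⟨n, p⟩), fun l => h'.2 ⟨n, l⟩⟩ (h3 n)
      obtain rfl : ch = ch' := funext fun n => (Sigma.mk.inj (H n)).1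
      have H := fun n => Prod.mk.inj (eq_of_heq (Sigma.mk.inj (H n)).2)
      have h4 : d = d' := funext fun o => match o with
        | none => hd
        | some ⟨n, m⟩ => congrFun (H n).1 m
      have h5 : f = f' := funext fun l => congrFun (H l.1).2 l.2
      rw [h4, h5]

theorem Pres.unique {C : P.Constel} {M M' : P.plus.toPolyEndo.Tree}
    {d : M.1.Node ≃ Fin C.nest.dots} {f : M.1.Leaf ≃ Fin C.nest.leaves}
    {d' : M'.1.Node ≃ Fin C.nest.dots} {f' : M'.1.Leaf ≃ Fin C.nest.leaves}
    (h : Pres C M d f) (h' : Pres C M' d' f') :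
    (⟨M, d.symm⟩ : Σ M : P.plus.toPolyEndo.Tree, (Fin C.nest.dots → M.1.Node)) = ⟨M', d'.symm⟩ := by
  have := h.named.unique h'.named (h.rt_eq.trans h'.rt_eq.symm)
  obtain ⟨M, vM⟩ := M
  obtain ⟨M', vM'⟩ := M'
  obtain ⟨h1, h2⟩ := Sigma.mk.inj this
  dsimp only at h1
  subst h1
  have h3 := (Prod.mk.inj (eq_of_heq h2)).1
  rw [DFunLike.coe_injective h3]

/-- Constellations with the same composition tree are isomorphic. -/
theorem Pres.exists_iso {C C' : P.Constel} {M : P.plus.toPolyEndo.Tree}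
    {d : M.1.Node ≃ Fin C.nest.dots} {f : M.1.Leaf ≃ Fin C.nest.leaves}
    {d' : M.1.Node ≃ Fin C'.nest.dots} {f' : M.1.Leaf ≃ Fin C'.nest.leaves}
    (h : Pres C M d f) (h' : Pres C' M d' f') :
    ∃ φ : Constellation.Iso C C', ∀ x, φ.dot x = d' (d.symm x) := by
  let p := d.symm.trans d'
  let q := f.symm.trans f'
  have hd : (d' : M.1.Node → _) = p ∘ d := funext fun m => by simp [p]
  have hf : (f' : M.1.Leaf → _) = q ∘ f := funext fun m => by simp [q]
  have hlay : ∀ x, layerLab C' (p x) = (layerLab C x).mapLab (Sum.map p q) := by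
    intro x
    obtain ⟨n, rfl⟩ := d.surjective x
    have h1 := h'.named.1 n
    rw [hd, hf, lay_map, ← h.named.1 n] at h1
    exact h1
  have hinj : Function.Injective (Sum.map p q) := p.injective.sumMap q.injective
  -- The children of a sphere are the labels occurring in its layer, so the nesting can be read off
  -- from the layers, and these correspond by `hlay`.
  have hpar : ∀ v x, C'.nest.parent (Sum.map p q v) = some (p x) ↔ C.nest.parent v = some x := by
    intro v x
    have h1 : ∀ (C : P.Constel) x v, C.nest.parent v = some x ↔ (layerLab C x).Meets {v} :=
      fun C x v => (parent_iff C x v).trans (meets_iff_nodeLab (A := {v}) _).symm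
    have h2 : Sum.map p q ⁻¹' {Sum.map p q v} = {v} := Set.ext fun w => hinj.eq_iff
    rw [h1, h1, hlay, meets_mapLab, h2]
  refine ⟨⟨p, q, fun v => ?_, ?_⟩, fun x => rfl⟩
  · ext y
    obtain ⟨x, rfl⟩ := p.surjective y
    rw [hpar]
    simp
  -- Both filled trees are expansions of the same `M`, with names that differ by `p` and `q`.
  · apply P.fillWhite_injective
    rw [P.fillWhite_rename]
    change (filled C).1.mapLab _ = (filled C').1
    rw [← h.expand_eq, ← h'.expand_eq, hd, hf, expand_map]

theorem exists_dec_rename (p : L → L') (q : D → D') (T : (P.toPolyEndo.subdiv L D).PreTree)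
    (n : T.Node) (b : P.Op) (l : L) (h : T.dec n = .inl (b, l)) :
    ∃ n, (T.rename p q).dec n = .inl (b, p l) := by
  induction T with
  | edge i => exact n.elim
  | node b' ch ih =>
    rcases b' with b' | b'
    · match n with
      | none =>
        obtain rfl := Sum.inl.inj h
        exact ⟨none, rfl⟩
      | some ⟨e, n⟩ =>
        obtain ⟨m, hm⟩ := ih e n h
        exact ⟨some ⟨e, m⟩, hm⟩
    · match n with
      | none => cases h
      | some ⟨e, n⟩ =>
        obtain ⟨m, hm⟩ := ih e n h
        exact ⟨some ⟨e, m⟩, hm⟩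

theorem Pres.map {C C' : P.Constel} {M : P.plus.toPolyEndo.Tree}
    {d : M.1.Node ≃ Fin C.nest.dots} {f : M.1.Leaf ≃ Fin C.nest.leaves}
    (h : Pres C M d f) (φ : Constellation.Iso C C') :
    Pres C' M (d.trans φ.dot) (f.trans φ.leaf) := by
  obtain ⟨M, vM⟩ := M
  refine ⟨⟨fun p => ?_, fun l => ?_⟩, ?_, ?_⟩
  · refine (layerLab_iso φ (d p)).trans ?_
    rw [h.named.1 p]
    exact (lay_map M d f φ.dot φ.leaf p).symm
  · obtain ⟨n, hn⟩ := h.named.2 l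
    have := exists_dec_rename φ.leaf φ.dot C.tree.1 n _ _ hn
    rwa [φ.tree_eq] at this
  · refine (rt_map M d f φ.dot φ.leaf).trans ?_
    rw [h.rt_eq]
    refine RTree.eq_root ?_
    rw [φ.parent_map, RTree.parent_root]
    rfl
  · refine Subtype.ext ((expand_map M vM d f φ.dot φ.leaf).trans ?_)
    rw [h.expand_eq]
    exact ((congrArg P.fillWhite φ.tree_eq).symm.trans (P.fillWhite_rename _ _ _)).symm

end PolyMonad

/-! ### The nesting of a tree, and its subtrees -/

namespace PolyEndo.PreTree

variable {I : Type u} {Q : PolyEndo I}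

theorem finite_leaf (T : PreTree Q) : Finite T.Leaf := by
  induction T with
  | edge i => exact (inferInstance : Finite PUnit.{u+1})
  | node b ch ih =>
    have := Q.finite_ar b
    exact (inferInstance : Finite (Σ e : Q.Ar b, (ch e).Leaf))

/-- The node at the lower end of a leaf, if any. -/
def leafParent : (T : PreTree Q) → T.Leaf → Option T.Node
  | edge _, _ => none
  | node _ ch, l => some (((ch l.1).leafParent l.2).map fun m => ⟨l.1, m⟩)

/-- The node at the lower end of the output edge of a node, or at the lower end of a leaf. -/
def eltParent (T : PreTree Q) : T.Node ⊕ T.Leaf → Option T.Node :=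
  Sum.elim T.parentNode T.leafParent

/-- Elements of a subtree as elements of the whole tree. -/
def incl {b : Q.Op} {ch : Q.Ar b → PreTree Q} (e : Q.Ar b) :
    (ch e).Node ⊕ (ch e).Leaf → (node b ch).Node ⊕ (node b ch).Leaf :=
  Sum.map (fun m => some ⟨e, m⟩) fun l => ⟨e, l⟩

theorem eltParent_incl {b : Q.Op} {ch : Q.Ar b → PreTree Q} (e : Q.Ar b)
    (w : (ch e).Node ⊕ (ch e).Leaf) : (node b ch).eltParent (incl e w) =
      some (((ch e).eltParent w).map fun m => ⟨e, m⟩) := by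
  rcases w with w | w <;> rfl

theorem elt_cases {b : Q.Op} {ch : Q.Ar b → PreTree Q}
    (w : (node b ch).Node ⊕ (node b ch).Leaf) : w = .inl none ∨ ∃ e w', w = incl e w' := by
  match w with
  | .inl none => exact .inl rfl
  | .inl (some ⟨e, m⟩) => exact .inr ⟨e, .inl m, rfl⟩
  | .inr ⟨e, m⟩ => exact .inr ⟨e, .inr m, rfl⟩

theorem eltParent_eq_none {T : PreTree Q} {w : T.Node ⊕ T.Leaf} :
    T.eltParent w = none ↔ w = rt T id id := by
  cases T with
  | edge i => exact ⟨fun _ => match w with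
      | .inl m => m.elim
      | .inr _ => rfl, by rintro rfl; rfl⟩
  | node b ch =>
    rcases elt_cases w with rfl | ⟨e, w, rfl⟩
    · exact ⟨fun _ => rfl, fun _ => rfl⟩
    · rw [eltParent_incl]
      refine ⟨fun h => (by cases h), fun h => ?_⟩
      rcases w with w | w <;> cases h

theorem eltParent_eq_root {b : Q.Op} {ch : Q.Ar b → PreTree Q}
    {w : (node b ch).Node ⊕ (node b ch).Leaf} :
    (node b ch).eltParent w = some none ↔ ∃ e, w = incl e (rt (ch e) id id) := by
  rcases elt_cases w with rfl | ⟨e, w, rfl⟩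
  · refine ⟨fun h => (by cases h), ?_⟩
    rintro ⟨e, h⟩
    revert h
    rcases rt (ch e) id id with w | w <;> intro h <;> cases h
  · rw [eltParent_incl]
    constructor
    · intro h
      cases h' : (ch e).eltParent w with
      | none => exact ⟨e, congrArg _ (eltParent_eq_none.1 h')⟩
      | some m => rw [h'] at h; cases h
    · rintro ⟨e', h⟩
      have h1 := eltParent_incl (ch := ch) e w
      rw [h, eltParent_incl, eltParent_eq_none.2 rfl] at h1
      exact h1.symm

theorem eltParent_eq_some {b : Q.Op} {ch : Q.Ar b → PreTree Q}
    {w : (node b ch).Node ⊕ (node b ch).Leaf} {e : Q.Ar b} {m : (ch e).Node}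
    (h : (node b ch).eltParent w = some (some ⟨e, m⟩)) :
    ∃ w', w = incl e w' ∧ (ch e).eltParent w' = some m := by
  rcases elt_cases w with rfl | ⟨e', w, rfl⟩
  · cases h
  · rw [eltParent_incl] at h
    cases h' : (ch e').eltParent w with
    | none => rw [h'] at h; cases h
    | some m' =>
      rw [h'] at h
      obtain ⟨rfl, h2⟩ := Sigma.mk.inj (Option.some.inj (Option.some.inj h))
      obtain rfl := eq_of_heq h2
      exact ⟨w, rfl, h'⟩

/-- Subtrees of a tree with named nodes and leaves. -/
inductive Occ {D L : Type} (M : PreTree Q) (d : M.Node → D) (f : M.Leaf → L) :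
    (M' : PreTree Q) → (M'.Node → D) → (M'.Leaf → L) → Prop
  | refl : Occ M d f M d f
  | step (b : Q.Op) (ch : Q.Ar b → PreTree Q) (d' : (node b ch).Node → D)
      (f' : (node b ch).Leaf → L) (h : Occ M d f (node b ch) d' f') (e : Q.Ar b) :
      Occ M d f (ch e) (fun m => d' (some ⟨e, m⟩)) fun l => f' ⟨e, l⟩

variable {D L : Type} {M M' : PreTree Q} {d : M.Node → D} {f : M.Leaf → L} {d' : M'.Node → D}
  {f' : M'.Leaf → L}

theorem Occ.valid (h : Occ M d f M' d' f') (v : M.Valid) : M'.Valid := by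
  induction h with
  | refl => exact v
  | step b ch d' f' h e ih => exact (ih e).2

theorem Occ.injective (h : Occ M d f M' d' f') (hd : Function.Injective (Sum.map d f)) :
    Function.Injective (Sum.map d' f') := by
  induction h with
  | refl => exact hd
  | step b ch d' f' h e ih =>
    have h1 : Function.Injective (incl (ch := ch) e) := by
      rintro (m | m) (m' | m') h
      · cases h; rfl
      · cases h
      · cases h
      · cases h; rfl
    have h2 : Sum.map (fun m => d' (some ⟨e, m⟩)) (fun l => f' ⟨e, l⟩) =
        Sum.map d' f' ∘ incl (ch := ch) e := (Sum.map_comp_map _ _ _ _).symm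
    rw [h2]
    exact ih.comp h1

theorem map_incl {b : Q.Op} {ch : Q.Ar b → PreTree Q} (d : (node b ch).Node → D)
    (f : (node b ch).Leaf → L) (e : Q.Ar b) (w : (ch e).Node ⊕ (ch e).Leaf) :
    Sum.map d f (incl e w) = Sum.map (fun m => d (some ⟨e, m⟩)) (fun l => f ⟨e, l⟩) w :=
  Sum.map_map _ _ _ _ w

theorem Occ.exists_leaf (h : Occ M d f M' d' f') (l : M'.Leaf) :
    ∃ d'' f'', Occ M d f (edge (M'.leafType l)) d'' f'' ∧ f'' PUnit.unit = f' l := by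
  induction M' with
  | edge i => exact ⟨d', f', h, rfl⟩
  | node b ch ih => exact ih l.1 (.step b ch d' f' h l.1) l.2

/-- An element whose parent is a node of a subtree belongs to that subtree, so a parent function
that is correct on `M` is correct on each subtree. -/
theorem Occ.parent (par : D ⊕ L → Option D)
    (hpar : ∀ w, par (Sum.map d f w) = (M.eltParent w).map d)
    (hs : Function.Surjective (Sum.map d f)) (hd : Function.Injective d)
    (h : Occ M d f M' d' f') (y : M'.Node) (v : D ⊕ L) :
    par v = some (d' y) ↔ ∃ w, v = Sum.map d' f' w ∧ M'.eltParent w = some y := by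
  induction h generalizing v with
  | refl =>
    obtain ⟨w, rfl⟩ := hs v
    rw [hpar, Option.map_eq_some_iff]
    constructor
    · rintro ⟨a, h1, h2⟩
      obtain rfl := hd h2
      exact ⟨w, rfl, h1⟩
    · rintro ⟨w', h1, h2⟩
      refine ⟨y, ?_, rfl⟩
      have h3 := hpar w
      rw [h1, hpar, h2] at h3
      obtain ⟨a, h4, h5⟩ := Option.map_eq_some_iff.1 h3.symm
      rwa [hd h5] at h4
  | step b ch d' f' h e ih =>
    refine (ih (some ⟨e, y⟩) v).trans ?_
    constructor
    · rintro ⟨w, h1, h2⟩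
      obtain ⟨w, rfl, h3⟩ := eltParent_eq_some h2
      exact ⟨w, h1.trans (map_incl d' f' e w), h3⟩
    · rintro ⟨w, h1, h2⟩
      exact ⟨incl e w, h1.trans (map_incl d' f' e w).symm, by rw [eltParent_incl, h2]; rfl⟩

theorem rt_eq_map (M : PreTree Q) (d : M.Node → D) (f : M.Leaf → L) :
    rt M d f = Sum.map d f (rt M id id) := by
  cases M <;> rfl

theorem Occ.parent_root {b : Q.Op} {ch : Q.Ar b → PreTree Q} {d' : (node b ch).Node → D}
    {f' : (node b ch).Leaf → L} (par : D ⊕ L → Option D)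
    (hpar : ∀ w, par (Sum.map d f w) = (M.eltParent w).map d)
    (hs : Function.Surjective (Sum.map d f)) (hd : Function.Injective d)
    (h : Occ M d f (node b ch) d' f') (v : D ⊕ L) :
    par v = some (d' none) ↔
      ∃ e, v = rt (ch e) (fun m => d' (some ⟨e, m⟩)) fun l => f' ⟨e, l⟩ := by
  refine (h.parent par hpar hs hd none v).trans ⟨?_, ?_⟩
  · rintro ⟨w, h1, h2⟩
    obtain ⟨e, rfl⟩ := eltParent_eq_root.1 h2
    exact ⟨e, h1.trans ((map_incl d' f' e _).trans (rt_eq_map _ _ _).symm)⟩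
  · rintro ⟨e, h1⟩
    exact ⟨_, h1.trans ((rt_eq_map _ _ _).trans (map_incl d' f' e _).symm),
      eltParent_eq_root.2 ⟨e, rfl⟩⟩

end PolyEndo.PreTree

open PolyEndo PreTree in
/-- The nesting given by a tree with numbered nodes and leaves. -/
noncomputable def RTree.ofTree {I : Type u} {Q : PolyEndo I} (M : Q.PreTree) {n m : ℕ}
    (d : M.Node ≃ Fin n) (f : M.Leaf ≃ Fin m) : RTree where
  dots := n
  leaves := m
  parent v := (M.eltParent (Sum.map d.symm f.symm v)).map d
  existsUnique_root := by
    refine ⟨Sum.map d f (rt M id id), ?_, fun v hv => ?_⟩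
    · change Option.map _ _ = _
      rw [Sum.map_map, Equiv.symm_comp_self, Equiv.symm_comp_self, Sum.map_id_id, id,
        eltParent_eq_none.2 rfl]
      rfl
    · have h := eltParent_eq_none.1 (Option.map_eq_none_iff.1 hv)
      rw [← h, Sum.map_map, Equiv.self_comp_symm, Equiv.self_comp_symm, Sum.map_id_id, id]
  acyclic := by
    -- A parent has smaller depth than its children, so the parent relation is contained in the one
    -- comparing depths, which is well-founded as a strict order on a finite set.
    have : IsTrans (Fin n) fun x y => M.depth (d.symm y) < M.depth (d.symm x) :=
      ⟨fun _ _ _ h h' => h'.trans h⟩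
    have : Std.Irrefl fun x y : Fin n => M.depth (d.symm y) < M.depth (d.symm x) :=
      ⟨fun _ => lt_irrefl _⟩
    refine Subrelation.wf ?_ (Finite.wellFounded_of_trans_of_irrefl
      fun x y : Fin n => M.depth (d.symm y) < M.depth (d.symm x))
    intro x y h
    obtain ⟨a, h1, h2⟩ := Option.map_eq_some_iff.1 h
    have := depth_parent M (d.symm x) a h1
    rw [← h2, Equiv.symm_apply_apply]
    lia

/-! ### Every tree of `P`-trees is a composition tree -/

namespace PolyMonad

open PolyEndo PreTree

variable {I : Type u} {P : PolyMonad I} {D L : Type} {M M' : P.plus.PTree} {d : M.Node → D}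
  {f : M.Leaf → L} {d' : M'.Node → D} {f' : M'.Leaf → L}

theorem names_incl (T : P.toPolyEndo.Tree) (ch : T.1.Node → P.plus.PTree)
    (d : (node (P := P.plus.toPolyEndo) T ch).Node → D)
    (f : (node (P := P.plus.toPolyEndo) T ch).Leaf → L) (n : T.1.Node) :
    names (M := ch n) (fun m => d (some ⟨n, m⟩)) (fun l => f ⟨n, l⟩) ⊆
      names (M := node (P := P.plus.toPolyEndo) T ch) d f := by
  rintro _ ⟨w, rfl⟩
  exact ⟨incl n w, map_incl (Q := P.plus.toPolyEndo) (ch := ch) d f n w⟩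

theorem disjoint_names (T : P.toPolyEndo.Tree) (ch : T.1.Node → P.plus.PTree)
    (d : (node (P := P.plus.toPolyEndo) T ch).Node → D)
    (f : (node (P := P.plus.toPolyEndo) T ch).Leaf → L) (hd : Function.Injective (Sum.map d f))
    (n m : T.1.Node) (hnm : m ≠ n) :
    Disjoint (names (M := ch m) (fun p => d (some ⟨m, p⟩)) (fun l => f ⟨m, l⟩))
      (names (M := ch n) (fun p => d (some ⟨n, p⟩)) (fun l => f ⟨n, l⟩)) := by
  rw [Set.disjoint_left]
  rintro _ ⟨w, rfl⟩ ⟨w', hw'⟩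
  have h := hd ((map_incl (Q := P.plus.toPolyEndo) (ch := ch) d f n w').trans (hw'.trans
    (map_incl (Q := P.plus.toPolyEndo) (ch := ch) d f m w).symm))
  apply hnm
  rcases w with w | w <;> rcases w' with w' | w' <;> cases h <;> rfl

/-- A branch is expanded and then substituted into one node of the decoration below it. Other
branches have disjoint names, so by `conn_lsub` it survives as a connected part, and `kern_kern`
carries this through all the subtrees that contain it. These connected parts become the spheres. -/
theorem conn_expand (h : Occ M d f M' d' f') (hd : Function.Injective (Sum.map d f))
    (v : M.Valid) (v' : M'.Valid) :
    (expand M v d f).1.1.Conn (names d' f') ∧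
      (expand M v d f).1.1.kern (names d' f') = (expand M' v' d' f').1.1 := by
  have base : ∀ (M : P.plus.PTree) (v : M.Valid) (d : M.Node → D) (f : M.Leaf → L),
      (expand M v d f).1.1.Conn (names d f) ∧
      (expand M v d f).1.1.kern (names d f) = (expand M v d f).1.1 := by
    intro M v d f
    have hw := expand_within M v d f
    obtain ⟨b, ch, h⟩ := expand_eq_node M v d f
    rw [h] at hw ⊢
    exact ⟨hw.conn_node, hw.kern_node⟩
  induction h with
  | refl => exact base M v' d f
  | step T ch d' f' h n ih =>
    have vT := h.valid v
    obtain ⟨h1, h2⟩ := ih vT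
    have hsub := names_incl T ch d' f' n
    have hl : (expand (node T ch) vT d' f').1.1 = _ := blow_eq_lsub T.1 T.2 _ _ _ n
    obtain ⟨h3, h4⟩ := base (ch n) v' (fun m => d' (some ⟨n, m⟩)) fun l => f' ⟨n, l⟩
    obtain ⟨h5, h6⟩ := conn_lsub (names (M := ch n) (fun m => d' (some ⟨n, m⟩)) fun l => f' ⟨n, l⟩)
      T.1 (fun n => (expand (ch n) (vT n).2 (fun m => d' (some ⟨n, m⟩)) fun l => f' ⟨n, l⟩).1)
      (fun n => (expand (ch n) (vT n).2 _ _).2.trans (vT n).1) T.2 n h3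
      fun m hm => (expand_within _ _ _ _).not_meets
        (disjoint_names T ch d' f' (h.injective hd) n m hm)
    have hK : (expand (node T ch) vT d' f').1.1.Conn
          (names (M := ch n) (fun m => d' (some ⟨n, m⟩)) fun l => f' ⟨n, l⟩) ∧
        (expand (node T ch) vT d' f').1.1.kern
          (names (M := ch n) (fun m => d' (some ⟨n, m⟩)) fun l => f' ⟨n, l⟩) =
        (expand (ch n) v' (fun m => d' (some ⟨n, m⟩)) fun l => f' ⟨n, l⟩).1.1 := by
      rw [hl]
      exact ⟨h5, h6.trans h4⟩
    rw [← h2] at hK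
    have h7 := (conn_kern hsub h1).1 hK.1
    exact ⟨h7, (kern_kern hsub h1 h7).symm.trans hK.2⟩

theorem exists_node (h : Occ M d f M' d' f') (p : M'.Node) :
    ∃ ch d'' f'', Occ M d f (node (M'.dec p) ch) d'' f'' ∧ d'' none = d' p ∧
      lay M' d' f' p = lay (node (M'.dec p) ch) d'' f'' none := by
  induction M' with
  | edge i => exact p.elim
  | node b ch ih =>
    match p with
    | none => exact ⟨ch, d', f', h, rfl, rfl⟩
    | some ⟨e, p⟩ => exact ih e (.step b ch d' f' h e) p

theorem exists_dec_of_kern {Y : Type} {A : Set Y} (T : (P.toPolyEndo.lab Y).PreTree)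
    (b : P.Op × Y) (c : P.Ar b.1 → (P.toPolyEndo.lab Y).PreTree)
    (h : T.kern A = node (P := P.toPolyEndo.lab Y) b c) : ∃ n, T.dec n = b := by
  induction T with
  | edge i => cases h
  | node b' ch ih =>
    unfold kern subtreeAt at h
    split_ifs at h with h1 h2
    · rw [prune_of_mem h1] at h
      cases h
      exact ⟨none, rfl⟩
    · obtain ⟨n, hn⟩ := ih _ h
      exact ⟨some ⟨_, n⟩, hn⟩
    · cases h

/-- Dots arise in two ways only: black ones from leaves, white ones from nodes decorated by unit
trees. -/
theorem expand_within_black (M : P.plus.PTree) (v : M.Valid) (d : M.Node → D) (f : M.Leaf → L) :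
    (expand M v d f).1.1.Within {y | (∃ l, y = .inr (f l)) ∨
      ∃ p i, y = .inl (d p) ∧ (M.dec p).1 = edge i} := by
  induction M with
  | edge b => exact ⟨.inl ⟨_, rfl⟩, fun _ => trivial⟩
  | node T ch ih =>
    refine blow_induction (p := fun W : P.VTree (D ⊕ L) => W.1.Within _) T.1 T.2
      (.inl (d none)) _ _ (fun i hi => ?_) fun _ => ?_
    · exact ⟨.inr ⟨none, i, rfl, hi⟩, fun _ => trivial⟩
    · refine lsub_within _ _ _ _ fun n => (ih n _ _ _).mono ?_
      rintro _ (⟨l, rfl⟩ | ⟨p, i, rfl, h⟩)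
      · exact .inl ⟨⟨n, l⟩, rfl⟩
      · exact .inr ⟨some ⟨n, p⟩, i, rfl, h⟩

/-- The case of `conn_expand` where the subtree is a unit tree, whose only name is that of the leaf.
-/
theorem conn_expand_leaf (M : P.plus.PTree) (v : M.Valid) (d : M.Node → D) (f : M.Leaf → L)
    (hd : Function.Injective (Sum.map d f)) (l : M.Leaf) :
    (expand M v d f).1.1.Conn {.inr (f l)} ∧
      (expand M v d f).1.1.kern {.inr (f l)} = (lcorolla (M.leafType l) (.inr (f l))).1 := by
  obtain ⟨d', f', h, hf⟩ := Occ.exists_leaf (Occ.refl (d := d) (f := f)) l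
  have hn : names d' f' = {.inr (f l)} := by
    refine Set.ext fun w => ⟨?_, ?_⟩
    · rintro ⟨m | m, rfl⟩
      · exact m.elim
      · exact congrArg Sum.inr hf
    · rintro rfl
      exact ⟨.inr PUnit.unit, congrArg Sum.inr hf⟩
  have := conn_expand h hd v trivial
  rw [hn] at this
  exact ⟨this.1, this.2.trans (congrArg (fun l' : L =>
    (lcorolla (M.leafType l) (Sum.inr l' : D ⊕ L)).1) hf)⟩

theorem conn_expand_null (M : P.plus.PTree) (v : M.Valid) (d : M.Node → D) (f : M.Leaf → L)
    (hd : Function.Injective (Sum.map d f)) (p : M.Node) (i : I) (hp : (M.dec p).1 = edge i) :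
    (expand M v d f).1.1.Conn {.inl (d p)} ∧
      (expand M v d f).1.1.kern {.inl (d p)} = (lcorolla (P.one i) (.inl (d p))).1 := by
  obtain ⟨ch, d', f', h, hf, -⟩ := exists_node (Occ.refl (d := d) (f := f)) p
  revert h hf ch
  generalize hT : M.dec p = T
  intro ch d' f' h hf
  obtain ⟨T, vT⟩ := T
  obtain rfl : T = edge i := (congrArg Subtype.val hT).symm.trans hp
  have hn : names (M := node (P := P.plus.toPolyEndo) ⟨edge i, vT⟩ ch) d' f' = {.inl (d p)} := by
    refine Set.ext fun w => ⟨?_, ?_⟩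
    · rintro ⟨w, rfl⟩
      rcases elt_cases w with rfl | ⟨e, -⟩
      · exact congrArg Sum.inl hf
      · exact PEmpty.elim e
    · rintro rfl
      exact ⟨.inl none, congrArg Sum.inl hf⟩
  have := conn_expand h hd v (h.valid v)
  rw [hn] at this
  exact ⟨this.1, this.2.trans (congrArg (fun l' : D =>
    (lcorolla (P.one i) (Sum.inl l' : D ⊕ L)).1) hf)⟩

/-- Both sides consist of the root of the subtree and of what lies below its children, and
`Occ.parent_root` identifies these children with the roots of the branches. -/
theorem le_rt (N : RTree) {M : P.plus.PTree} {d : M.Node → Fin N.dots}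
    {f : M.Leaf → Fin N.leaves} (hpar : ∀ w, N.parent (Sum.map d f w) = (M.eltParent w).map d)
    (hs : Function.Surjective (Sum.map d f)) (hd : Function.Injective d) {d' : M'.Node → Fin N.dots}
    {f' : M'.Leaf → Fin N.leaves} (h : Occ M d f M' d' f') :
    {v | N.Le v (rt M' d' f')} = names d' f' := by
  induction M' with
  | edge b =>
    refine Set.ext fun w => ⟨fun hw => ⟨.inr PUnit.unit, (RTree.le_inr hw).symm⟩, ?_⟩
    rintro ⟨m | m, rfl⟩
    · exact m.elim
    · exact .refl
  | node T ch ih =>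
    have H := fun n => ih n (.step T ch d' f' h n)
    refine Set.ext fun w => ⟨fun hw => ?_, ?_⟩
    · rcases RTree.le_inl_iff.1 hw with rfl | ⟨y, hy, hwy⟩
      · exact ⟨.inl none, rfl⟩
      · obtain ⟨n, rfl⟩ := (h.parent_root N.parent hpar hs hd y).1 hy
        exact names_incl T ch d' f' n ((Set.ext_iff.1 (H n) w).1 hwy)
    · rintro ⟨w, rfl⟩
      rcases elt_cases w with rfl | ⟨n, w, rfl⟩
      · exact .refl
      · rw [map_incl]
        exact RTree.le_inl_iff.2 (.inr ⟨_, (h.parent_root N.parent hpar hs hd _).2 ⟨n, rfl⟩,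
          (Set.ext_iff.1 (H n) _).2 ⟨w, rfl⟩⟩)

theorem lcorolla_one_injective {Y : Type} {i j : I} {y : Y}
    (h : lcorolla (P.one i) y = lcorolla (P.one j) y) : i = j := by
  have := congrArg (fun W : P.VTree Y => W.1.root) h
  exact (P.tgt_one i).symm.trans (this.trans (P.tgt_one j))

/-- The part inside the sphere arises by substituting the expanded branches into `T`, and the child
above a dot says from which branch the dot comes. So contracting along this colouring undoes the
substitution, by `contract_lsub`. A unit tree is treated apart, its expansion being a white dot
rather than a substitution. -/
theorem layerLab_eq_lay (C : P.Constel) (T : P.toPolyEndo.Tree) (ch : T.1.Node → P.plus.PTree)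
    (v : (node (P := P.plus.toPolyEndo) T ch).Valid)
    (d : (node (P := P.plus.toPolyEndo) T ch).Node → Fin C.nest.dots)
    (f : (node (P := P.plus.toPolyEndo) T ch).Leaf → Fin C.nest.leaves)
    (hin : inside C (.inl (d none)) = (expand (node T ch) v d f).1)
    (hr : ∀ w, C.nest.parent w = some (d none) ↔
      ∃ n, w = rt (ch n) (fun m => d (some ⟨n, m⟩)) fun l => f ⟨n, l⟩)
    (hb : ∀ n, {w | C.nest.Le w (rt (ch n) (fun m => d (some ⟨n, m⟩)) fun l => f ⟨n, l⟩)} =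
      names (M := ch n) (fun m => d (some ⟨n, m⟩)) fun l => f ⟨n, l⟩)
    (hd : Function.Injective (Sum.map d f)) : layerLab C (d none) = lay (node T ch) d f none := by
  obtain ⟨T, vT⟩ := T
  cases T with
  | edge i =>
    obtain ⟨j, h1, h2⟩ := layerLab_null C (d none) fun w hw => by
      obtain ⟨n, -⟩ := (hr w).1 hw
      exact n.elim
    obtain rfl : j = i := lcorolla_one_injective (h2.symm.trans hin)
    exact h1
  | node b c =>
    refine (layerLab_eq C (d none)).trans ((P.contract_congr _ (congrArg Subtype.val hin) _
      (expand _ v d f).1.2).trans ?_)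
    refine contract_lsub _ (node b c) (fun n : (node b c : P.PTree).Node => (expand (ch n) (v n).2
      (fun m => d (some ⟨n, m⟩)) fun l => f ⟨n, l⟩).1)
      (fun n => (expand (ch n) (v n).2 _ _).2.trans (v n).1) vT
      (fun n => rt (ch n) (fun m => d (some ⟨n, m⟩)) fun l => f ⟨n, l⟩)
      (fun n m hnm => ?_) (fun n => ?_) (fun n => expand_eq_node _ _ _ _) _
    -- If two branches had the same root name, that name would belong to the disjoint sets of names
    -- of both branches.
    · by_contra hne
      have h1 : rt (ch n) (fun m => d (some ⟨n, m⟩)) (fun l => f ⟨n, l⟩) ∈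
          names (M := ch n) (fun m => d (some ⟨n, m⟩)) fun l => f ⟨n, l⟩ :=
        (Set.ext_iff.1 (hb n) _).1 .refl
      refine Set.disjoint_left.1 (disjoint_names ⟨node b c, vT⟩ ch d f hd n m (Ne.symm hne)) ?_ h1
      exact (Set.ext_iff.1 (hb m) _).1 ((congrArg (C.nest.Le _) hnm).mp .refl)
    · refine (expand_within _ _ _ _).mono ?_
      rw [← hb]
      exact fun w hw => (RTree.childAbove_eq_some _ _ _ _).2 ⟨(hr _).2 ⟨n, rfl⟩, hw⟩

theorem name_of_dec (T : (P.toPolyEndo.subdiv L D).PreTree) (n : T.Node) (b : P.Op) (l : L)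
    (h : T.dec n = .inl (b, l)) : T.name n = .inr l := by
  unfold name
  rw [h]

/-- Every tree of `P`-trees is the composition tree of a constellation. -/
theorem exists_constel (M : P.plus.toPolyEndo.Tree) : ∃ C d f, Pres (P := P) C M d f := by
  obtain ⟨M, vM⟩ := M
  have := finite_node M
  have := finite_leaf M
  obtain ⟨n, ⟨d⟩⟩ := Finite.exists_equiv_fin M.Node
  obtain ⟨m, ⟨f⟩⟩ := Finite.exists_equiv_fin M.Leaf
  let N := RTree.ofTree M d f
  have hpar : ∀ w, N.parent (Sum.map d f w) = (M.eltParent w).map d := by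
    intro w
    have h : Sum.map d.symm f.symm (Sum.map d f w) = w := by
      rw [Sum.map_map, Equiv.symm_comp_self, Equiv.symm_comp_self, Sum.map_id_id, id]
    exact congrArg (fun w => (M.eltParent w).map d) h
  have hd : Function.Injective (Sum.map d f) := d.injective.sumMap f.injective
  have hs : Function.Surjective (Sum.map d f) := d.surjective.sumMap f.surjective
  -- The white dots of the expansion are decorated by units, so it comes from a subdivided tree `T`.
  obtain ⟨T, vT, -, hT⟩ := P.exists_fillWhite _ (expand M vM d f).1.2
    (whiteUnit_expand M vM d f)
  have hname : ∀ y, (∃ n, T.name n = y) ↔ ∃ n, ((expand M vM d f).1.1.dec n).2 = y := by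
    intro y
    rw [← hT]
    constructor
    · rintro ⟨n, rfl⟩
      exact ⟨P.fillNode T n, P.label_fillNode T n⟩
    · rintro ⟨n, rfl⟩
      obtain ⟨n, rfl⟩ := (P.fillNode T).surjective n
      exact ⟨n, (P.label_fillNode T n).symm⟩
  have hleaf := conn_expand_leaf M vM d f hd
  have hnull := conn_expand_null M vM d f hd
  have hblack : ∀ n, T.name n ∈ {y | (∃ l, y = Sum.inr (f l)) ∨
      ∃ p i, y = .inl (d p) ∧ (M.dec p).1 = edge i} := by
    intro n
    obtain ⟨n', hn'⟩ := (hname _).1 ⟨n, rfl⟩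
    rw [← hn']
    exact within_iff.1 (expand_within_black M vM d f) n'
  -- The subtree belonging to a leaf or to a null node expands to a single dot, so every name cuts
  -- out a single node and cannot occur twice.
  have hone : ∀ n m, T.name n = T.name m → n = m := by
    intro n m h
    have hw : (P.fillWhite T).Conn {T.name n} ∧ ∃ (b : P.Op × _) (i : P.Ar b.1 → I),
        (P.fillWhite T).kern {T.name n} = node (P := P.toPolyEndo.lab _) b fun e => edge (i e) := by
      rw [hT]
      rcases hblack n with ⟨l, hl⟩ | ⟨p, i, hp, hi⟩
      · rw [hl]
        exact ⟨(hleaf l).1, _, _, (hleaf l).2⟩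
      · rw [hp]
        exact ⟨(hnull p i hi).1, _, _, (hnull p i hi).2⟩
    obtain ⟨h1, b, i, h2⟩ := hw
    exact (P.fillNode T).injective (eq_of_kern_singleton _ _ h1 b i h2 _ _ (P.label_fillNode T n)
      ((P.label_fillNode T m).trans h.symm))
  -- The children of the sphere named by `p` correspond to the nodes of the decoration of `p`. There
  -- are none exactly when this decoration is a unit tree, and that is the case in which `p`
  -- contributes a white dot.
  have hdot : ∀ x, (∃ n, T.name n = .inl x) ↔ N.IsNull x := by
    intro x
    obtain ⟨p, rfl⟩ := d.surjective x
    obtain ⟨ch, d', f', h, hp, -⟩ := exists_node (Occ.refl (d := d) (f := f)) p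
    have hr := h.parent_root N.parent hpar hs d.injective
    rw [hp] at hr
    constructor
    · rintro ⟨n, hn⟩ v hv
      obtain ⟨e, -⟩ := (hr v).1 hv
      rcases hn ▸ hblack n with ⟨l, hl⟩ | ⟨p', i, hp', hi⟩
      · cases hl
      · obtain rfl := d.injective (Sum.inl.inj hp')
        have : (edge i : P.PTree).Node := hi ▸ e
        exact this.elim
    · intro hx
      have : ∃ i, (M.dec p).1 = edge i := by
        cases hT : (M.dec p).1 with
        | edge i => exact ⟨i, rfl⟩
        | node b c =>
          have e : (M.dec p).1.Node := hT ▸ (none : (node b c : P.PTree).Node)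
          exact (hx _ ((hr _).2 ⟨e, rfl⟩)).elim
      obtain ⟨i, hi⟩ := this
      obtain ⟨n, hn⟩ := exists_dec_of_kern _ _ _ (hnull p i hi).2
      exact (hname _).2 ⟨n, congrArg Prod.snd hn⟩
  have hleafdec : ∀ l, ∃ n, T.dec n = .inl (M.leafType l, f l) := by
    intro l
    obtain ⟨n, hn⟩ := exists_dec_of_kern (P.fillWhite T) _ _
      ((congrArg (kern _) hT).trans (hleaf l).2)
    obtain ⟨n, rfl⟩ := (P.fillNode T).surjective n
    exact ⟨n, P.dec_of_fillNode T n _ _ hn⟩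
  let C : P.Constel :=
    { nest := N
      tree := ⟨T, vT⟩
      name_injective := fun n m h => hone n m h
      leaf_named := fun l => by
        obtain ⟨l, rfl⟩ := f.surjective l
        obtain ⟨n, hn⟩ := hleafdec l
        exact ⟨n, name_of_dec T n _ _ hn⟩
      dot_named := hdot
      kernel_rule := fun x => by
        obtain ⟨p, rfl⟩ := d.surjective x
        obtain ⟨ch, d', f', h, hp, -⟩ := exists_node (Occ.refl (d := d) (f := f)) p
        have hle := le_rt N hpar hs d.injective h
        have h1 := (conn_expand h hd vM (h.valid vM)).1
        have h2 := (P.isKernel_iff_conn T _).2 ((congrArg₂ Conn hle hT).mpr h1)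
        rw [← hp]
        exact h2 }
  have hfill : filled C = (expand M vM d f).1 := Subtype.ext hT
  refine ⟨C, d, f, ⟨fun p => ?_, hleafdec⟩, ?_, hfill.symm⟩
  · obtain ⟨ch, d', f', h, hp, hlay⟩ := exists_node (Occ.refl (d := d) (f := f)) p
    have hle : below C (.inl (d' none)) = _ := le_rt N hpar hs d.injective h
    have hin : inside C (.inl (d' none)) = (expand _ (h.valid vM) d' f').1 := by
      refine Subtype.ext ?_
      change (filled C).1.kern (below C (.inl (d' none))) = _
      rw [hfill, hle]
      exact (conn_expand h hd vM _).2
    have hr := h.parent_root N.parent hpar hs d.injective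
    refine (congrArg (layerLab C) hp.symm).trans (Eq.trans ?_ hlay.symm)
    exact layerLab_eq_lay C _ ch (h.valid vM) d' f' hin hr
      (fun n => le_rt N hpar hs d.injective (.step _ ch d' f' h n)) (h.injective hd)
  · refine RTree.eq_root ?_
    rw [rt_eq_map]
    refine (hpar _).trans ?_
    rw [eltParent_eq_none.2 rfl]
    rfl

end PolyMonad

/-! ### Transport of a monad structure along an isomorphism of endofunctors -/

/-- Data identifying a polynomial endofunctor with the one underlying a polynomial monad. -/
structure EndoIso {I : Type u} (E : PolyEndo I) (Q : PolyMonad I) where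
  op : E.Op ≃ Q.Op
  ar : ∀ b, E.Ar b ≃ Q.Ar (op b)
  tgt_op : ∀ b, Q.tgt (op b) = E.tgt b
  src_ar : ∀ b e, Q.src (op b) (ar b e) = E.src b e

namespace EndoIso

open PolyEndo

variable {I : Type u} {E : PolyEndo I} {Q : PolyMonad I} (φ : EndoIso E Q)

/-- The bijection on inputs. -/
def inp (x : E.Input) : Q.Input := ⟨φ.op x.1, φ.ar x.1 x.2⟩

theorem inp_injective : Function.Injective φ.inp := by
  rintro ⟨b, e⟩ ⟨b', e'⟩ h
  obtain ⟨h1, h2⟩ := Sigma.mk.inj h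
  obtain rfl : b = b' := φ.op.injective h1
  have h3 : e = e' := (φ.ar b).injective (eq_of_heq h2)
  rw [h3]

/-- The bijection between the inputs of two corresponding operations. -/
def lift {b : E.Op} {B : Q.Op} (h : φ.op b = B) : E.Ar b ≃ Q.Ar B :=
  (φ.ar b).trans (Equiv.cast (congrArg Q.Ar h))

theorem inp_lift {b : E.Op} {B : Q.Op} (h : φ.op b = B) (e : E.Ar b) :
    φ.inp ⟨b, e⟩ = ⟨B, φ.lift h e⟩ := by
  subst h
  rfl

theorem src_of_inp {b : E.Op} {B : Q.Op} {e : E.Ar b} {e' : Q.Ar B} (h : φ.inp ⟨b, e⟩ = ⟨B, e'⟩) :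
    Q.src B e' = E.src b e := by
  cases h
  exact φ.src_ar b e

/-- A family of operations of `E` as a family of operations of `Q`. -/
def fam {b : E.Op} (c : E.Fam b) : Q.Fam (φ.op b) :=
  ⟨fun q => φ.op (c.1 ((φ.ar b).symm q)), fun q => (φ.tgt_op _).trans ((c.2 _).trans
    ((φ.src_ar b _).symm.trans (by rw [Equiv.apply_symm_apply])))⟩

theorem exists_fam {b : E.Op} (c : E.Fam b) {B : Q.Op} (h : φ.op b = B) :
    ∃ c' : Q.Fam B, ∀ e e', φ.inp ⟨b, e⟩ = ⟨B, e'⟩ → c'.1 e' = φ.op (c.1 e) := by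
  subst h
  refine ⟨φ.fam c, fun e e' he => ?_⟩
  rw [← eq_of_heq (Sigma.mk.inj he).2]
  exact congrArg (fun e => φ.op (c.1 e)) ((φ.ar b).symm_apply_apply e)

theorem eq_fam {b : E.Op} (c : E.Fam b) (c' : Q.Fam (φ.op b))
    (hc : ∀ e, c'.1 (φ.ar b e) = φ.op (c.1 e)) : c' = φ.fam c := by
  refine Subtype.ext (funext fun q => ?_)
  obtain ⟨e, rfl⟩ := (φ.ar b).surjective q
  exact (hc e).trans (congrArg (fun e => φ.op (c.1 e)) ((φ.ar b).symm_apply_apply e).symm)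

theorem fam_apply {b : E.Op} (c : E.Fam b) (e : E.Ar b) :
    φ.op (c.1 e) = (φ.fam c).1 (φ.ar b e) :=
  congrArg (fun e => φ.op (c.1 e)) ((φ.ar b).symm_apply_apply e).symm

/-- The unit operation corresponding to that of `Q`. -/
def one (i : I) : E.Op := φ.op.symm (Q.one i)

theorem op_one (i : I) : φ.op (φ.one i) = Q.one i := φ.op.apply_symm_apply _

/-- The composite operation corresponding to that of `Q`. -/
def mul (b : E.Op) (c : E.Fam b) : E.Op := φ.op.symm (Q.mul (φ.op b) (φ.fam c))

theorem op_mul_fam (b : E.Op) (c : E.Fam b) : φ.op (φ.mul b c) = Q.mul (φ.op b) (φ.fam c) :=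
  φ.op.apply_symm_apply _

/-- The bijection on inputs corresponding to that of `Q`. -/
def pos (b : E.Op) (c : E.Fam b) : (Σ e : E.Ar b, E.Ar (c.1 e)) ≃ E.Ar (φ.mul b c) :=
  ((Equiv.sigmaCongr (φ.ar b) fun e => φ.lift (φ.fam_apply c e)).trans
    (Q.pos (φ.op b) (φ.fam c))).trans (φ.lift (φ.op_mul_fam b c)).symm

/-- The operation `B` and the family `c'` are arbitrary up to the stated correspondence, because the
image of a composite is only propositionally the composite in `Q`. In this form the rule can be
applied to iterated composites, with inputs compared in the total space. -/
theorem op_mul {b : E.Op} {c : E.Fam b} {B : Q.Op} (h : φ.op b = B) {c' : Q.Fam B}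
    (hc : ∀ e e', φ.inp ⟨b, e⟩ = ⟨B, e'⟩ → c'.1 e' = φ.op (c.1 e)) :
    φ.op (φ.mul b c) = Q.mul B c' := by
  subst h
  rw [φ.eq_fam c c' fun e => hc e _ rfl]
  exact φ.op_mul_fam b c

theorem inp_pos {b : E.Op} {c : E.Fam b} {B : Q.Op} (h : φ.op b = B) {c' : Q.Fam B}
    (hc : ∀ e e', φ.inp ⟨b, e⟩ = ⟨B, e'⟩ → c'.1 e' = φ.op (c.1 e)) {e : E.Ar b} {e' : Q.Ar B}
    (he : φ.inp ⟨b, e⟩ = ⟨B, e'⟩) {f : E.Ar (c.1 e)} {f' : Q.Ar (c'.1 e')}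
    (hf : φ.inp ⟨c.1 e, f⟩ = ⟨c'.1 e', f'⟩) :
    φ.inp ⟨φ.mul b c, φ.pos b c ⟨e, f⟩⟩ = ⟨Q.mul B c', Q.pos B c' ⟨e', f'⟩⟩ := by
  subst h
  obtain rfl := φ.eq_fam c c' fun e => hc e _ rfl
  obtain rfl := eq_of_heq (Sigma.mk.inj he).2
  have h1 : f' = φ.lift (φ.fam_apply c e) f :=
    eq_of_heq (Sigma.mk.inj (hf.symm.trans (φ.inp_lift (φ.fam_apply c e) f))).2
  rw [φ.inp_lift (φ.op_mul_fam b c), h1]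
  exact congrArg (Sigma.mk _) ((φ.lift (φ.op_mul_fam b c)).apply_symm_apply _)

theorem one_mul_of_eq {i : I} {B : Q.Op} (h : B = Q.one i) (c : Q.Fam B) (q : Q.Ar B) :
    Q.mul B c = c.1 q ∧ ∀ f, (⟨_, Q.pos B c ⟨q, f⟩⟩ : Q.Input) = ⟨_, f⟩ := by
  subst h
  obtain rfl := Q.eq_pt i q
  exact ⟨Q.one_mul i c, Q.one_mul_pos i c⟩

/-- The input of the unit operation. -/
def pt (i : I) : E.Ar (φ.one i) := (φ.lift (φ.op_one i)).symm (Q.pt i)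

theorem inp_pt (i : I) : φ.inp ⟨φ.one i, φ.pt i⟩ = ⟨Q.one i, Q.pt i⟩ :=
  (φ.inp_lift (φ.op_one i) _).trans
    (congrArg (Sigma.mk _) ((φ.lift (φ.op_one i)).apply_symm_apply _))

theorem tgt_one (i : I) : E.tgt (φ.one i) = i :=
  (φ.tgt_op _).symm.trans ((congrArg Q.tgt (φ.op_one i)).trans (Q.tgt_one i))

theorem tgt_mul (b : E.Op) (c : E.Fam b) : E.tgt (φ.mul b c) = E.tgt b :=
  (φ.tgt_op _).symm.trans ((congrArg Q.tgt (φ.op_mul_fam b c)).trans ((Q.tgt_mul _ _).trans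
    (φ.tgt_op b)))

theorem exists_inp (x : E.Input) {B : Q.Op} (h : φ.op x.1 = B) : ∃ e, φ.inp x = ⟨B, e⟩ := by
  subst h
  exact ⟨_, rfl⟩

theorem src_pos (b : E.Op) (c : E.Fam b) (x : Σ e : E.Ar b, E.Ar (c.1 e)) :
    E.src _ (φ.pos b c x) = E.src _ x.2 := by
  obtain ⟨c', hc⟩ := φ.exists_fam c rfl
  obtain ⟨f', hf⟩ := φ.exists_inp ⟨c.1 x.1, x.2⟩ (hc x.1 _ rfl).symm
  have h1 := φ.inp_pos rfl hc (e := x.1) rfl hf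
  exact (φ.src_of_inp h1).symm.trans ((Q.src_pos _ _ _).trans (φ.src_of_inp hf))

theorem unit_fam (b : E.Op) (e : E.Ar b) (e' : Q.Ar (φ.op b))
    (he : φ.inp ⟨b, e⟩ = ⟨φ.op b, e'⟩) :
    Q.one (Q.src (φ.op b) e') = φ.op (φ.one (E.src b e)) := by
  rw [φ.op_one, φ.src_of_inp he]

theorem assoc_fam {b : E.Op} {c : E.Fam b} (d : E.Fam (φ.mul b c)) {B : Q.Op} (h : φ.op b = B)
    {c' : Q.Fam B} (hc : ∀ e e', φ.inp ⟨b, e⟩ = ⟨B, e'⟩ → c'.1 e' = φ.op (c.1 e))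
    {d' : Q.Fam (Q.mul B c')}
    (hd : ∀ e e', φ.inp ⟨φ.mul b c, e⟩ = ⟨Q.mul B c', e'⟩ → d'.1 e' = φ.op (d.1 e))
    (e : E.Ar b) (e' : Q.Ar B) (he : φ.inp ⟨b, e⟩ = ⟨B, e'⟩) (f : E.Ar (c.1 e))
    (f' : Q.Ar (c'.1 e')) (hf : φ.inp ⟨c.1 e, f⟩ = ⟨c'.1 e', f'⟩) :
    d'.1 (Q.pos B c' ⟨e', f'⟩) = φ.op (d.1 (φ.pos b c ⟨e, f⟩)) :=
  hd _ _ (φ.inp_pos h hc he hf)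

/-- The monad structure corresponding to that of `Q`. -/
def monadStr : MonadStr E where
  one := φ.one
  tgt_one := φ.tgt_one
  pt := φ.pt
  eq_pt i e := (φ.lift (φ.op_one i)).injective ((Q.eq_pt i _).trans
    ((φ.lift (φ.op_one i)).apply_symm_apply _).symm)
  src_pt i := (φ.src_of_inp (φ.inp_pt i)).symm.trans (Q.src_pt i)
  mul := φ.mul
  tgt_mul := φ.tgt_mul
  pos := φ.pos
  src_pos := φ.src_pos
  mul_one b := φ.op.injective ((φ.op_mul rfl (c' := ⟨fun e => Q.one (Q.src (φ.op b) e),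
    fun _ => Q.tgt_one _⟩) (φ.unit_fam b)).trans (Q.mul_one _))
  mul_one_pos b e := by
    refine φ.inp_injective ((φ.inp_pos rfl (c' := ⟨fun e => Q.one (Q.src (φ.op b) e),
      fun _ => Q.tgt_one _⟩) (φ.unit_fam b) (e' := φ.ar b e) (f' := Q.pt _) rfl ?_).trans
      (Q.mul_one_pos _ _))
    have := φ.src_ar b e
    dsimp only
    rw [this]
    exact φ.inp_pt _
  one_mul i c := by
    obtain ⟨c', hc⟩ := φ.exists_fam c rfl
    refine φ.op.injective ((φ.op_mul rfl hc).trans ?_)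
    exact (one_mul_of_eq (φ.op_one i) c' (φ.ar _ (φ.pt i))).1.trans (hc _ _ rfl)
  one_mul_pos i c f := by
    obtain ⟨c', hc⟩ := φ.exists_fam c rfl
    obtain ⟨f', hf⟩ := φ.exists_inp ⟨c.1 (φ.pt i), f⟩ (hc (φ.pt i) _ rfl).symm
    refine φ.inp_injective ((φ.inp_pos rfl hc rfl hf).trans (Eq.trans ?_ hf.symm))
    exact (one_mul_of_eq (φ.op_one i) c' (φ.ar _ (φ.pt i))).2 f'
  assoc b c d := by
    obtain ⟨c', hc⟩ := φ.exists_fam c rfl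
    obtain ⟨d', hd⟩ := φ.exists_fam d (φ.op_mul rfl hc)
    -- Both bracketings are carried to `Q` by applying `op_mul` twice, and there `Q.assoc` compares
    -- them.
    refine φ.op.injective ((φ.op_mul (φ.op_mul rfl hc) hd).trans ((Q.assoc _ c' d').trans
      (φ.op_mul rfl fun e e' he => ?_).symm))
    exact (φ.op_mul (hc e e' he).symm fun f f' hf => φ.assoc_fam d rfl hc hd e e' he f f' hf).symm
  assoc_pos b c d e f g := by
    obtain ⟨c', hc⟩ := φ.exists_fam c rfl
    obtain ⟨d', hd⟩ := φ.exists_fam d (φ.op_mul rfl hc)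
    obtain ⟨f', hf⟩ := φ.exists_inp ⟨c.1 e, f⟩ (hc e _ rfl).symm
    have hp := φ.inp_pos rfl hc rfl hf
    obtain ⟨g', hg⟩ := φ.exists_inp ⟨_, g⟩ (hd _ _ hp).symm
    refine φ.inp_injective ((φ.inp_pos (φ.op_mul rfl hc) hd hp hg).trans
      ((Q.assoc_pos _ c' d' _ f' g').trans
      (φ.inp_pos rfl (fun e e' he => ?_) rfl ?_).symm))
    · exact (φ.op_mul (hc e e' he).symm
        fun f f' hf => φ.assoc_fam d rfl hc hd e e' he f f' hf).symm
    · exact φ.inp_pos (hc e _ rfl).symm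
        (fun f f' hf => φ.assoc_fam d rfl hc hd e _ rfl f f' hf) hf hg

/-- The resulting isomorphism of monads. -/
def monadIso : PolyMonadIso ⟨E, φ.monadStr⟩ Q where
  op := φ.op
  ar := φ.ar
  tgt_op := φ.tgt_op
  src_ar := φ.src_ar
  op_one := φ.op_one
  op_mul b c c' h := φ.op_mul rfl fun e e' he => by
    obtain rfl := eq_of_heq (Sigma.mk.inj he).2
    exact h e
  ar_pos b c c' h e f f' hf := φ.inp_pos rfl (fun e e' he => by
    obtain rfl := eq_of_heq (Sigma.mk.inj he).2
    exact h e) rfl hf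

end EndoIso

/-! ### The bijections between constellations and `P⁺`-trees -/

namespace PolyMonad

open PolyEndo PreTree

variable {I : Type u} {P : PolyMonad I}

/-- The composition tree of a constellation. -/
noncomputable def tree (C : P.Constel) : P.plus.toPolyEndo.Tree := (exists_pres C).choose

/-- The numbering of the nodes of the composition tree. -/
noncomputable def dots (C : P.Constel) : (tree C).1.Node ≃ Fin C.nest.dots :=
  (exists_pres C).choose_spec.choose

theorem exists_pres_tree (C : P.Constel) : ∃ f, Pres C (tree C) (dots C) f :=
  (exists_pres C).choose_spec.choose_spec

theorem Pres.tree_eq {C : P.Constel} {M d f} (h : Pres C M d f) :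
    (⟨tree C, (dots C).symm⟩ : Σ M : P.plus.toPolyEndo.Tree, (Fin C.nest.dots → M.1.Node)) =
      ⟨M, d.symm⟩ := by
  obtain ⟨f', h'⟩ := exists_pres_tree C
  exact h'.unique h

theorem Pres.mark_eq {C : P.Constel} {M d f} (h : Pres C M d f) (x : Fin C.nest.dots) :
    (⟨tree C, (dots C).symm x⟩ : Σ M : P.plus.toPolyEndo.Tree, M.1.Node) = ⟨M, d.symm x⟩ :=
  congrArg (fun y : Σ M : P.plus.toPolyEndo.Tree, (Fin C.nest.dots → M.1.Node) =>
    (⟨y.1, y.2 x⟩ : Σ M : P.plus.toPolyEndo.Tree, M.1.Node)) h.tree_eq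

/-- The composition tree, on isomorphism classes. -/
noncomputable def constTree : P.toPolyEndo.Const → P.plus.toPolyEndo.Tree :=
  Quotient.lift tree fun C C' ⟨φ⟩ => by
    obtain ⟨f, h⟩ := exists_pres_tree C
    exact (congrArg Sigma.fst (h.map φ).tree_eq).symm

/-- The marked composition tree, on isomorphism classes. -/
noncomputable def markTree : P.toPolyEndo.MarkedConst → Σ M : P.plus.toPolyEndo.Tree, M.1.Node :=
  Quotient.lift (fun C : Σ C : P.Constel, Fin C.nest.dots => ⟨tree C.1, (dots C.1).symm C.2⟩) (by
    rintro ⟨C, x⟩ ⟨C', x'⟩ ⟨φ, hφ⟩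
    obtain ⟨f, h⟩ := exists_pres_tree C
    refine Eq.symm (((h.map φ).mark_eq x').trans (congrArg (Sigma.mk _) ?_))
    refine congrArg (dots C).symm (φ.dot.injective ?_)
    exact (φ.dot.apply_symm_apply x').trans hφ.symm)

theorem Pres.constTree_eq {C : P.Constel} {M d f} (h : Pres C M d f) : constTree C.cls = M :=
  congrArg Sigma.fst h.tree_eq

theorem Pres.markTree_eq {C : P.Constel} {M d f} (h : Pres C M d f) (x : Fin C.nest.dots) :
    markTree (C.markedCls x) = ⟨M, d.symm x⟩ :=
  h.mark_eq x

/-- Injectivity: a composition tree determines the constellation up to isomorphism. Surjectivity: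
every `P⁺`-tree has a constellation, by `exists_constel`. -/
theorem constTree_bijective : Function.Bijective (constTree (P := P)) := by
  constructor
  · intro c c'
    induction c using Quotient.inductionOn with | _ C => ?_
    induction c' using Quotient.inductionOn with | _ C' => ?_
    intro h
    obtain ⟨M, d, f, hC⟩ := exists_pres C
    obtain ⟨M', d', f', hC'⟩ := exists_pres C'
    obtain rfl : M = M' := hC.constTree_eq.symm.trans (h.trans hC'.constTree_eq)
    obtain ⟨φ, -⟩ := hC.exists_iso hC'
    exact Quotient.sound ⟨φ⟩
  · intro M
    obtain ⟨C, d, f, h⟩ := exists_constel M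
    exact ⟨C.cls, h.constTree_eq⟩

theorem markTree_bijective : Function.Bijective (markTree (P := P)) := by
  constructor
  · intro c c'
    induction c using Quotient.inductionOn with | _ C => ?_
    induction c' using Quotient.inductionOn with | _ C' => ?_
    obtain ⟨C, x⟩ := C
    obtain ⟨C', x'⟩ := C'
    intro h
    obtain ⟨M, d, f, hC⟩ := exists_pres C
    obtain ⟨M', d', f', hC'⟩ := exists_pres C'
    have h : (⟨M, d.symm x⟩ : Σ M : P.plus.toPolyEndo.Tree, M.1.Node) = ⟨M', d'.symm x'⟩ :=
      (hC.markTree_eq x).symm.trans (h.trans (hC'.markTree_eq x'))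
    obtain rfl : M = M' := congrArg Sigma.fst h
    have h := eq_of_heq (Sigma.mk.inj h).2
    -- This isomorphism matches layers through the nodes of the common composition tree, so it also
    -- matches the marks.
    obtain ⟨φ, hφ⟩ := hC.exists_iso hC'
    exact Quotient.sound ⟨φ, (hφ x).trans ((congrArg d' h).trans (d'.apply_symm_apply x'))⟩
  · rintro ⟨M, n⟩
    obtain ⟨C, d, f, h⟩ := exists_constel M
    exact ⟨C.markedCls (d n), (h.markTree_eq _).trans
      (congrArg (Sigma.mk M) (d.symm_apply_apply n))⟩

theorem fst_markTree (q : P.toPolyEndo.MarkedConst) : (markTree q).1 = constTree q.unmark := by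
  induction q using Quotient.inductionOn with | _ C => rfl

/-- The layers of a constellation are the nodes of its composition tree. -/
noncomputable def markEquiv (c : P.toPolyEndo.Const) :
    {q : P.toPolyEndo.MarkedConst // q.unmark = c} ≃ (constTree c).1.Node :=
  ((Equiv.ofBijective _ markTree_bijective).subtypeEquiv fun q => by
    refine Iff.trans ?_ (Eq.congr_left (fst_markTree q)).symm
    exact constTree_bijective.1.eq_iff.symm).trans (Equiv.sigmaSubtype (constTree c))

theorem markEquiv_eq (c : P.toPolyEndo.Const)
    (q : {q : P.toPolyEndo.MarkedConst // q.unmark = c}) :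
    (⟨constTree c, markEquiv c q⟩ : Σ M : P.plus.toPolyEndo.Tree, M.1.Node) = markTree q.1 := by
  have := (Equiv.sigmaSubtype (constTree c)).symm_apply_apply
    ((Equiv.ofBijective _ markTree_bijective).subtypeEquiv (p := fun q => q.unmark = c)
      (q := fun s => s.1 = constTree c) (fun q => by
    refine Iff.trans ?_ (Eq.congr_left (fst_markTree q)).symm
    exact constTree_bijective.1.eq_iff.symm) q)
  exact congrArg Subtype.val this

/-- Erasing the white dots amounts to removing units from the expansion, which leaves the composite
of `M`. This gives the compatibility with the target maps, and also keeps track of the names. -/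
theorem Pres.underLab_eq {C : P.Constel} {M d f} (h : Pres C M d f) :
    C.underLab = (P.plus.tot M.1 M.2).1.1.mkLab fun q => f ((P.plus.leafAr M.1 M.2).symm q) := by
  refine (unwhite_fillWhite C.tree.1).symm.trans ?_
  change unwhite (filled C).1 = _
  rw [← h.expand_eq]
  exact unwhite_expand M.1 M.2 d f

theorem Pres.underlying_eq {C : P.Constel} {M d f} (h : Pres C M d f) :
    C.underlying = P.plus.target M := by
  refine Subtype.ext ((congrArg forget h.underLab_eq).trans (forget_mkLab _ _))

theorem Named.layerTree_eq {C : P.Constel} {M : P.plus.PTree} {d f} (h : Named C M d f)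
    (n : M.Node) : layerTree C (d n) = M.dec n := by
  refine Subtype.ext ((congrArg forget (h.1 n)).trans (forget_lay _ _ _ _))

/-- The identification of constellations with trees of `P`-trees. -/
noncomputable def constIso (P : PolyMonad I) : EndoIso P.constEndo P.plus.plus where
  op := Equiv.ofBijective _ constTree_bijective
  ar := markEquiv
  tgt_op c := by
    induction c using Quotient.inductionOn with | _ C => ?_
    obtain ⟨M, d, f, h⟩ := exists_pres C
    exact (congrArg P.plus.target h.constTree_eq).trans h.underlying_eq.symm
  src_ar c q := by
    have h1 := congrArg (fun s : Σ M : P.plus.toPolyEndo.Tree, M.1.Node => s.1.1.dec s.2)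
      (markEquiv_eq c q)
    refine h1.trans ?_
    obtain ⟨q, -⟩ := q
    induction q using Quotient.inductionOn with | _ C => ?_
    obtain ⟨C, x⟩ := C
    obtain ⟨f, h⟩ := exists_pres_tree C
    refine (h.named.layerTree_eq _).symm.trans ?_
    exact congrArg (layerTree C) ((dots C).apply_symm_apply x)

/-- The constructor `CompTree.dot` asks for the tree seen in the layer itself; this version admits a
labelled tree that is merely equal to it. -/
theorem compTree_dot (C : P.Constel) (x : Fin C.nest.dots) (T : P.toPolyEndo.Tree)
    (a : T.1.Node → C.nest.Elt) (ch : T.1.Node → (P.plus.toPolyEndo.lab (Fin C.nest.dots)).PreTree)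
    (h : layerLab C x = T.1.mkLab a) (hch : ∀ n, CompTree C (a n) (ch n)) :
    CompTree C (.inl x) (node (P := P.plus.toPolyEndo.lab (Fin C.nest.dots)) (T, x) ch) := by
  obtain ⟨h1, h2⟩ := Sigma.mk.inj (mkLab_sigma_eq ((mkLab_nodeLab (layerLab C x)).trans h))
  obtain rfl : layerTree C x = T := Subtype.ext h1
  obtain rfl : (layerLab C x).nodeLab = a := eq_of_heq h2
  exact .dot x ch hch

theorem Named.compTree {C : P.Constel} {M : P.plus.PTree} {d : M.Node → Fin C.nest.dots} {f}
    (h : Named C M d f) : CompTree C (rt M d f) (M.mkLab d) := by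
  induction M with
  | edge b =>
    obtain ⟨n, hn⟩ := h.2 PUnit.unit
    exact .leaf n b _ hn
  | node T ch ih =>
    exact compTree_dot C (d none) T _ _ (h.1 none) fun n => ih n
      ⟨fun p => h.1 (some ⟨n, p⟩), fun l => h.2 ⟨n, l⟩⟩

theorem Pres.isCompositionTree {C : P.Constel} {M d f} (h : Pres C M d f) :
    IsCompositionTree C M.1 d.symm := by
  refine ⟨M.1.mkLab d, h.rt_eq ▸ h.named.compTree, forget_mkLab _ _, ?_⟩
  have key : ∀ (T : P.plus.PTree) (b : T.Node → Fin C.nest.dots)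
      (_ : (⟨M.1, d⟩ : Σ T : P.plus.PTree, (T.Node → Fin C.nest.dots)) = ⟨T, b⟩) (n : T.Node),
      (⟨T, n⟩ : Σ T : P.plus.toPolyEndo.PreTree, T.Node) = ⟨M.1, d.symm (b n)⟩ := by
    intro T b h n
    cases h
    rw [d.symm_apply_apply]
  exact key _ _ (mkLab_sigma_eq (mkLab_nodeLab (M.1.mkLab d))).symm

theorem isCompositionTree_constIso (C : P.Constel) :
    IsCompositionTree C ((constIso P).op C.cls).1
      fun x => (constIso P).ar C.cls ⟨C.markedCls x, rfl⟩ := by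
  obtain ⟨M, d, f, h⟩ := exists_pres C
  have key : ∀ (M' : P.plus.toPolyEndo.Tree) (ν : Fin C.nest.dots → M'.1.Node), M' = M →
      (∀ x, (⟨M', ν x⟩ : Σ M : P.plus.toPolyEndo.Tree, M.1.Node) = ⟨M, d.symm x⟩) →
      IsCompositionTree C M'.1 ν := by
    rintro M' ν rfl hν
    obtain rfl : ν = d.symm := funext fun x => eq_of_heq (Sigma.mk.inj (hν x)).2
    exact h.isCompositionTree
  exact key _ _ h.constTree_eq fun x =>
    (markEquiv_eq C.cls ⟨C.markedCls x, rfl⟩).trans (h.markTree_eq x)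

end PolyMonad

/-! ### Layers of a substituted tree -/

namespace PolyEndo.PreTree

variable {I : Type u} {Q : PolyEndo I}

/-- The node or leaf sitting on an input of a node. -/
def child : (M : PreTree Q) → (p : M.Node) → Q.Ar (M.dec p) → M.Node ⊕ M.Leaf
  | edge _, p, _ => p.elim
  | node _ ch, none, e => incl e (rt (ch e) id id)
  | node _ ch, some p, e => incl p.1 ((ch p.1).child p.2 e)

end PolyEndo.PreTree

namespace PolyMonad

open PolyEndo PreTree

section

variable {I : Type u} (Q : PolyMonad I)

theorem leafType_substLeaf (M : Q.PTree) (F : M.Node → Q.toPolyEndo.Tree)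
    (h : ∀ n, Q.target (F n) = M.dec n) (l : (Q.subst M F h).Leaf) :
    (Q.subst M F h).leafType l = M.leafType (Q.substLeaf M F h l) := by
  induction M with
  | edge i => rfl
  | node b ch ih => exact (leafType_graftLeaf _ _ l).trans (ih _ _ _ _)

/-- Leaves are the inputs of the total operation, and substitution does not change the total
operation. -/
theorem substLeaf_bijective (M : Q.PTree) (F : M.Node → Q.toPolyEndo.Tree)
    (h : ∀ n, Q.target (F n) = M.dec n) (v : M.Valid) : Function.Bijective (Q.substLeaf M F h) := by
  have vS := (Q.valid_subst M F h v).1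
  obtain ⟨h1, h2⟩ := Q.tot_subst M F h v vS
  have inj : ∀ (T : Q.PTree) (v : T.Valid) (l l' : T.Leaf),
      (⟨_, Q.leafAr T v l⟩ : Q.Input) = ⟨_, Q.leafAr T v l'⟩ → l = l' := fun T v l l' h =>
    (Q.leafAr T v).injective (eq_of_heq (Sigma.mk.inj h).2)
  constructor
  · intro l l' hl
    refine inj _ vS _ _ ((h2 l).trans (Eq.trans ?_ (h2 l').symm))
    rw [hl]
  · intro l
    have key : ∀ (b : Q.Op) (e : Q.Ar b) (b' : Q.Op) (_ : b' = b),
        ∃ e' : Q.Ar b', (⟨b', e'⟩ : Q.Input) = ⟨b, e⟩ := by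
      rintro b e _ rfl
      exact ⟨e, rfl⟩
    obtain ⟨e, he⟩ := key _ (Q.leafAr M v l) _ h1
    obtain ⟨L, rfl⟩ := (Q.leafAr _ vS).surjective e
    exact ⟨L, inj _ v _ _ ((h2 L).symm.trans he)⟩

/-- Here `γ` says what takes the place of a node or leaf of `M` after substitution, and `η` does so
for the leaves of the trees substituted. If `F p` is a unit tree, the node `p` disappears and its
place is taken by whatever replaces its child; so the two maps depend on each other and are defined
together by recursion from the leaves of `M`. -/
theorem exists_names {D L : Type} (M : Q.PTree) (F : M.Node → Q.toPolyEndo.Tree)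
    (h : ∀ n, Q.target (F n) = M.dec n) (ν : ∀ p, (F p).1.Node → D) (κ : M.Leaf → L) :
    ∃ (γ : M.Node ⊕ M.Leaf → D ⊕ L) (η : ∀ p, (F p).1.Leaf → D ⊕ L),
      (∀ l, γ (.inr l) = .inr (κ l)) ∧
      (∀ p, γ (.inl p) = Sum.elim (fun m => .inl (ν p m)) (η p) (rt (F p).1 id id)) ∧
      ∀ p l, η p l = γ (M.child p (Q.leafTo (F p) (h p) l)) := by
  induction M with
  | edge i => exact ⟨Sum.elim (fun p => p.elim) fun l => .inr (κ l), fun p => p.elim,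
      fun _ => rfl, fun p => p.elim, fun p => p.elim⟩
  | node b ch ih =>
    choose γ η h1 h2 h3 using fun e => ih e (fun p => F (some ⟨e, p⟩)) (fun p => h (some ⟨e, p⟩))
      (fun p => ν (some ⟨e, p⟩)) fun l => κ ⟨e, l⟩
    -- A leaf of the tree put into the root node stands for the branch on the corresponding input,
    -- hence for what replaces the root of that branch.
    let η' : ∀ p, (F p).1.Leaf → D ⊕ L := fun p => match p with
      | none => fun l => γ _ (rt (ch (Q.leafTo (F none) (h none) l)) id id)
      | some p => η p.1 p.2
    let γ' : (node b ch).Node ⊕ (node b ch).Leaf → D ⊕ L := fun w => match w with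
      | .inl none => Sum.elim (fun m => .inl (ν none m)) (η' none) (rt (F none).1 id id)
      | .inl (some p) => γ p.1 (.inl p.2)
      | .inr l => γ l.1 (.inr l.2)
    have hincl : ∀ e w, γ' (incl e w) = γ e w := by
      rintro e (w | w) <;> rfl
    refine ⟨γ', η', fun l => h1 l.1 l.2, fun p => ?_, fun p l => ?_⟩
    · match p with
      | none => rfl
      | some p => exact h2 p.1 p.2
    · match p with
      | none => exact (hincl _ _).symm
      | some p => exact (h3 p.1 p.2 l).trans (hincl _ _).symm

end

variable {I : Type u} {P : PolyMonad I} {D L D' L' : Type}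

theorem lay_eq_mkLab (M : P.plus.PTree) (d : M.Node → D) (f : M.Leaf → L) (p : M.Node) :
    lay M d f p = (M.dec p).1.mkLab fun e => Sum.map d f (M.child p e) := by
  induction M with
  | edge b => exact p.elim
  | node T ch ih =>
    match p with
    | none =>
      exact congrArg T.1.mkLab (funext fun n => (rt_eq_map (ch n) _ _).trans
        (map_incl (Q := P.plus.toPolyEndo) (ch := ch) d f n _).symm)
    | some ⟨e, p⟩ =>
      refine (ih e _ _ p).trans (congrArg (mkLab _) (funext fun n => ?_))
      exact (map_incl (Q := P.plus.toPolyEndo) (ch := ch) d f e _).symm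

/-- Grafting leaves every node with its decoration; in the layers of the lower tree `U` it only
replaces the name of a leaf by the name of the root of the tree grafted there, which is what `h`
does. -/
theorem lay_graft {A B : Type} (U : P.plus.PTree) (X : U.Leaf → P.plus.PTree) (a : U.Node → A)
    (b : U.Leaf → B) (h : A ⊕ B → D' ⊕ L') (ν₁ : A → D') (ν₂ : ∀ l, (X l).Node → D')
    (κ : ∀ l, (X l).Leaf → L') (h1 : ∀ x, h (.inl x) = .inl (ν₁ x))
    (h2 : ∀ l, h (.inr (b l)) = rt (X l) (ν₂ l) (κ l)) :
    rt (U.graft X) (fun q => Sum.elim (fun m => ν₁ (a m)) (fun m => ν₂ m.1 m.2) (U.graftNode X q))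
      (fun k => κ (U.graftLeaf X k).1 (U.graftLeaf X k).2) = h (rt U a b) ∧
    ∀ q, lay (U.graft X)
      (fun q => Sum.elim (fun m => ν₁ (a m)) (fun m => ν₂ m.1 m.2) (U.graftNode X q))
      (fun k => κ (U.graftLeaf X k).1 (U.graftLeaf X k).2) q =
      Sum.elim (fun m => (lay U a b m).mapLab h) (fun m => lay (X m.1) (ν₂ m.1) (κ m.1) m.2)
        (U.graftNode X q) := by
  induction U with
  | edge i => exact ⟨(h2 PUnit.unit).symm, fun q => rfl⟩
  | node T ch ih =>
    have H := fun n => ih n (fun l => X ⟨n, l⟩) (fun m => a (some ⟨n, m⟩)) (fun l => b ⟨n, l⟩)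
      (fun l => ν₂ ⟨n, l⟩) (fun l => κ ⟨n, l⟩) (fun l => h2 ⟨n, l⟩)
    have K : ∀ n, (fun q => Sum.elim (fun m => ν₁ (a m)) (fun m => ν₂ m.1 m.2)
        ((node (P := P.plus.toPolyEndo) T ch).graftNode X (some ⟨n, q⟩))) =
        fun q => Sum.elim (fun m => ν₁ (a (some ⟨n, m⟩))) (fun m => ν₂ ⟨n, m.1⟩ m.2)
          ((ch n).graftNode (fun k => X ⟨n, k⟩) q) := by
      intro n
      funext q
      simp only [graftNode]
      cases (ch n).graftNode (fun k => X ⟨n, k⟩) q <;> rfl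
    refine ⟨(h1 _).symm, fun q => ?_⟩
    match q with
    | none =>
      refine Eq.trans (congrArg T.1.mkLab (funext fun n => ?_)) (mapLab_mkLab _ _ _).symm
      exact (congrArg (fun ν => rt ((ch n).graft fun k => X ⟨n, k⟩) ν _) (K n)).trans (H n).1
    | some ⟨n, q⟩ =>
      refine (congrArg (fun ν => lay ((ch n).graft fun k => X ⟨n, k⟩) ν _ q) (K n)).trans
        (((H n).2 q).trans ?_)
      simp only [graftNode]
      cases (ch n).graftNode (fun k => X ⟨n, k⟩) q <;> rfl

/-- Each layer of the result is a layer of one of the trees `F p`. A node of that layer which leads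
to a leaf of `F p` now leads to what replaces the corresponding child of `p`, as expressed by `h2`.
The first half, on the root, is what makes the induction over branches work. -/
theorem lay_subst (M : P.plus.PTree) (F : M.Node → P.plus.toPolyEndo.Tree)
    (hF : ∀ p, P.plus.target (F p) = M.dec p) {X Y : M.Node → Type}
    (a : ∀ p, (F p).1.Node → X p) (b : ∀ p, (F p).1.Leaf → Y p)
    (γ : M.Node ⊕ M.Leaf → D' ⊕ L') (h : ∀ p, X p ⊕ Y p → D' ⊕ L') (ν : ∀ p, X p → D')
    (κ : M.Leaf → L') (h1 : ∀ p x, h p (.inl x) = .inl (ν p x))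
    (h2 : ∀ p l, h p (.inr (b p l)) = γ (M.child p (P.plus.leafTo (F p) (hF p) l)))
    (h3 : ∀ l, γ (.inr l) = .inr (κ l))
    (h4 : ∀ p, γ (.inl p) = h p (rt (F p).1 (a p) (b p))) :
    rt (P.plus.subst M F hF) (fun q => ν _ (a _ (P.plus.substNode M F hF q).2))
      (fun l => κ (P.plus.substLeaf M F hF l)) = γ (rt M id id) ∧
    ∀ q, lay (P.plus.subst M F hF) (fun q => ν _ (a _ (P.plus.substNode M F hF q).2))
      (fun l => κ (P.plus.substLeaf M F hF l)) q =
      (lay (F (P.plus.substNode M F hF q).1).1 (a _) (b _) (P.plus.substNode M F hF q).2).mapLab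
        (h _) := by
  induction M with
  | edge i => exact ⟨(h3 PUnit.unit).symm, fun q => q.elim⟩
  | node T ch ih =>
    have H := fun n => ih n (fun p => F (some ⟨n, p⟩)) (fun p => hF (some ⟨n, p⟩))
      (fun p => a (some ⟨n, p⟩)) (fun p => b (some ⟨n, p⟩)) (fun w => γ (incl n w))
      (fun p => h (some ⟨n, p⟩)) (fun p => ν (some ⟨n, p⟩)) (fun l => κ ⟨n, l⟩)
      (fun p => h1 (some ⟨n, p⟩)) (fun p => h2 (some ⟨n, p⟩)) (fun l => h3 ⟨n, l⟩)
      (fun p => h4 (some ⟨n, p⟩))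
    let S : (F none).1.Leaf → P.plus.PTree := fun l =>
      P.plus.subst (ch (P.plus.leafTo (F none) (hF none) l)) (fun n => F (some ⟨_, n⟩))
        fun n => hF (some ⟨_, n⟩)
    have G := lay_graft (F none).1 S (a none) (b none) (h none) (ν none)
      (fun l q => ν _ (a _ (P.plus.substNode (ch (P.plus.leafTo (F none) (hF none) l))
        (fun n => F (some ⟨_, n⟩)) (fun n => hF (some ⟨_, n⟩)) q).2))
      (fun l k => κ ⟨_, P.plus.substLeaf (ch (P.plus.leafTo (F none) (hF none) l))
        (fun n => F (some ⟨_, n⟩)) (fun n => hF (some ⟨_, n⟩)) k⟩) (h1 none)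
      (fun l => (h2 none l).trans (H _).1.symm)
    have K : (fun q => ν _ (a _ (P.plus.substNode (node (P := P.plus.toPolyEndo) T ch) F hF q).2)) =
        fun q => Sum.elim (fun m => ν none (a none m))
          (fun m => ν _ (a _ (P.plus.substNode (ch (P.plus.leafTo (F none) (hF none) m.1))
            (fun n => F (some ⟨_, n⟩)) (fun n => hF (some ⟨_, n⟩)) m.2).2))
          ((F none).1.graftNode S q) := by
      funext q
      simp only [substNode]
      cases (F none).1.graftNode S q <;> rfl
    refine ⟨(congrArg (fun ν => rt ((F none).1.graft S) ν _) K).trans (G.1.trans (h4 none).symm),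
      fun q => (congrArg (fun ν => lay ((F none).1.graft S) ν _ q) K).trans ((G.2 q).trans ?_)⟩
    have fin : ∀ s : (F none).1.Node ⊕ Σ l, (S l).Node,
        Sum.elim (fun m => (lay (F none).1 (a none) (b none) m).mapLab (h none))
          (fun m => lay (S m.1) (fun q => ν _ (a _ (P.plus.substNode
              (ch (P.plus.leafTo (F none) (hF none) m.1))
              (fun n => F (some ⟨_, n⟩)) (fun n => hF (some ⟨_, n⟩)) q).2))
            (fun k => κ ⟨_, P.plus.substLeaf (ch (P.plus.leafTo (F none) (hF none) m.1))
              (fun n => F (some ⟨_, n⟩)) (fun n => hF (some ⟨_, n⟩)) k⟩) m.2) s =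
        (fun r : Σ n, (F n).1.Node => (lay (F r.1).1 (a r.1) (b r.1) r.2).mapLab (h r.1))
          (Sum.elim (fun m => ⟨none, m⟩) (fun m =>
            let r := P.plus.substNode (ch (P.plus.leafTo (F none) (hF none) m.1))
              (fun n => F (some ⟨_, n⟩)) (fun n => hF (some ⟨_, n⟩)) m.2
            ⟨some ⟨_, r.1⟩, r.2⟩) s) := by
      rintro (m | m)
      · rfl
      · exact (H _).2 m.2
    exact fin _

end PolyMonad

/-! ### Substitution of constellations is substitution of composition trees -/

namespace PolyEndo.PreTree

variable {I : Type u} {P : PolyEndo I} {D L Y Z : Type}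

theorem exists_dec_erase (T : PreTree (P.subdiv L D)) (b : P.Op) (l : L) :
    (∃ n, T.dec n = .inl (b, l)) ↔ ∃ n, T.erase.dec n = (b, l) := by
  induction T with
  | edge i => exact ⟨fun ⟨n, _⟩ => n.elim, fun ⟨n, _⟩ => n.elim⟩
  | node c ch ih =>
    rcases c with c | c
    · constructor
      · rintro ⟨n, hn⟩
        match n with
        | none => exact ⟨none, Sum.inl.inj hn⟩
        | some ⟨e, n⟩ =>
          obtain ⟨m, hm⟩ := (ih e).1 ⟨n, hn⟩
          exact ⟨some ⟨e, m⟩, hm⟩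
      · rintro ⟨n, hn⟩
        match n with
        | none => exact ⟨none, congrArg Sum.inl hn⟩
        | some ⟨e, n⟩ =>
          obtain ⟨m, hm⟩ := (ih e).2 ⟨n, hn⟩
          exact ⟨some ⟨e, m⟩, hm⟩
    · refine Iff.trans ?_ (ih PUnit.unit)
      constructor
      · rintro ⟨n, hn⟩
        match n with
        | none => cases hn
        | some ⟨_, n⟩ => exact ⟨n, hn⟩
      · rintro ⟨n, hn⟩
        exact ⟨some ⟨PUnit.unit, n⟩, hn⟩

theorem exists_dec_mapLab (f : Y → Z) (T : PreTree (P.lab Y)) (n : T.Node) :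
    ∃ m, (T.mapLab f).dec m = ((T.dec n).1, f (T.dec n).2) := by
  induction T with
  | edge i => exact n.elim
  | node b ch ih =>
    match n with
    | none => exact ⟨none, rfl⟩
    | some ⟨e, n⟩ =>
      obtain ⟨m, hm⟩ := ih e n
      exact ⟨some ⟨e, m⟩, hm⟩

end PolyEndo.PreTree

namespace PolyMonad

open PolyEndo PreTree

variable {I : Type u} {P : PolyMonad I}

theorem mkLab_tot_iff {Z : Type} (N : P.plus.toPolyEndo.Tree) (T : P.toPolyEndo.Tree)
    (h : P.plus.target N = T) (a : N.1.Leaf → Z) (c : T.1.Node → Z) :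
    (P.plus.tot N.1 N.2).1.1.mkLab (fun q => a ((P.plus.leafAr N.1 N.2).symm q)) = T.1.mkLab c ↔
      ∀ l, a l = c (P.plus.leafTo N h l) := by
  subst h
  constructor
  · intro h l
    have := congrFun (mkLab_injective h) (P.plus.leafAr N.1 N.2 l)
    refine Eq.trans (congrArg a ?_) this
    exact ((P.plus.leafAr N.1 N.2).symm_apply_apply l).symm
  · intro h
    refine congrArg (mkLab _) (funext fun q => (h _).trans (congrArg c ?_))
    exact (P.plus.leafAr N.1 N.2).apply_symm_apply q

/-- The condition matching the nodes of the tree seen in a layer of `C` with the dots of the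
constellation substituted into that layer. -/
theorem mapLab_layerLab_iff {Z : Type} {C G : P.Constel} {M : P.plus.toPolyEndo.Tree} {d f}
    (hC : Pres C M d f) {N : P.plus.toPolyEndo.Tree} {d' f'} (hG : Pres G N d' f') (p : M.1.Node)
    (h : P.plus.target N = M.1.dec p) (a : Fin G.nest.leaves → Z) (g : C.nest.Elt → Z) :
    G.underLab.mapLab a = (layerLab C (d p)).mapLab g ↔
      ∀ l, a (f' l) = g (Sum.map d f (M.1.child p (P.plus.leafTo N h l))) := by
  rw [hG.underLab_eq, hC.named.1 p, lay_eq_mkLab]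
  refine Iff.trans ?_ (mkLab_tot_iff N (M.1.dec p) h (fun l => a (f' l))
    fun e => g (Sum.map d f (M.1.child p e)))
  exact Eq.congr (mapLab_mkLab _ _ _) (mapLab_mkLab _ _ _)

variable {C D : P.Constel} {F : Fin C.nest.dots → P.Constel} {M : P.plus.toPolyEndo.Tree}
  {d : M.1.Node ≃ Fin C.nest.dots} {f : M.1.Leaf ≃ Fin C.nest.leaves}
  {N : Fin C.nest.dots → P.plus.toPolyEndo.Tree} {dF : ∀ x, (N x).1.Node ≃ Fin (F x).nest.dots}
  {fF : ∀ x, (N x).1.Leaf ≃ Fin (F x).nest.leaves}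

/-- The composition tree of the result of a substitution. -/
theorem IsSubst.tree_eq {s} (hs : IsSubst C F D s) (hC : Pres C M d f)
    (hF : ∀ x, Pres (F x) (N x) (dF x) (fF x)) (h : ∀ p, P.plus.target (N (d p)) = M.1.dec p)
    {MD : P.plus.toPolyEndo.Tree} {dD fD} (hD : Pres D MD dD fD) :
    (⟨P.plus.substTree M (fun p => N (d p)) h,
      fun q => s ⟨d _, dF _ (P.plus.substNode M.1 (fun p => N (d p)) h q).2⟩⟩ :
        Σ M : P.plus.toPolyEndo.Tree, (M.1.Node → Fin D.nest.dots)) = ⟨MD, dD⟩ := by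
  obtain ⟨g, η, k, e1, e2, e3, e4, e5, e6, e7⟩ := hs
  -- The maps in `IsSubst` are, after passing to composition trees, the renaming data required by
  -- `lay_subst`. It follows that the substituted tree is named by `D`, and uniqueness of such
  -- namings identifies it with the composition tree of `D`.
  obtain ⟨h1, h2⟩ := lay_subst M.1 (fun p => N (d p)) h (fun p => dF (d p)) (fun p => fF (d p))
    (fun w => g (Sum.map d f w)) (fun p => η (d p)) (fun p y => s ⟨d p, y⟩) (fun l => k (f l))
    (fun p => e5 (d p)) (fun p => (mapLab_layerLab_iff hC (hF (d p)) p (h p) _ g).1 (e6 (d p)))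
    (fun l => e2 _) (fun p => (e3 (d p)).trans (congrArg (η (d p)) (hF (d p)).rt_eq.symm))
  have hN : Named D (P.plus.subst M.1 (fun p => N (d p)) h)
      (fun q => s ⟨d _, dF _ (P.plus.substNode M.1 (fun p => N (d p)) h q).2⟩)
      (fun l => k (f (P.plus.substLeaf M.1 (fun p => N (d p)) h l))) := by
    refine ⟨fun q => ?_, fun l => ?_⟩
    · refine (e7 _ _).trans (Eq.trans ?_ (h2 q).symm)
      exact congrArg (mapLab (η _)) ((hF _).named.1 _)
    · obtain ⟨n, hn⟩ := hC.named.2 (P.plus.substLeaf M.1 (fun p => N (d p)) h l)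
      obtain ⟨m, hm⟩ := (exists_dec_erase C.tree.1 _ _).1 ⟨n, hn⟩
      obtain ⟨m', hm'⟩ := exists_dec_mapLab k C.tree.1.erase m
      rw [hm] at hm'
      obtain ⟨n', hn'⟩ := (exists_dec_erase D.tree.1 _ _).2 ((congrArg
        (fun U : (P.toPolyEndo.lab (Fin D.nest.leaves)).PreTree => ∃ m, U.dec m = (_, _)) e1).mpr
          ⟨m', hm'⟩)
      refine ⟨n', hn'.trans ?_⟩
      rw [P.plus.leafType_substLeaf]
  have hU := hN.unique hD.named (h1.trans (((congrArg g (rt_eq_map M.1 d f).symm).trans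
    (congrArg g hC.rt_eq)).trans (e4.trans hD.rt_eq.symm)))
  obtain ⟨MD, vD⟩ := MD
  obtain ⟨h3, h4⟩ := Sigma.mk.inj hU
  dsimp only at h3
  subst h3
  exact congrArg (Sigma.mk _) (Prod.mk.inj (eq_of_heq h4)).1

/-- The nodes of the substituted tree are the pairs given by `substNode`, and this is the bijection
`s` of layers. The remaining maps are those of `exists_names`, and `lay_subst` compares the layers.
-/
theorem exists_isSubst (hC : Pres C M d f) (hF : ∀ x, Pres (F x) (N x) (dF x) (fF x))
    (h : ∀ p, P.plus.target (N (d p)) = M.1.dec p) {dD fD}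
    (hD : Pres D (P.plus.substTree M (fun p => N (d p)) h) dD fD) : ∃ s, IsSubst C F D s := by
  let en := Equiv.ofBijective _ (P.plus.substNode_bijective M.1 (fun p => N (d p)) h)
  let el := Equiv.ofBijective _ (P.plus.substLeaf_bijective M.1 (fun p => N (d p)) h M.2)
  obtain ⟨γ, η, h1, h2, h3⟩ := P.plus.exists_names M.1 (fun p => N (d p)) h
    (fun p m => dD (en.symm ⟨p, m⟩)) (fun l => fD (el.symm l))
  let S : (Σ p, (N (d p)).1.Node) ≃ Σ x, Fin (F x).nest.dots :=
    (Equiv.sigmaCongrLeft (β := fun x => (N x).1.Node) d).trans (Equiv.sigmaCongrRight dF)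
  let s : (Σ x, Fin (F x).nest.dots) ≃ Fin D.nest.dots := S.symm.trans (en.symm.trans dD)
  have hs : ∀ p m, s ⟨d p, dF _ m⟩ = dD (en.symm ⟨p, m⟩) := fun p m =>
    congrArg (fun r => dD (en.symm r)) (S.symm_apply_apply ⟨p, m⟩)
  let θ : ∀ p, (F (d p)).nest.Elt → D.nest.Elt := fun p =>
    Sum.elim (fun y => .inl (s ⟨d p, y⟩)) fun l => η p ((fF (d p)).symm l)
  have hγ : ∀ p, γ (.inl p) = θ p (rt (N (d p)).1 (dF (d p)) (fF (d p))) := by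
    intro p
    rw [h2 p, rt_eq_map (N (d p)).1 (dF (d p)) (fF (d p))]
    rcases rt (N (d p)).1 id id with m | l
    · exact congrArg Sum.inl (hs p m).symm
    · exact congrArg (η p) ((fF (d p)).symm_apply_apply l).symm
  have hη : ∀ p l, θ p (.inr (fF (d p) l)) =
      γ (M.1.child p (P.plus.leafTo (N (d p)) (h p) l)) := fun p l =>
    (congrArg (η p) ((fF (d p)).symm_apply_apply l)).trans (h3 p l)
  obtain ⟨h4, h5⟩ := lay_subst M.1 (fun p => N (d p)) h (fun p => dF (d p)) (fun p => fF (d p))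
    γ θ (fun p y => s ⟨d p, y⟩) (fun l => fD (el.symm l)) (fun p y => rfl) hη h1 hγ
  have hν : (fun q => s ⟨d _, dF _ (P.plus.substNode M.1 (fun p => N (d p)) h q).2⟩) = dD :=
    funext fun q => (hs _ _).trans (congrArg dD (en.symm_apply_apply q))
  have hκ : (fun l => fD (el.symm (P.plus.substLeaf M.1 (fun p => N (d p)) h l))) = fD :=
    funext fun l => congrArg fD (el.symm_apply_apply l)
  rw [hν, hκ] at h4 h5
  have hg : ∀ w, γ (Sum.map d.symm f.symm (Sum.map d f w)) = γ w := fun w => congrArg γ (by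
    rw [Sum.map_map, Equiv.symm_comp_self, Equiv.symm_comp_self, Sum.map_id_id, id])
  -- The map `θ` is indexed by nodes of `M`; asserting only existence for each sphere `x` allows `x`
  -- to be replaced by some `d p`, which avoids transport.
  have H : ∀ x, ∃ θ : (F x).nest.Elt → D.nest.Elt,
      γ (.inl (d.symm x)) = θ (F x).nest.root ∧ (∀ y, θ (.inl y) = .inl (s ⟨x, y⟩)) ∧
      (F x).underLab.mapLab (fun l => θ (.inr l)) =
        (layerLab C x).mapLab (fun w => γ (Sum.map d.symm f.symm w)) ∧
      ∀ y, layerLab D (s ⟨x, y⟩) = (layerLab (F x) y).mapLab θ := by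
    intro x
    obtain ⟨p, rfl⟩ := d.surjective x
    refine ⟨θ p, ?_, fun y => rfl, ?_, fun y => ?_⟩
    · rw [d.symm_apply_apply, hγ p, (hF (d p)).rt_eq]
    · exact (mapLab_layerLab_iff hC (hF (d p)) p (h p) _ _).2 fun l => (hη p l).trans (hg _).symm
    · obtain ⟨m, rfl⟩ := (dF (d p)).surjective y
      obtain ⟨q, hq⟩ := en.surjective ⟨p, m⟩
      have h6 : s ⟨d p, dF (d p) m⟩ = dD q :=
        (hs p m).trans (congrArg dD (en.symm_apply_eq.2 hq.symm))
      rw [h6, (hF (d p)).named.1 m]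
      refine (hD.named.1 q).trans ((h5 q).trans ?_)
      exact congrArg (fun r : Σ p, (N (d p)).1.Node =>
        (lay (N (d r.1)).1 (dF _) (fF _) r.2).mapLab (θ r.1)) hq
  choose Θ t1 t2 t3 t4 using H
  refine ⟨s, fun w => γ (Sum.map d.symm f.symm w), Θ, fun l => fD (el.symm (f.symm l)), ?_,
    fun l => h1 _, t1, ?_, t2, t3, t4⟩
  · rw [hD.underLab_eq, hC.underLab_eq, mapLab_mkLab]
    refine (mkLab_tot_iff (P.plus.substTree M (fun p => N (d p)) h) _
      (P.plus.target_substTree M (fun p => N (d p)) h) fD _).2 fun l => ?_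
    have h6 : P.plus.leafTo (P.plus.substTree M (fun p => N (d p)) h)
        (P.plus.target_substTree M (fun p => N (d p)) h) l =
          P.plus.leafAr M.1 M.2 (P.plus.substLeaf M.1 (fun p => N (d p)) h l) :=
      P.plus.leafTo_substTree M (fun p => N (d p)) h rfl _ l
    rw [h6]
    refine congrArg fD ((el.symm_apply_apply l).symm.trans (congrArg el.symm ?_))
    exact ((f.symm_apply_apply _).trans ((P.plus.leafAr M.1 M.2).symm_apply_apply _)).symm
  · refine Eq.trans (congrArg (fun w => γ (Sum.map d.symm f.symm w)) ?_) (Eq.trans (hg _)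
      (h4.symm.trans hD.rt_eq))
    exact hC.rt_eq.symm.trans (rt_eq_map M.1 d f)

end PolyMonad

/-! ### The constellation monad: uniqueness and identification with `P⁺⁺` -/

/-- The point over a unit is unique and the other fields are proofs. Positions are compared in the
total space since the composites are only propositionally equal. -/
theorem PolyEndo.MonadStr.ext_of_input {I : Type u} {E : PolyEndo I} {m m' : E.MonadStr}
    (h1 : ∀ i, m.one i = m'.one i) (h2 : ∀ b c, m.mul b c = m'.mul b c)
    (h3 : ∀ b c x, (⟨_, m.pos b c x⟩ : E.Input) = ⟨_, m'.pos b c x⟩) : m = m' := by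
  have h4 := m'.eq_pt
  obtain ⟨one, _, pt, _, _, mul, _, pos⟩ := m
  obtain ⟨one', _, pt', _, _, mul', _, pos'⟩ := m'
  obtain rfl : one = one' := funext h1
  obtain rfl : mul = mul' := funext fun b => funext (h2 b)
  obtain rfl : pt = pt' := funext fun i => h4 i (pt i)
  obtain rfl : pos = pos' := funext fun b => funext fun c => Equiv.ext fun x =>
    eq_of_heq (Sigma.mk.inj (h3 b c x)).2
  rfl

namespace PolyEndo.Constellation

theorem exists_markedCls {I : Type u} {P : PolyEndo I} (C : P.Constellation) (q : P.MarkedConst)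
    (h : q.unmark = C.cls) : ∃ x, q = C.markedCls x := by
  induction q using Quotient.inductionOn with | _ q => ?_
  obtain ⟨f⟩ := Quotient.exact h
  exact ⟨f.dot q.2, Quotient.sound ⟨f, rfl⟩⟩

end PolyEndo.Constellation

namespace PolyMonad

open PolyEndo PreTree

variable {I : Type u} {P : PolyMonad I}

/-- Every class has a representative. For a representative of the unit or of a composite under `m`,
the characterisation transfers the equation to `m'`, and `pos_eq` gives the same marked class for
both. -/
theorem IsConstellationMonad.unique {m m' : P.constEndo.MonadStr} (h : IsConstellationMonad m)
    (h' : IsConstellationMonad m') : m = m' := by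
  have key : ∀ (C : P.Constel) (c : P.constEndo.Fam C.cls), m.mul C.cls c = m'.mul C.cls c ∧
      ∀ x, (m.pos C.cls c x).1 = (m'.pos C.cls c x).1 := by
    intro C c
    choose F hF using fun x => Quotient.exists_rep (c.1 ⟨C.markedCls x, rfl⟩)
    have hF : ∀ x, c.1 ⟨C.markedCls x, rfl⟩ = (F x).cls := fun x => (hF x).symm
    obtain ⟨D, hD⟩ := Quotient.exists_rep (m.mul C.cls c)
    obtain ⟨s, hs⟩ := (h.mul_iff C c F hF D).1 hD.symm
    refine ⟨hD.symm.trans ((h'.mul_iff C c F hF D).2 ⟨s, hs⟩).symm, ?_⟩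
    rintro ⟨⟨q, hq⟩, ⟨r, hr⟩⟩
    obtain ⟨x, rfl⟩ := C.exists_markedCls q hq
    obtain ⟨y, rfl⟩ := (F x).exists_markedCls r (hr.trans (hF x))
    exact (h.pos_eq C c F hF D s hs x y).trans (h'.pos_eq C c F hF D s hs x y).symm
  have hin : ∀ (b b' : P.toPolyEndo.Const) (_ : b = b') (q : P.constEndo.Ar b)
      (q' : P.constEndo.Ar b') (_ : q.1 = q'.1), (⟨b, q⟩ : P.constEndo.Input) = ⟨b', q'⟩ := by
    rintro b _ rfl q q' h
    exact congrArg (Sigma.mk b) (Subtype.ext h)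
  refine MonadStr.ext_of_input (fun T => ?_) (fun b c => ?_) fun b c x => ?_
  · obtain ⟨C, hC⟩ := Quotient.exists_rep (m.one T)
    exact hC.symm.trans ((h'.one_iff T C).2 ((h.one_iff T C).1 hC.symm)).symm
  · induction b using Quotient.inductionOn with | _ C => exact (key C c).1
  · induction b using Quotient.inductionOn with
    | _ C => exact hin _ _ (key C c).1 _ _ ((key C c).2 x)

/-- With no second node, only unit trees can sit on the inputs of the root node, and validity fixes
their types. -/
theorem eq_corolla (Q : PolyMonad I) (M : Q.toPolyEndo.Tree) [Subsingleton M.1.Node]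
    (n : M.1.Node) : ∃ b, M = Q.corolla b := by
  obtain ⟨M, v⟩ := M
  cases M with
  | edge i => exact n.elim
  | node b ch =>
    refine ⟨b, Subtype.ext (congrArg (node b) (funext fun e => ?_))⟩
    have hr := (v e).1
    cases h : ch e with
    | edge i =>
      rw [h] at hr
      exact congrArg edge hr
    | node b' ch' =>
      let r : (ch e).Node := h ▸ (none : (node b' ch').Node)
      exact absurd (Subsingleton.elim (α := (node b ch).Node) none (some ⟨e, r⟩)) (by simp)

theorem inp_constIso (b : P.toPolyEndo.Const) (q : P.constEndo.Ar b) :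
    (constIso P).inp ⟨b, q⟩ = markTree q.1 :=
  markEquiv_eq b q

/-- Spells out the transported multiplication on representatives: composition trees are substituted
into the nodes of a composition tree, and layers correspond to pairs of nodes. -/
theorem op_mul_constIso (C : P.Constel) (c : P.constEndo.Fam C.cls)
    (F : Fin C.nest.dots → P.Constel) (hF : ∀ x, c.1 ⟨C.markedCls x, rfl⟩ = (F x).cls) :
    ∃ h : ∀ p, P.plus.target (tree (F (dots C p))) = (tree C).1.dec p,
      constTree ((constIso P).monadStr.mul C.cls c) =
        P.plus.substTree (tree C) (fun p => tree (F (dots C p))) h ∧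
      ∀ p m, markTree ((constIso P).monadStr.pos C.cls c ⟨⟨C.markedCls (dots C p), rfl⟩,
        ⟨(F (dots C p)).markedCls (dots _ m), (hF _).symm⟩⟩).1 =
        ⟨_, P.plus.plusPos (tree C) ⟨fun p => tree (F (dots C p)), h⟩ ⟨p, m⟩⟩ := by
  have hC := exists_pres_tree C
  have h : ∀ p, P.plus.target (tree (F (dots C p))) = (tree C).1.dec p := by
    intro p
    obtain ⟨f, hC⟩ := hC
    obtain ⟨f', hF'⟩ := exists_pres_tree (F (dots C p))
    refine hF'.underlying_eq.symm.trans (Eq.trans ?_ (hC.named.layerTree_eq p))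
    exact (congrArg P.constEndo.tgt (hF (dots C p))).symm.trans (c.2 _)
  have hm : ∀ (C : P.Constel) (p : (tree C).1.Node), markTree (C.markedCls (dots C p)) =
      ⟨tree C, p⟩ := fun C p => congrArg (Sigma.mk _) ((dots C).symm_apply_apply p)
  have hc : ∀ e (e' : (tree C).1.Node), (constIso P).inp ⟨C.cls, e⟩ = ⟨tree C, e'⟩ →
      tree (F (dots C e')) = (constIso P).op (c.1 e) := by
    rintro ⟨q, hq⟩ e' he
    obtain ⟨x, rfl⟩ := C.exists_markedCls q hq
    obtain ⟨p, rfl⟩ := (dots C).surjective x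
    have h1 := (hm C p).symm.trans ((inp_constIso C.cls _).symm.trans he)
    obtain rfl : p = e' := eq_of_heq (Sigma.mk.inj h1).2
    exact (congrArg constTree (hF (dots C p))).symm
  let c' : P.plus.plus.Fam (tree C) := ⟨fun p => tree (F (dots C p)), h⟩
  refine ⟨h, (constIso P).op_mul (b := C.cls) (c := c) (B := tree C) rfl (c' := c') hc, fun p m => ?_⟩
  refine (inp_constIso _ _).symm.trans ?_
  exact (constIso P).inp_pos (b := C.cls) (c := c) (B := tree C) rfl (c' := c') hc (e' := p)
    ((inp_constIso _ _).trans (hm C p)) (f' := m) ((inp_constIso _ _).trans (hm _ m))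

/-- A single layer means a composition tree with one node. Such a tree is a corolla, and a corolla
is determined by its composite, which is the underlying tree of the constellation. -/
theorem one_constIso (T : P.toPolyEndo.Tree) (C : P.Constel) :
    (constIso P).monadStr.one T = C.cls ↔ C.nest.dots = 1 ∧ C.underlying = T := by
  obtain ⟨M, d, f, h⟩ := exists_pres C
  have h1 : (constIso P).monadStr.one T = C.cls ↔ P.plus.corolla T = M := by
    rw [← h.constTree_eq]
    exact (constIso P).op.symm_apply_eq
  rw [h1]
  constructor
  · rintro rfl
    have hs : ∀ n : (P.plus.corolla T).1.Node, n = none := fun n => match n with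
      | none => rfl
      | some n => PEmpty.elim n.2
    refine ⟨?_, h.underlying_eq.trans (P.plus.target_corolla T)⟩
    have : Subsingleton (Fin C.nest.dots) := ⟨fun x y =>
      d.symm.injective ((hs _).trans (hs _).symm)⟩
    have h2 := Fin.subsingleton_iff_le_one.1 this
    have h3 : Fin C.nest.dots := d none
    have := h3.pos
    lia
  · rintro ⟨h2, rfl⟩
    have : Subsingleton (Fin C.nest.dots) := Fin.subsingleton_iff_le_one.2 h2.le
    have := d.subsingleton
    obtain ⟨T, rfl⟩ := eq_corolla P.plus M (d.symm ⟨0, by lia⟩)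
    exact congrArg _ (h.underlying_eq.trans (P.plus.target_corolla T))

theorem isConstellationMonad_constIso : IsConstellationMonad (constIso P).monadStr where
  one_iff := one_constIso
  mul_iff C c F hF D := by
    obtain ⟨h, h1, -⟩ := op_mul_constIso C c F hF
    obtain ⟨f, hC⟩ := exists_pres_tree C
    choose fF hF' using fun x => exists_pres_tree (F x)
    obtain ⟨fD, hD⟩ := exists_pres_tree D
    constructor
    · intro hm
      have h2 : tree D = _ := (congrArg constTree hm).symm.trans h1
      -- The numbering of `tree D` is generalised first, so that `tree D` can be replaced by the
      -- substituted tree although the numbering depends on it.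
      revert fD
      generalize dots D = dD
      revert dD
      rw [h2]
      intro dD fD hD
      exact exists_isSubst hC hF' h hD
    · rintro ⟨s, hs⟩
      refine constTree_bijective.1 (h1.trans ?_)
      exact congrArg Sigma.fst (hs.tree_eq hC hF' h hD)
  pos_eq C c F hF D s hs x y := by
    obtain ⟨h, -, h1⟩ := op_mul_constIso C c F hF
    obtain ⟨f, hC⟩ := exists_pres_tree C
    choose fF hF' using fun x => exists_pres_tree (F x)
    obtain ⟨fD, hD⟩ := exists_pres_tree D
    obtain ⟨p, rfl⟩ := (dots C).surjective x
    obtain ⟨m, rfl⟩ := (dots _).surjective y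
    refine markTree_bijective.1 ((h1 p m).trans ?_)
    have key : ∀ (A B : P.plus.toPolyEndo.Tree) (α : A.1.Node → Fin D.nest.dots)
        (β : B.1.Node ≃ Fin D.nest.dots) (_ : (⟨A, α⟩ : Σ M : P.plus.toPolyEndo.Tree,
          (M.1.Node → Fin D.nest.dots)) = ⟨B, β⟩) (q : A.1.Node),
        (⟨A, q⟩ : Σ M : P.plus.toPolyEndo.Tree, M.1.Node) = ⟨B, β.symm (α q)⟩ := by
      intro A B α β h q
      cases h
      rw [β.symm_apply_apply]
    refine (key _ _ _ _ (hs.tree_eq hC hF' h hD) _).trans (congrArg (Sigma.mk _) ?_)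
    exact congrArg (fun r : Σ p, (tree (F (dots C p))).1.Node =>
      (dots D).symm (s ⟨dots C r.1, dots _ r.2⟩))
      (P.plus.substNode_plusPos (tree C) ⟨fun p => tree (F (dots C p)), h⟩ ⟨p, m⟩)

end PolyMonad

theorem mainTheorem1 {I : Type u} (P : PolyMonad I) :
    (∃! m : P.constEndo.MonadStr, PolyMonad.IsConstellationMonad m) ∧
    ∀ m : P.constEndo.MonadStr, PolyMonad.IsConstellationMonad m →
      ∃ φ : PolyMonadIso ⟨P.constEndo, m⟩ P.plus.plus,
        ∀ C : P.Constel, PolyMonad.IsCompositionTree C (φ.op C.cls).1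
          (fun x => φ.ar C.cls ⟨C.markedCls x, rfl⟩) := by
  have h := PolyMonad.isConstellationMonad_constIso (P := P)
  refine ⟨⟨_, h, fun m hm => hm.unique h⟩, fun m hm => ?_⟩
  -- By uniqueness `m` is the transported structure, for which the bijections form an isomorphism of
  -- monads by construction.
  obtain rfl := h.unique hm
  exact ⟨(PolyMonad.constIso P).monadIso, PolyMonad.isCompositionTree_constIso⟩
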